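/- Let $n \ge 5$. An algebraic curvature tensor on $\mathbb{R}^n$ is a four-tensor $R$ with $R_{ijkl} = -R_{jikl} = R_{klij}$ and $R_{ijkl}+R_{iklj}+R_{iljk}=0$. Put $\mathrm{Ric}_{ik} = \sum_j R_{ijkj}$, $\mathrm{scal} = \mathrm{tr}(\mathrm{Ric})$, $\mathrm{Ric}_0 = \mathrm{Ric} - \frac1n\,\mathrm{scal}\,\mathrm{id}$, and $$Q(R)_{ijkl} = \sum_{p,q=1}^n R_{ijpq}R_{klpq} + 2\sum_{p,q=1}^n (R_{ipkq}R_{jplq} - R_{iplq}R_{jpkq}).$$ For symmetric bilinear forms $A,B$ let $(A \owedge B)_{ijkl} = A_{ik}B_{jl}-A_{il}B_{jk}-A_{jk}B_{il}+A_{jl}B_{ik}$ be the Kulkarni--Nomizu product. A curvature tensor has nonnegative isotropic curvature if $R(e_1,e_3,e_1,e_3)+R(e_1,e_4,e_1,e_4)+R(e_2,e_3,e_2,e_3)+R(e_2,e_4,e_2,e_4)-2R(e_1,e_2,e_3,e_4) \ge 0$ for every orthonormal four-frame; $R \in \mathrm{PIC2}$ means that the curvature tensor induced by $R$ on the product $\mathbb{R}^n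 \times \mathbb{R}^2$ with a flat factor has nonnegative isotropic curvature. For $\sigma \in (0,2]$ and $\theta \ge 0$ let $$\mathcal{C}_{\sigma,\theta} = \{ S + H \owedge \mathrm{id} : S \in \mathrm{PIC2},\ \mathrm{Ric}_0(S) = 0,\ \mathrm{tr}(H)\,\mathrm{id} - (n-2\sigma)H \ge 0,\ \mathrm{tr}(H) - \theta\,\mathrm{scal}(S) \ge 0 \},$$ where $S$ ranges over algebraic curvature tensors and $H$ over symmetric bilinear forms on $\mathbb{R}^n$. **Theorem.** For each $n \ge 5$ there is a constant $\bar\theta = \bar\theta(n) > 0$ with the following properties. (i) For every $\sigma \in (0,2]$ and every $\theta \in [0,\bar\theta]$ the cone $\mathcal{C}_{\sigma,\theta}$ is invariant under the Hamilton ODE $\frac{d}{dt}R = Q(R)$: every solution $R(t)$, $t \in [0,T)$, with $R(0) \in \mathcal{C}_{\sigma,\theta}$ satisfies $R(t) \in \mathcal{C}_{\sigma,\theta}$ for all $t \in [0,T)$. (ii) For every $\sigma \in (0,1)\cup(1,2)$ and every $\theta \in (0,\bar\theta)$ the cone $\mathcal{C}_{\sigma,\theta}$ is transversally invariant away from $0$: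 for every $R \in \mathcal{C}_{\sigma,\theta} \setminus \{0\}$ the tensor $Q(R)$ lies in the interior, relative to the space of algebraic curvature tensors, of the tangent cone to $\mathcal{C}_{\sigma,\theta}$ at $R$. -/

import Mathlib

namespace PinchingCones

noncomputable section

/-- Covariant four-tensors on `ℝ^ι`, given by their components in the standard orthonormal basis. -/
abbrev Tensor4 (ι : Type*) := ι → ι → ι → ι → ℝ

/-- The vector space of algebraic curvature tensors on `ℝ^ι`. As a subspace of the
finite-dimensional space of four-tensors it carries its usual vector space topology. -/
def AlgCurv (ι : Type*) : Submodule ℝ (Tensor4 ι) where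
  carrier := {R | (∀ i j k l, R i j k l = -R j i k l) ∧ (∀ i j k l, R i j k l = R k l i j) ∧
    ∀ i j k l, R i j k l + R i k l j + R i l j k = 0}
  add_mem' := by
    rintro R R' ⟨h1, h2, h3⟩ ⟨h1', h2', h3'⟩
    refine ⟨fun i j k l => ?_, fun i j k l => ?_, fun i j k l => ?_⟩ <;> simp only [Pi.add_apply]
    · linarith [h1 i j k l, h1' i j k l]
    · linarith [h2 i j k l, h2' i j k l]
    · linarith [h3 i j k l, h3' i j k l]
  zero_mem' := by
    refine ⟨fun i j k l => ?_, fun i j k l => ?_, fun i j k l => ?_⟩ <;> simp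
  smul_mem' := by
    rintro c R ⟨h1, h2, h3⟩
    refine ⟨fun i j k l => ?_, fun i j k l => ?_, fun i j k l => ?_⟩ <;>
      simp only [Pi.smul_apply, smul_eq_mul]
    · rw [h1 i j k l]; ring
    · rw [h2 i j k l]
    · rw [← mul_add, ← mul_add, h3 i j k l, mul_zero]

section Algebra

variable {ι : Type*} [Fintype ι]

/-- The bilinear expression `B(S,T)`. -/
def curvB (S T : Tensor4 ι) : Tensor4 ι := fun i j k l =>
  (1 / 2) * ∑ p, ∑ q, (S i j p q * T k l p q + S k l p q * T i j p q) +
    ∑ p, ∑ q, (S i p k q * T j p l q - S i p l q * T j p k q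
      - S j p k q * T i p l q + S j p l q * T i p k q)

/-- `∑ R_{ipjq} R_{kplq}`, used only to check the symmetries of `B(R,R)`. -/
def auxB (R : Tensor4 ι) (i j k l : ι) : ℝ := ∑ p, ∑ q, R i p j q * R k p l q

theorem curvB_self (R : AlgCurv ι) (i j k l : ι) :
    curvB R.1 R.1 i j k l = 2 * (auxB R.1 i j k l - auxB R.1 i j l k
      + auxB R.1 i k j l - auxB R.1 i l j k) := by
  obtain ⟨R, h1, h2, h3⟩ := R
  have hb : ∀ i j p q, R i j p q = R i p j q - R i q j p := fun i j p q => by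
    have a := h3 i j p q
    have b := h2 i p q j
    have c := h1 q j i p
    have d := h2 j q i p
    linarith
  have e1 : ∑ p, ∑ q, R i q j p * R k q l p = auxB R i j k l := Finset.sum_comm
  have e2 : ∑ p, ∑ q, R i q j p * R k p l q = auxB R i j l k := by
    rw [Finset.sum_comm]
    refine Finset.sum_congr rfl fun p _ => Finset.sum_congr rfl fun q _ => ?_
    rw [h2 k q l p]
  have e3 : ∑ p, ∑ q, R i p j q * R k q l p = auxB R i j l k := by
    refine Finset.sum_congr rfl fun p _ => Finset.sum_congr rfl fun q _ => ?_
    rw [h2 k q l p]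
  have key : ∑ p, ∑ q, R i j p q * R k l p q = 2 * auxB R i j k l - 2 * auxB R i j l k := by
    have : ∀ p q, R i j p q * R k l p q = R i p j q * R k p l q - R i p j q * R k q l p
        - R i q j p * R k p l q + R i q j p * R k q l p := fun p q => by
      rw [hb i j p q, hb k l p q]; ring
    simp only [this, Finset.sum_add_distrib, Finset.sum_sub_distrib, e1, e2, e3]
    simp only [auxB]; ring
  have k1 : ∑ p, ∑ q, (R i j p q * R k l p q + R k l p q * R i j p q)
      = 2 * ∑ p, ∑ q, R i j p q * R k l p q := by
    simp only [Finset.mul_sum]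
    exact Finset.sum_congr rfl fun p _ => Finset.sum_congr rfl fun q _ => by ring
  have k2 : ∑ p, ∑ q, (R i p k q * R j p l q - R i p l q * R j p k q
      - R j p k q * R i p l q + R j p l q * R i p k q)
      = 2 * auxB R i k j l - 2 * auxB R i l j k := by
    simp only [auxB, Finset.mul_sum, ← Finset.sum_sub_distrib]
    exact Finset.sum_congr rfl fun p _ => Finset.sum_congr rfl fun q _ => by ring
  simp only [curvB, k1, k2, key]
  ring

theorem curvB_self_mem (R : AlgCurv ι) : curvB R.1 R.1 ∈ AlgCurv ι := by
  refine ⟨fun i j k l => ?_, fun i j k l => ?_, fun i j k l => ?_⟩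
  · have h1 := R.2.1
    simp only [curvB]
    rw [neg_add, ← mul_neg, ← Finset.sum_neg_distrib, ← Finset.sum_neg_distrib]
    simp only [← Finset.sum_neg_distrib]
    congr 1
    · congr 1
      refine Finset.sum_congr rfl fun p _ => Finset.sum_congr rfl fun q _ => ?_
      rw [h1 i j p q]; ring
    · exact Finset.sum_congr rfl fun p _ => Finset.sum_congr rfl fun q _ => by ring
  · have h2 := R.2.2.1
    have hs : ∀ a b c d, auxB R.1 a b c d = auxB R.1 c d a b := fun a b c d =>
      Finset.sum_congr rfl fun p _ => Finset.sum_congr rfl fun q _ => by ring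
    have ht : ∀ a b c d, auxB R.1 a b c d = auxB R.1 b a d c := fun a b c d => by
      simp only [auxB]
      rw [Finset.sum_comm]
      refine Finset.sum_congr rfl fun p _ => Finset.sum_congr rfl fun q _ => ?_
      rw [h2 a q b p, h2 c q d p]
    rw [curvB_self, curvB_self, hs k l i j, hs k l j i, ht k i l j, ht j i k l, hs k j l i,
      ht l i k j, hs i l j k, ht j k i l]
  · rw [curvB_self, curvB_self, curvB_self]
    ring

/-- The quadratic term `Q(R) = B(R,R)` of the Hamilton ODE. -/
def Q (R : AlgCurv ι) : AlgCurv ι := ⟨curvB R.1 R.1, curvB_self_mem R⟩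

/-- The Kulkarni-Nomizu product of two symmetric bilinear forms. -/
def kn (A B : Matrix ι ι ℝ) : Tensor4 ι := fun i j k l =>
  A i k * B j l - A i l * B j k - A j k * B i l + A j l * B i k

/-- The Ricci tensor `Ric_{ik} = ∑_j R_{ijkj}`. -/
def ric (R : AlgCurv ι) : Matrix ι ι ℝ := Matrix.of fun i k => ∑ j, R.1 i j k j

/-- The scalar curvature. -/
def scal (R : AlgCurv ι) : ℝ := (ric R).trace

/-- The trace-free Ricci tensor. -/
def ric0 [DecidableEq ι] (R : AlgCurv ι) : Matrix ι ι ℝ :=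
  ric R - (scal R / Fintype.card ι) • (1 : Matrix ι ι ℝ)

/-- The value `R(x,y,z,w)` of a curvature tensor on four vectors. -/
def evalCurv (R : AlgCurv ι) (x y z w : EuclideanSpace ℝ ι) : ℝ :=
  ∑ i, ∑ j, ∑ k, ∑ l, R.1 i j k l * x i * y j * z k * w l

/-- Nonnegative isotropic curvature:
`R₁₃₁₃ + R₁₄₁₄ + R₂₃₂₃ + R₂₄₂₄ - 2 R₁₂₃₄ ≥ 0` for every orthonormal four-frame. -/
def NonnegIsotropic (R : AlgCurv ι) : Prop :=
  ∀ e : Fin 4 → EuclideanSpace ℝ ι, Orthonormal ℝ e →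
    0 ≤ evalCurv R (e 0) (e 2) (e 0) (e 2) + evalCurv R (e 0) (e 3) (e 0) (e 3)
      + evalCurv R (e 1) (e 2) (e 1) (e 2) + evalCurv R (e 1) (e 3) (e 1) (e 3)
      - 2 * evalCurv R (e 0) (e 1) (e 2) (e 3)

end Algebra

/-- The components of the product of `R` with a flat factor `ℝ^κ`. -/
def prodFlatTensor {ι : Type*} (κ : Type*) (R : Tensor4 ι) : Tensor4 (ι ⊕ κ)
  | .inl i, .inl j, .inl k, .inl l => R i j k l
  | _, _, _, _ => 0

/-- The curvature tensor of the product with a flat factor `ℝ^κ`, on `ℝ^ι × ℝ^κ`. -/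
def prodFlat {ι : Type*} (κ : Type*) (R : AlgCurv ι) : AlgCurv (ι ⊕ κ) :=
  ⟨prodFlatTensor κ R.1, by
    obtain ⟨R, h1, h2, h3⟩ := R
    refine ⟨?_, ?_, ?_⟩ <;> rintro (i | i) (j | j) (k | k) (l | l) <;>
      simp only [prodFlatTensor, neg_zero, add_zero]
    · exact h1 i j k l
    · exact h2 i j k l
    · exact h3 i j k l⟩

/-- The PIC2 cone: the product with a flat `ℝ²` has nonnegative isotropic curvature. -/
def PIC2 (ι : Type*) [Fintype ι] : Set (AlgCurv ι) :=
  {R | NonnegIsotropic (prodFlat (Fin 2) R)}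

/-- The cone `C_{σ,θ}` of curvature tensors on `ℝⁿ`. -/
def pinchingCone (n : ℕ) (σ θ : ℝ) : Set (AlgCurv (Fin n)) :=
  {R | ∃ (S : AlgCurv (Fin n)) (H : Matrix (Fin n) (Fin n) ℝ), H.IsSymm ∧
    R.1 = S.1 + kn H 1 ∧ S ∈ PIC2 (Fin n) ∧ ric0 S = 0 ∧
    (H.trace • (1 : Matrix (Fin n) (Fin n) ℝ) - ((n : ℝ) - 2 * σ) • H).PosSemidef ∧
    0 ≤ H.trace - θ * scal S}

/-- `R` solves the Hamilton ODE `dR/dt = Q(R)` on `[0,T)` (one-sided derivative at `0`). -/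
def IsHamiltonSolution {n : ℕ} (R : ℝ → AlgCurv (Fin n)) (T : ℝ) : Prop :=
  ∀ t ∈ Set.Ico 0 T, HasDerivWithinAt R (Q (R t)) (Set.Ico 0 T) t

/-- Every solution of the Hamilton ODE that starts in `F` stays in `F` for as long as it exists. -/
def HamiltonInvariant {n : ℕ} (F : Set (AlgCurv (Fin n))) : Prop :=
  ∀ (T : ℝ) (R : ℝ → AlgCurv (Fin n)), IsHamiltonSolution R T → R 0 ∈ F →
    ∀ t ∈ Set.Ico 0 T, R t ∈ F

/-- At each nonzero point of `F`, the vector `Q(R)` is interior to the tangent cone of `F` at `R`;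
the interior is taken in the space of algebraic curvature tensors. (At interior points of `F` the
tangent cone is the whole space, so that this is a condition on the boundary points.) -/
def TransversallyInvariantAwayFromZero {n : ℕ} (F : Set (AlgCurv (Fin n))) : Prop :=
  ∀ R ∈ F, R ≠ 0 → Q R ∈ interior (posTangentConeAt F R)

end

end PinchingCones

/-! Write `R = S + H ∧ id` with `Ric₀(S) = 0`. The trace-free part `K` of `H` must be
`Ric₀(R)/(n-2)`, so the only freedom is `h = tr(H)/n`. Raising `h` lowers the complex sectional
curvatures of `S`, while both conditions on `H` are lower bounds for `h` that are linear in `R` once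
a unit vector is fixed. Eliminating `h` turns the cone into an intersection of half-spaces indexed
by a compact set: a choice of lower bound, a unit vector and a unitary pair in `ℂⁿ`
(`pinchingCone_eq_familyCone`). The unitary pairs enter because PIC2 means exactly `S(z,w,z̄,w̄) ≥
0` for all complex `z, w`.

For such a cone everything is decided by the sign of `ℓ(Q(R))` at points where a defining functional
satisfies `ℓ(R) = 0`. The sign `≥ 0` gives invariance by a maximum principle
(`mem_familyCone_of_null_vector_condition`); strict positivity gives an interior point of the
tangent cone (`mem_interior_posTangentConeAt_familyCone`).

To find the sign, expand `Q(R) = Q(S) + ((n-2) K ∧ K + 2 K² ∧ id) + V ∧ id`. The first two summands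
have pure-trace Ricci tensor, so the trace-free part of `V` is the velocity of `K`. On the active
plane `S` has zero complex sectional curvature, and a second variation argument makes that of `Q(S)`
nonnegative there (`csec_Q_nonneg`). The other terms are compared with the velocity of the active
lower bound for `h`.

If the eigenvalue bound is active, let `k` be the largest eigenvalue of `K` and `P = k id - K ≥ 0`,
a matrix of trace `nk`. Trace inequalities for the compression of `P` to the plane bound `ℓ(Q(R))`
below, up to a positive factor, by `(nk)²(1-σ)²` or by `(nk)²(1-σ/2)²` (`warp_pinching`,
`eigenvalue_face`). These degenerate at `σ = 1` and `σ = 2`, the values excluded in the transversal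
statement. If the scalar bound is active, then `h = θ s`, where `Ric(S) = s id`; for small `θ` the
term `2sh` dominates the terms of order `|K|²`, since `|K|²` is at most a constant times `h²`
(`scalar_face`).

Strictness also needs `h > 0`. For `θ > 0`, the value `h = 0` forces `K = 0` and `scal(R) ≤ 0`, and
then `R = 0`. -/

namespace PinchingCones

noncomputable section

open Filter Topology Set

/-! ### Cones cut out by compact families of functionals: tangent cones and the maximum principle.
-/

section CompactFamily

variable {E Y : Type*} [NormedAddCommGroup E] [NormedSpace ℝ E] [TopologicalSpace Y]

/-- The closed convex cone cut out by a family of linear functionals. -/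
def familyCone (K : Set Y) (ℓ : Y → E →ₗ[ℝ] ℝ) : Set E := {x | ∀ v ∈ K, 0 ≤ ℓ v x}

/-- Functionals active at `x` increase along every direction close to `y`, and inactive ones stay
positive for a short time. Compactness of `K` makes both the neighbourhood of `y` and the length of
the step uniform in `v`. -/
theorem mem_interior_posTangentConeAt_familyCone {K : Set Y} (hK : IsCompact K)
    {ℓ : Y → E →ₗ[ℝ] ℝ} (hℓ : Continuous fun p : E × Y => ℓ p.2 p.1) {x y : E}
    (hx : x ∈ familyCone K ℓ) (hy : ∀ v ∈ K, ℓ v x = 0 → 0 < ℓ v y) :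
    y ∈ interior (posTangentConeAt (familyCone K ℓ) x) := by
  have hℓx : Continuous fun v => ℓ v x := hℓ.comp (by fun_prop : Continuous fun v : Y => (x, v))
  have hpos : ∀ v ∈ K, ℓ v x ≠ 0 → 0 < ℓ v x := fun v hv h => lt_of_le_of_ne (hx v hv) (Ne.symm h)
  rw [mem_interior_iff_mem_nhds]
  have hy' : ∀ᶠ y' in 𝓝 y, ∀ v ∈ K, 0 < ℓ v x ∨ 0 < ℓ v y' := by
    refine hK.eventually_forall_of_forall_eventually fun v hv => ?_
    by_cases h0 : ℓ v x = 0
    · have : ∀ᶠ z : E × Y in 𝓝 (y, v), 0 < ℓ z.2 z.1 :=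
        hℓ.continuousAt.eventually (lt_mem_nhds (hy v hv h0))
      exact this.mono fun z hz => Or.inr hz
    · have : ∀ᶠ z : E × Y in 𝓝 (y, v), 0 < ℓ z.2 x :=
        (hℓx.comp continuous_snd).continuousAt.eventually (lt_mem_nhds (hpos v hv h0))
      exact this.mono fun z hz => Or.inl hz
  filter_upwards [hy'] with y' hy'
  refine mem_posTangentConeAt_of_frequently_mem (Eventually.frequently ?_)
  have hc : Continuous fun z : ℝ × Y => ℓ z.2 x + z.1 * ℓ z.2 y' := by
    have h1 : Continuous fun z : ℝ × Y => ℓ z.2 x := hℓx.comp continuous_snd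
    have h2 : Continuous fun z : ℝ × Y => ℓ z.2 y' :=
      hℓ.comp (by fun_prop : Continuous fun z : ℝ × Y => (y', z.2))
    exact h1.add (continuous_fst.mul h2)
  have h2c : Continuous fun z : ℝ × Y => ℓ z.2 y' :=
      hℓ.comp (by fun_prop : Continuous fun z : ℝ × Y => (y', z.2))
  have hev : ∀ᶠ t in 𝓝 (0 : ℝ), ∀ v ∈ K, 0 < ℓ v x + t * ℓ v y' ∨ 0 < ℓ v y' := by
    refine hK.eventually_forall_of_forall_eventually fun v hv => ?_
    rcases hy' v hv with h | h
    · have : ∀ᶠ z : ℝ × Y in 𝓝 (0, v), 0 < ℓ z.2 x + z.1 * ℓ z.2 y' :=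
        hc.continuousAt.eventually (lt_mem_nhds (by simpa using h))
      exact this.mono fun z hz => Or.inl hz
    · have : ∀ᶠ z : ℝ × Y in 𝓝 (0, v), 0 < ℓ z.2 y' :=
        h2c.continuousAt.eventually (lt_mem_nhds (by simpa using h))
      exact this.mono fun z hz => Or.inr hz
  filter_upwards [nhdsWithin_le_nhds hev, self_mem_nhdsWithin] with t ht ht0 v hv
  rw [map_add, map_smul, smul_eq_mul]
  rcases ht v hv with h | h
  · exact h.le
  · exact add_nonneg (hx v hv) (mul_nonneg (le_of_lt ht0) h.le)

/-- A maximum principle for ODEs: if the vector field points inwards along every face of the cone,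
then solutions do not leave it. -/
theorem mem_familyCone_of_null_vector_condition [T2Space Y] {K : Set Y} (hK : IsCompact K)
    {ℓ : Y → E →ₗ[ℝ] ℝ} (hℓ : Continuous fun p : E × Y => ℓ p.2 p.1) {e : E}
    (he : ∀ v ∈ K, 0 < ℓ v e) {f : E → E} {g : E → ℝ → E}
    (hg : Continuous fun p : E × ℝ => g p.1 p.2) (hfg : ∀ x δ, f (x + δ • e) = f x + δ • g x δ)
    (hf : ∀ x ∈ familyCone K ℓ, ∀ v ∈ K, ℓ v x = 0 → 0 ≤ ℓ v (f x))
    {T : ℝ} {x : ℝ → E} (hx : ∀ t ∈ Ico 0 T, HasDerivWithinAt x (f (x t)) (Ico 0 T) t)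
    (h0 : x 0 ∈ familyCone K ℓ) {t₁ : ℝ} (ht₁ : t₁ ∈ Ico 0 T) : x t₁ ∈ familyCone K ℓ := by
  rcases K.eq_empty_or_nonempty with rfl | hne
  · intro v hv; simp at hv
  have hsub : Icc 0 t₁ ⊆ Ico 0 T := fun t ht => ⟨ht.1, ht.2.trans_lt ht₁.2⟩
  have hxc : ContinuousOn x (Icc 0 t₁) := fun t ht =>
    ((hx t (hsub ht)).continuousWithinAt).mono hsub
  obtain ⟨v₀, hv₀, hmin⟩ := hK.exists_isMinOn hne
    (hℓ.comp (by fun_prop : Continuous fun v : Y => (e, v))).continuousOn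
  set c := ℓ v₀ e with hcdef
  have hc : 0 < c := he v₀ hv₀
  have hcle : ∀ v ∈ K, c ≤ ℓ v e := fun v hv => hmin hv
  have hcomp : IsCompact ((Icc 0 t₁ ×ˢ Icc (0 : ℝ) 1) ×ˢ K) :=
    (isCompact_Icc.prod isCompact_Icc).prod hK
  have hcont : ContinuousOn (fun p : (ℝ × ℝ) × Y => ℓ p.2 (g (x p.1.1) p.1.2))
      ((Icc 0 t₁ ×ˢ Icc (0 : ℝ) 1) ×ˢ K) := by
    have hx1 : ContinuousOn (fun p : (ℝ × ℝ) × Y => x p.1.1)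
        ((Icc 0 t₁ ×ˢ Icc (0 : ℝ) 1) ×ˢ K) :=
      hxc.comp (by fun_prop) fun p hp => hp.1.1
    have hg1 := hg.comp_continuousOn (hx1.prodMk
      (by fun_prop : ContinuousOn (fun p : (ℝ × ℝ) × Y => p.1.2) _))
    exact hℓ.comp_continuousOn (hg1.prodMk continuous_snd.continuousOn)
  obtain ⟨C, hC⟩ := (hcomp.image_of_continuousOn hcont).bddAbove
  have hC' : ∀ t ∈ Icc 0 t₁, ∀ δ ∈ Icc (0 : ℝ) 1, ∀ v ∈ K, ℓ v (g (x t) δ) ≤ C :=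
    fun t ht δ hδ v hv => hC ⟨((t, δ), v), ⟨⟨ht, hδ⟩, hv⟩, rfl⟩
  -- The rate `L` is chosen so that `L * ℓ v e` exceeds the bound `C` on `ℓ v (g (x t) δ)`: moving
  -- the barrier outpaces the error made by evaluating `f` at the perturbed point.
  set L := (|C| + 1) / c with hL
  have hLpos : 0 < L := by positivity
  have hLc : |C| + 1 = L * c := by rw [hL]; field_simp
  -- Perturb the solution into the interior by `ε exp(Lt) e`. The restriction on `ε` keeps the
  -- coefficient of `e` at most `1` on `[0, t₁]`, the range in which `C` is a valid bound.
  have key : ∀ ε, 0 < ε → ε ≤ Real.exp (-(L * t₁)) → ∀ t ∈ Icc 0 t₁, ∀ v ∈ K,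
      0 < ℓ v (x t + (ε * Real.exp (L * t)) • e) := by
    intro ε hε hε1
    by_contra! hbad
    set δ : ℝ → ℝ := fun t => ε * Real.exp (L * t) with hδ
    have hδc : Continuous δ := by fun_prop
    have hδ1 : ∀ t ∈ Icc 0 t₁, δ t ∈ Icc (0 : ℝ) 1 := by
      intro t ht
      refine ⟨by positivity, ?_⟩
      calc δ t ≤ Real.exp (-(L * t₁)) * Real.exp (L * t₁) := by
            simp only [hδ]; gcongr; exact ht.2
        _ = 1 := by rw [← Real.exp_add]; simp
    have hyc : ContinuousOn (fun t => x t + δ t • e) (Icc 0 t₁) := by fun_prop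
    have hFc : ContinuousOn (fun p : ℝ × Y => ℓ p.2 (x p.1 + δ p.1 • e)) (Icc 0 t₁ ×ˢ K) := by
      have h1 : ContinuousOn (fun p : ℝ × Y => x p.1 + δ p.1 • e) (Icc 0 t₁ ×ˢ K) :=
        hyc.comp continuous_fst.continuousOn fun p hp => hp.1
      exact hℓ.comp_continuousOn (h1.prodMk continuous_snd.continuousOn)
    set B : Set (ℝ × Y) := (Icc 0 t₁ ×ˢ K) ∩ {p | ℓ p.2 (x p.1 + δ p.1 • e) ≤ 0} with hB
    have hBne : B.Nonempty := by
      obtain ⟨t, ht, v, hv, h⟩ := hbad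
      exact ⟨(t, v), ⟨ht, hv⟩, h⟩
    have hBc : IsCompact B := (isCompact_Icc.prod hK).of_isClosed_subset
      (hFc.preimage_isClosed_of_isClosed (isClosed_Icc.prod hK.isClosed) isClosed_Iic)
      inter_subset_left
    obtain ⟨t₀, ⟨⟨t₀', v⟩, ⟨⟨ht₀, hv⟩, hle⟩, rfl⟩, hleast⟩ :=
      (hBc.image continuous_fst).exists_isLeast (hBne.image _)
    change ℓ v (x t₀' + δ t₀' • e) ≤ 0 at hle
    change t₀' ∈ Icc 0 t₁ at ht₀
    change v ∈ K at hv
    have hbefore : ∀ t ∈ Ico 0 t₀', ∀ w ∈ K, 0 < ℓ w (x t + δ t • e) := by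
      intro t ht w hw
      by_contra! h
      exact absurd (hleast ⟨(t, w), ⟨⟨⟨ht.1, ht.2.le.trans ht₀.2⟩, hw⟩, h⟩, rfl⟩) (not_le.2 ht.2)
    have hδpos : ∀ t, 0 < δ t := fun t => by positivity
    have ht₀pos : 0 < t₀' := by
      rcases ht₀.1.eq_or_lt with h | h
      · exfalso
        rw [← h, map_add, map_smul, smul_eq_mul] at hle
        exact absurd hle (not_le.2 (add_pos_of_nonneg_of_pos (h0 v hv)
          (mul_pos (hδpos 0) (he v hv))))
      · exact h
    have hxd : HasDerivAt x (f (x t₀')) t₀' :=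
      (hx t₀' (hsub ht₀)).hasDerivAt (Ico_mem_nhds ht₀pos (hsub ht₀).2)
    have hδd : HasDerivAt δ (L * δ t₀') t₀' := by
      have h1 : HasDerivAt (fun t => L * t) L t₀' := by
        simpa using (hasDerivAt_id t₀').const_mul L
      refine (h1.exp.const_mul ε).congr_deriv ?_
      simp only [hδ]; ring
    have hnear : ∀ᶠ t in 𝓝[<] t₀', t ∈ Ico 0 t₀' := Ico_mem_nhdsLT ht₀pos
    have hmem : x t₀' + δ t₀' • e ∈ familyCone K ℓ := by
      intro w hw
      have hcw : Tendsto (fun t => ℓ w (x t + δ t • e)) (𝓝[<] t₀')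
          (𝓝 (ℓ w (x t₀' + δ t₀' • e))) := by
        have h1 : ContinuousAt (fun t => x t + δ t • e) t₀' :=
          hxd.continuousAt.add (hδc.continuousAt.smul continuousAt_const)
        have h2 : Continuous (ℓ w) := hℓ.comp (by fun_prop : Continuous fun z : E => (z, w))
        exact (h2.continuousAt.comp h1).tendsto.mono_left nhdsWithin_le_nhds
      exact ge_of_tendsto hcw (hnear.mono fun t ht => (hbefore t ht w hw).le)
    have hzero : ℓ v (x t₀' + δ t₀' • e) = 0 := le_antisymm hle (hmem v hv)
    have hnull := hf _ hmem v hv hzero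
    rw [hfg, map_add, map_smul, smul_eq_mul] at hnull
    have hderiv : HasDerivAt (fun t => ℓ v (x t + δ t • e))
        (ℓ v (f (x t₀')) + L * δ t₀' * ℓ v e) t₀' := by
      have hlv : Continuous (ℓ v) := hℓ.comp (by fun_prop : Continuous fun z : E => (z, v))
      refine ((⟨ℓ v, hlv⟩ : E →L[ℝ] ℝ).hasFDerivAt.comp_hasDerivAt t₀'
        (hxd.add (hδd.smul_const e))).congr_deriv ?_
      simp
    -- At the first contact time the null vector condition, applied to the perturbed point, gives
    -- `ℓ(f(x)) ≥ -δ ℓ(g)`. The functional therefore has positive derivative, although it descends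
    -- from positive values to `0`.
    have hpos : 0 < ℓ v (f (x t₀')) + L * δ t₀' * ℓ v e := by
      have h1 := hC' t₀' ht₀ (δ t₀') (hδ1 t₀' ht₀) v hv
      have h2 : L * c ≤ L * ℓ v e := mul_le_mul_of_nonneg_left (hcle v hv) hLpos.le
      have h3 : C < L * ℓ v e := by linarith [le_abs_self C]
      have h4 : δ t₀' * ℓ v (g (x t₀') (δ t₀')) < δ t₀' * (L * ℓ v e) :=
        mul_lt_mul_of_pos_left (h1.trans_lt h3) (hδpos _)
      linarith [mul_assoc L (δ t₀') (ℓ v e), mul_left_comm L (δ t₀') (ℓ v e)]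
    have hslope := (hasDerivAt_iff_tendsto_slope.1 hderiv).mono_left
      (nhdsWithin_mono t₀' (fun t (ht : t < t₀') => ht.ne) : 𝓝[<] t₀' ≤ 𝓝[≠] t₀')
    obtain ⟨t, hts, htm, htlt⟩ := ((hslope.eventually (lt_mem_nhds hpos)).and
      (hnear.and self_mem_nhdsWithin)).exists
    rw [slope_def_field, hzero, sub_zero] at hts
    have h5 := hbefore t htm v hv
    have h6 : t - t₀' < 0 := sub_neg.2 htlt
    exact absurd hts (not_lt.2 (div_nonpos_of_nonneg_of_nonpos h5.le h6.le))
  intro v hv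
  have hlim : Tendsto (fun ε => ℓ v (x t₁ + (ε * Real.exp (L * t₁)) • e)) (𝓝[>] 0)
      (𝓝 (ℓ v (x t₁))) := by
    have h1 : Continuous fun ε : ℝ => ℓ v (x t₁) + (ε * Real.exp (L * t₁)) * ℓ v e := by fun_prop
    have h2 := h1.tendsto 0
    simp only [zero_mul, add_zero] at h2
    simpa only [map_add, map_smul, smul_eq_mul] using h2.mono_left nhdsWithin_le_nhds
  refine ge_of_tendsto hlim ?_
  filter_upwards [Ioc_mem_nhdsGT (Real.exp_pos (-(L * t₁)))] with ε hε
  exact (key ε hε.1 hε.2 t₁ ⟨ht₁.1, le_rfl⟩ v hv).le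

end CompactFamily
end
end PinchingCones

namespace PinchingCones

noncomputable section

/-! ### Contractions of curvature tensors and of the quadratic expression `B`. -/

section TensorCalculus

variable {ι : Type*}

theorem curv_antisymm (S : AlgCurv ι) (i j k l : ι) : S.1 i j k l = -S.1 j i k l := S.2.1 i j k l

theorem curv_pair_symm (S : AlgCurv ι) (i j k l : ι) : S.1 i j k l = S.1 k l i j :=
  S.2.2.1 i j k l

theorem curv_bianchi (S : AlgCurv ι) (i j k l : ι) :
    S.1 i j k l + S.1 i k l j + S.1 i l j k = 0 := S.2.2.2 i j k l

theorem curv_antisymm_right (S : AlgCurv ι) (i j k l : ι) : S.1 i j k l = -S.1 i j l k := by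
  rw [curv_pair_symm S, curv_antisymm S, curv_pair_symm S l k]

theorem curv_bianchi' (S : AlgCurv ι) (i j k l : ι) :
    S.1 i j k l - S.1 i l k j + S.1 j l k i = 0 := by
  linarith [curv_bianchi S k l i j, curv_pair_symm S i j k l, curv_pair_symm S i l k j,
    curv_pair_symm S j l k i, curv_antisymm_right S k j i l]

theorem kn_mem {A B : Matrix ι ι ℝ} (hA : A.IsSymm) (hB : B.IsSymm) : kn A B ∈ AlgCurv ι := by
  refine ⟨fun i j k l => ?_, fun i j k l => ?_, fun i j k l => ?_⟩ <;> simp only [kn]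
  · ring
  · rw [hA.apply i k, hA.apply i l, hA.apply j k, hA.apply j l,
      hB.apply i k, hB.apply i l, hB.apply j k, hB.apply j l]
    ring
  · rw [hA.apply j k, hA.apply j l, hA.apply k l, hB.apply j k, hB.apply j l, hB.apply k l]
    ring

/-- The Kulkarni-Nomizu product as an algebraic curvature tensor. -/
def knAlg (A B : Matrix ι ι ℝ) (hA : A.IsSymm) (hB : B.IsSymm) : AlgCurv ι := ⟨kn A B, kn_mem hA hB⟩

theorem kn_add_left (A A' B : Matrix ι ι ℝ) : kn (A + A') B = kn A B + kn A' B := by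
  ext i j k l; simp only [kn, Matrix.add_apply, Pi.add_apply]; ring

theorem kn_smul_left (c : ℝ) (A B : Matrix ι ι ℝ) : kn (c • A) B = c • kn A B := by
  ext i j k l; simp only [kn, Matrix.smul_apply, Pi.smul_apply, smul_eq_mul]; ring

theorem kn_smul_right (c : ℝ) (A B : Matrix ι ι ℝ) : kn A (c • B) = c • kn A B := by
  ext i j k l; simp only [kn, Matrix.smul_apply, Pi.smul_apply, smul_eq_mul]; ring

variable [Fintype ι]

/-- The contraction `(S * H)_{ik} = ∑ S_{ipkq} H_{pq}`. -/
def contr (S : Tensor4 ι) (H : Matrix ι ι ℝ) : Matrix ι ι ℝ :=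
  Matrix.of fun i k => ∑ p, ∑ q, S i p k q * H p q

theorem contr_add_right (S : Tensor4 ι) (H H' : Matrix ι ι ℝ) :
    contr S (H + H') = contr S H + contr S H' := by
  ext i k
  simp only [contr, Matrix.of_apply, Matrix.add_apply, mul_add, Finset.sum_add_distrib]

theorem contr_smul_right (S : Tensor4 ι) (c : ℝ) (H : Matrix ι ι ℝ) :
    contr S (c • H) = c • contr S H := by
  ext i k
  simp only [contr, Matrix.of_apply, Matrix.smul_apply, smul_eq_mul, Finset.mul_sum]
  exact Finset.sum_congr rfl fun p _ => Finset.sum_congr rfl fun q _ => by ring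

theorem ric_add (S T : AlgCurv ι) : ric (S + T) = ric S + ric T := by
  ext i k
  simp [ric, Finset.sum_add_distrib]

theorem ric_smul (c : ℝ) (S : AlgCurv ι) : ric (c • S) = c • ric S := by
  ext i k
  simp [ric, Finset.mul_sum]

theorem ric_isSymm (S : AlgCurv ι) : (ric S).IsSymm := by
  ext i k
  simp only [ric, Matrix.transpose_apply, Matrix.of_apply]
  exact Finset.sum_congr rfl fun j _ => curv_pair_symm S _ _ _ _

theorem contr_isSymm (S : AlgCurv ι) {H : Matrix ι ι ℝ} (hH : H.IsSymm) :
    (contr S.1 H).IsSymm := by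
  ext i k
  simp only [contr, Matrix.transpose_apply, Matrix.of_apply]
  rw [Finset.sum_comm]
  refine Finset.sum_congr rfl fun p _ => Finset.sum_congr rfl fun q _ => ?_
  rw [curv_pair_symm S, hH.apply]

theorem trace_contr (S : AlgCurv ι) (H : Matrix ι ι ℝ) :
    (contr S.1 H).trace = ∑ p, ∑ q, ric S p q * H p q := by
  simp only [contr, Matrix.trace, Matrix.diag_apply, Matrix.of_apply, ric, Finset.sum_mul]
  rw [Finset.sum_comm]
  refine Finset.sum_congr rfl fun p _ => ?_
  rw [Finset.sum_comm]
  refine Finset.sum_congr rfl fun q _ => Finset.sum_congr rfl fun i _ => ?_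
  rw [curv_antisymm S, curv_antisymm_right S]; ring

theorem curvB_comm (S T : Tensor4 ι) : curvB S T = curvB T S := by
  ext i j k l
  simp only [curvB]
  congr 1
  · congr 1
    exact Finset.sum_congr rfl fun p _ => Finset.sum_congr rfl fun q _ => by ring
  · exact Finset.sum_congr rfl fun p _ => Finset.sum_congr rfl fun q _ => by ring

theorem curvB_add_left (S S' T : Tensor4 ι) : curvB (S + S') T = curvB S T + curvB S' T := by
  ext i j k l
  simp only [curvB, Pi.add_apply]
  rw [add_add_add_comm, ← mul_add, ← Finset.sum_add_distrib, ← Finset.sum_add_distrib]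
  simp only [← Finset.sum_add_distrib]
  congr 1
  · congr 1
    exact Finset.sum_congr rfl fun p _ => Finset.sum_congr rfl fun q _ => by ring
  · exact Finset.sum_congr rfl fun p _ => Finset.sum_congr rfl fun q _ => by ring

theorem curvB_add_self (S T : Tensor4 ι) :
    curvB (S + T) (S + T) = curvB S S + (2 : ℝ) • curvB S T + curvB T T := by
  rw [curvB_add_left, curvB_comm S, curvB_comm T (S + T), curvB_add_left, curvB_add_left,
    curvB_comm T S, two_smul]
  abel

theorem ric_kn (A B : Matrix ι ι ℝ) (hA : A.IsSymm) (hB : B.IsSymm) :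
    ric (knAlg A B hA hB) = B.trace • A + A.trace • B - A * B - B * A := by
  ext i k
  simp only [ric, knAlg, kn, Matrix.of_apply, Matrix.add_apply, Matrix.sub_apply,
    Matrix.smul_apply, smul_eq_mul, Matrix.mul_apply, Matrix.trace, Matrix.diag_apply,
    Finset.sum_mul, ← Finset.sum_sub_distrib, ← Finset.sum_add_distrib]
  exact Finset.sum_congr rfl fun j _ => by ring

/-- The Bianchi identity splits one factor into two terms; after renaming summation indices each of
them reproduces the same contraction. -/
theorem sum_auxB_eq (S : AlgCurv ι) (i k : ι) :
    ∑ j, auxB S.1 i j k j = 2 * ∑ j, auxB S.1 i j j k := by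
  have hb : ∀ i j p q, S.1 i j p q = S.1 i p j q - S.1 i q j p := fun i j p q => by
    linarith [curv_bianchi S i j p q, curv_antisymm_right S i p q j]
  have e : ∀ f : ι → ι → ι → ℝ, ∑ j, ∑ p, ∑ q, f j p q = ∑ j, ∑ p, ∑ q, f q p j := fun f => by
    rw [Finset.sum_comm]
    conv_rhs => rw [Finset.sum_comm]
    exact Finset.sum_congr rfl fun p _ => Finset.sum_comm
  have h1 : ∑ j, ∑ p, ∑ q, S.1 i p j q * S.1 k q p j =
      -∑ j, ∑ p, ∑ q, S.1 i p j q * S.1 k j p q := by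
    rw [e]
    simp only [← Finset.sum_neg_distrib]
    refine Finset.sum_congr rfl fun j _ => Finset.sum_congr rfl fun p _ =>
      Finset.sum_congr rfl fun q _ => ?_
    rw [curv_antisymm_right S i p q j]; ring
  have h2 : ∑ j, ∑ p, ∑ q, S.1 i p j q * S.1 j p k q =
      ∑ j, ∑ p, ∑ q, S.1 i p j q * S.1 k j p q := by
    rw [e]
    refine Finset.sum_congr rfl fun j _ => Finset.sum_congr rfl fun p _ =>
      Finset.sum_congr rfl fun q _ => ?_
    rw [curv_antisymm_right S i p q j, curv_pair_symm S q p k j, curv_antisymm_right S k j q p]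
    ring
  simp only [auxB]
  rw [h2]
  have h3 : ∀ j p q, S.1 i p j q * S.1 k p j q =
      S.1 i p j q * S.1 k j p q - S.1 i p j q * S.1 k q p j := fun j p q => by
    rw [hb k p j q]; ring
  simp only [h3, Finset.sum_sub_distrib]
  rw [h1]; ring

/-- Of the four terms of `curvB_self`, three cancel after tracing by `sum_auxB_eq`; the fourth
contains a Ricci contraction. -/
theorem ric_Q (S : AlgCurv ι) : ric (Q S) = (2 : ℝ) • contr S.1 (ric S) := by
  ext i k
  have h1 : ∑ j, auxB S.1 i k j j = contr S.1 (ric S) i k := by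
    simp only [auxB, contr, ric, Matrix.of_apply, Finset.mul_sum]
    rw [Finset.sum_comm]
    refine Finset.sum_congr rfl fun p _ => ?_
    rw [Finset.sum_comm]
    refine Finset.sum_congr rfl fun q _ => Finset.sum_congr rfl fun j _ => ?_
    rw [curv_antisymm S j p j q, curv_antisymm_right S p j j q]; ring
  simp only [Matrix.smul_apply, smul_eq_mul, ← h1]
  simp only [ric, Q, Matrix.of_apply, curvB_self, ← Finset.mul_sum, Finset.sum_add_distrib,
    Finset.sum_sub_distrib]
  rw [sum_auxB_eq]; ring

variable [DecidableEq ι]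

theorem sum_mul_kn_one (S : AlgCurv ι) (H : Matrix ι ι ℝ) (i j k l : ι) :
    ∑ p, ∑ q, S.1 i j p q * kn H 1 k l p q =
      ∑ p, 2 * (S.1 i j p l * H k p + S.1 i j k p * H l p) := by
  simp only [kn, Matrix.one_apply, mul_add, mul_sub, Finset.sum_add_distrib,
    Finset.sum_sub_distrib, mul_ite, mul_one, mul_zero, Finset.sum_ite_eq, Finset.mem_univ,
    if_true, Finset.sum_ite_irrel, Finset.sum_const_zero]
  simp only [← Finset.sum_add_distrib, ← Finset.sum_sub_distrib]
  refine Finset.sum_congr rfl fun p _ => ?_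
  rw [curv_antisymm_right S i j l p, curv_antisymm_right S i j p k]
  ring

theorem sum_mul_kn_one' (S : AlgCurv ι) (H : Matrix ι ι ℝ) (i j k l : ι) :
    ∑ p, ∑ q, S.1 i p k q * kn H 1 j p l q = H j l * ric S i k +
      (1 : Matrix ι ι ℝ) j l * contr S.1 H i k -
      ∑ p, (S.1 i l k p * H j p + S.1 i p k j * H p l) := by
  have h1 : ∑ p, ∑ q, S.1 i p k q * (H p q * (1 : Matrix ι ι ℝ) j l) =
      (1 : Matrix ι ι ℝ) j l * contr S.1 H i k := by
    simp only [contr, Matrix.of_apply, Finset.mul_sum]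
    exact Finset.sum_congr rfl fun p _ => Finset.sum_congr rfl fun q _ => by ring
  have h2 : ∑ p, ∑ q, S.1 i p k q * (H j l * (1 : Matrix ι ι ℝ) p q) = H j l * ric S i k := by
    simp [Matrix.one_apply, ric, Finset.mul_sum, mul_comm]
  simp only [kn, mul_add, mul_sub, Finset.sum_add_distrib, Finset.sum_sub_distrib, h1, h2]
  simp only [Matrix.one_apply, mul_ite, mul_one, mul_zero, Finset.sum_ite_eq, Finset.mem_univ,
    if_true, Finset.sum_ite_irrel, Finset.sum_const_zero, Finset.sum_ite_eq']
  ring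

/-- The traces in which the identity factor closes up produce the right-hand side. All remaining
terms, in which one index of `S` is contracted with `H`, cancel by the Bianchi identity; this is
`key`. -/
theorem curvB_kn_one (S : AlgCurv ι) {H : Matrix ι ι ℝ} (hH : H.IsSymm) :
    curvB S.1 (kn H 1) = kn (ric S) H + kn (contr S.1 H) 1 := by
  ext i j k l
  simp only [curvB, Finset.sum_add_distrib, Finset.sum_sub_distrib, sum_mul_kn_one,
    sum_mul_kn_one', Pi.add_apply]
  rw [kn, kn]
  have key : ∑ p, (2 * (S.1 i j p l * H k p) + 2 * (S.1 i j k p * H l p)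
      + (2 * (S.1 k l p j * H i p) + 2 * (S.1 k l i p * H j p))
      - 2 * (S.1 i l k p * H j p + S.1 i p k j * H p l)
      + 2 * (S.1 i k l p * H j p + S.1 i p l j * H p k)
      + 2 * (S.1 j l k p * H i p + S.1 j p k i * H p l)
      - 2 * (S.1 j k l p * H i p + S.1 j p l i * H p k)) = 0 := by
    refine Finset.sum_eq_zero fun p _ => ?_
    rw [hH.apply l p, hH.apply k p]
    linear_combination 2 * H l p * curv_bianchi' S i j k p - 2 * H k p * curv_bianchi' S i j l p
      + 2 * H j p * curv_bianchi' S k l i p - 2 * H i p * curv_bianchi' S k l j p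
      + 2 * H k p * curv_antisymm_right S i j p l + 2 * H i p * curv_antisymm_right S k l p j
      + 2 * H j p * (curv_pair_symm S k p i l - curv_pair_symm S l p i k)
      - 2 * H i p * (curv_pair_symm S k p j l - curv_pair_symm S l p j k)
  simp only [mul_add, Finset.sum_add_distrib, Finset.sum_sub_distrib, ← Finset.mul_sum] at key ⊢
  linarith

theorem ric_kn_one (A : Matrix ι ι ℝ) (hA : A.IsSymm) :
    ric (knAlg A 1 hA Matrix.isSymm_one) =
      ((Fintype.card ι : ℝ) - 2) • A + A.trace • (1 : Matrix ι ι ℝ) := by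
  rw [ric_kn, Matrix.trace_one, mul_one, one_mul, sub_smul, two_smul]
  abel

theorem contr_one (S : AlgCurv ι) : contr S.1 1 = ric S := by
  ext i k
  simp [contr, ric, Matrix.one_apply]

theorem contr_kn_one (A : Matrix ι ι ℝ) {B : Matrix ι ι ℝ} (hB : B.IsSymm) :
    contr (kn A 1) B = B.trace • A - A * B - B * A + (A * B).trace • (1 : Matrix ι ι ℝ) := by
  ext i k
  have h1 : ∑ p, ∑ q, A p q * (1 : Matrix ι ι ℝ) i k * B p q =
      (∑ p, ∑ q, A p q * B q p) * (1 : Matrix ι ι ℝ) i k := by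
    simp only [Finset.sum_mul]
    refine Finset.sum_congr rfl fun p _ => Finset.sum_congr rfl fun q _ => ?_
    rw [hB.apply p q]; ring
  simp only [contr, kn, Matrix.of_apply, Matrix.add_apply, Matrix.sub_apply,
    Matrix.smul_apply, smul_eq_mul, Matrix.mul_apply, Matrix.trace, Matrix.diag_apply,
    add_mul, sub_mul, Finset.sum_add_distrib, Finset.sum_sub_distrib, h1]
  simp only [Matrix.one_apply, mul_ite, mul_one, mul_zero, ite_mul, zero_mul, Finset.sum_ite_eq,
    Finset.mem_univ, if_true, Finset.sum_ite_irrel, Finset.sum_const_zero, Finset.sum_ite_eq']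
  simp only [Finset.sum_mul]
  congr 1
  congr 1
  · congr 1
    · exact Finset.sum_congr rfl fun p _ => by ring
    · exact Finset.sum_congr rfl fun p _ => by rw [hB.apply]
  · exact Finset.sum_congr rfl fun p _ => by rw [hB.apply]; ring

end TensorCalculus
end
end PinchingCones

namespace PinchingCones

noncomputable section

/-! ### Splitting of `Q(R)` along `R = S + (K + h id) ∧ id`. -/

section Decomposition

variable {ι : Type*} [Fintype ι] [DecidableEq ι]

/-- The curvature tensor `(n-2) K ∧ K + 2 K² ∧ id`. -/
def warp (K : Matrix ι ι ℝ) : Tensor4 ι :=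
  ((Fintype.card ι : ℝ) - 2) • kn K K + (2 : ℝ) • kn (K * K) 1

/-- The velocity of the `H`-part of `S + (K + h id) ∧ id` under the Hamilton ODE, when
`Ric(S) = s id`. -/
def hVel (S : AlgCurv ι) (K : Matrix ι ι ℝ) (s h : ℝ) : Matrix ι ι ℝ :=
  (2 * s + 4 * ((Fintype.card ι : ℝ) - 2) * h) • K + (2 : ℝ) • contr S.1 K - (4 : ℝ) • (K * K)
    + (4 * s * h + 4 * ((Fintype.card ι : ℝ) - 1) * h ^ 2 + (K * K).trace) • (1 : Matrix ι ι ℝ)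

theorem hVel_isSymm (S : AlgCurv ι) {K : Matrix ι ι ℝ} (hK : K.IsSymm) (s h : ℝ) :
    (hVel S K s h).IsSymm := by
  have hKK : (K * K).IsSymm := by rw [Matrix.IsSymm, Matrix.transpose_mul, hK.eq]
  exact (((hK.smul _).add ((contr_isSymm S hK).smul _)).sub (hKK.smul _)).add
    (Matrix.isSymm_one.smul _)

theorem trace_hVel (S : AlgCurv ι) {K : Matrix ι ι ℝ} (hK0 : K.trace = 0)
    {s : ℝ} (hS : ric S = s • (1 : Matrix ι ι ℝ)) (h : ℝ) :
    (hVel S K s h).trace = 4 * Fintype.card ι * s * h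
      + 4 * Fintype.card ι * ((Fintype.card ι : ℝ) - 1) * h ^ 2
      + ((Fintype.card ι : ℝ) - 4) * (K * K).trace := by
  have hc : (contr S.1 K).trace = 0 := by
    rw [trace_contr, hS]
    simp only [Matrix.smul_apply, Matrix.one_apply, smul_eq_mul, mul_ite, mul_one, mul_zero,
      ite_mul, zero_mul, Finset.sum_ite_eq, Finset.mem_univ, if_true, ← Finset.mul_sum]
    have : ∑ x, K x x = 0 := hK0
    rw [this, mul_zero]
  simp only [hVel, Matrix.trace_add, Matrix.trace_sub, Matrix.trace_smul, hK0, hc,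
    Matrix.trace_one, smul_eq_mul]
  ring

/-- Polarize `Q` and apply `curvB_kn_one` twice, to `S` and to `H ∧ id` itself. The term `2 K² ∧ id`
is put into `warp K` and compensated in `hVel`, so that `warp K` has pure-trace Ricci tensor. -/
theorem Q_decomposition {R S : AlgCurv ι} {K : Matrix ι ι ℝ} (hK : K.IsSymm) (hK0 : K.trace = 0)
    {s h : ℝ} (hS : ric S = s • (1 : Matrix ι ι ℝ))
    (hR : R.1 = S.1 + kn (K + h • (1 : Matrix ι ι ℝ)) 1) :
    (Q R).1 = (Q S).1 + warp K + kn (hVel S K s h) 1 := by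
  have hH : (K + h • (1 : Matrix ι ι ℝ)).IsSymm := hK.add (Matrix.isSymm_one.smul _)
  set H := K + h • (1 : Matrix ι ι ℝ) with hHdef
  have htr : H.trace = Fintype.card ι * h := by simp [hHdef, hK0, mul_comm]
  have hHH : H * H = K * K + (2 * h) • K + h ^ 2 • (1 : Matrix ι ι ℝ) := by
    simp only [hHdef, mul_add, add_mul, mul_one, one_mul, Matrix.mul_smul, Matrix.smul_mul]
    module
  have htrHH : (H * H).trace = (K * K).trace + Fintype.card ι * h ^ 2 := by
    rw [hHH]; simp [hK0, mul_comm]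
  have h2 := curvB_kn_one (knAlg H 1 hH Matrix.isSymm_one) hH
  rw [ric_kn_one] at h2
  simp only [knAlg] at h2
  rw [contr_kn_one H hH, htr, htrHH, hHH] at h2
  simp only [Q]
  rw [hR, curvB_add_self, curvB_kn_one S hH, h2, hS]
  have hcS : contr S.1 H = contr S.1 K + (h * s) • (1 : Matrix ι ι ℝ) := by
    rw [hHdef, contr_add_right, contr_smul_right, contr_one, hS, smul_smul]
  rw [hcS, hHdef]
  ext i j k l
  simp only [warp, hVel, kn, Matrix.add_apply, Matrix.sub_apply, Matrix.smul_apply, smul_eq_mul,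
    Pi.add_apply, Pi.smul_apply]
  ring

/-- Both `Q(S)` and `warp K` contribute only multiples of the identity, `2s²` and `2 tr(K²)`, so the
trace-free Ricci part of `Q(R)` comes from `hVel` alone. -/
theorem ric_Q_decomposition {R S : AlgCurv ι} {K : Matrix ι ι ℝ} (hK : K.IsSymm)
    (hK0 : K.trace = 0) {s h : ℝ} (hS : ric S = s • (1 : Matrix ι ι ℝ))
    (hR : R.1 = S.1 + kn (K + h • (1 : Matrix ι ι ℝ)) 1) :
    ric (Q R) = ((Fintype.card ι : ℝ) - 2) • hVel S K s h +
      (2 * s ^ 2 + 2 * (K * K).trace + (hVel S K s h).trace) • (1 : Matrix ι ι ℝ) := by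
  have hKK : (K * K).IsSymm := by rw [Matrix.IsSymm, Matrix.transpose_mul, hK.eq]
  have hV := hVel_isSymm S hK s h
  have hQ : Q R = Q S + (((Fintype.card ι : ℝ) - 2) • knAlg K K hK hK
      + (2 : ℝ) • knAlg (K * K) 1 hKK Matrix.isSymm_one) +
      knAlg (hVel S K s h) 1 hV Matrix.isSymm_one :=
    Subtype.ext (Q_decomposition hK hK0 hS hR)
  rw [hQ, ric_add, ric_add, ric_add, ric_smul, ric_smul, ric_kn_one, ric_kn_one, ric_kn, ric_Q,
    hS, contr_smul_right, contr_one, hS, hK0]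
  module

end Decomposition
end
end PinchingCones

namespace PinchingCones

noncomputable section

open Matrix ComplexConjugate

/-! ### Complex sectional curvature and its second variation. -/

section ComplexSectional

variable {ι : Type*} [Fintype ι]

/-- The complex multilinear extension of a four-tensor. -/
def cEval (R : Tensor4 ι) (x y z w : ι → ℂ) : ℂ :=
  ∑ i, ∑ j, ∑ k, ∑ l, (R i j k l : ℂ) * x i * y j * z k * w l

/-- The (unnormalized) complex sectional curvature `R(z, w, z̄, w̄)`. -/
def csec (R : Tensor4 ι) (z w : ι → ℂ) : ℝ := (cEval R z w (star z) (star w)).re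

/-- Nonnegative complex sectional curvature. -/
def NonnegComplex (R : Tensor4 ι) : Prop := ∀ z w : ι → ℂ, 0 ≤ csec R z w

theorem cEval_add (R T : Tensor4 ι) (x y z w : ι → ℂ) :
    cEval (R + T) x y z w = cEval R x y z w + cEval T x y z w := by
  simp only [cEval, Pi.add_apply, Complex.ofReal_add, add_mul, Finset.sum_add_distrib]

theorem cEval_smul (c : ℝ) (R : Tensor4 ι) (x y z w : ι → ℂ) :
    cEval (c • R) x y z w = c * cEval R x y z w := by
  simp only [cEval, Pi.smul_apply, smul_eq_mul, Complex.ofReal_mul, Finset.mul_sum, mul_assoc]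

theorem csec_add (R T : Tensor4 ι) (z w : ι → ℂ) : csec (R + T) z w = csec R z w + csec T z w := by
  rw [csec, cEval_add, Complex.add_re, csec, csec]

theorem csec_smul (c : ℝ) (R : Tensor4 ι) (z w : ι → ℂ) : csec (c • R) z w = c * csec R z w := by
  rw [csec, cEval_smul, Complex.re_ofReal_mul, csec]

theorem cEval_add₁ (R : Tensor4 ι) (x x' y z w : ι → ℂ) :
    cEval R (x + x') y z w = cEval R x y z w + cEval R x' y z w := by
  simp only [cEval, Pi.add_apply, mul_add, add_mul, Finset.sum_add_distrib]

theorem cEval_add₂ (R : Tensor4 ι) (x y y' z w : ι → ℂ) :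
    cEval R x (y + y') z w = cEval R x y z w + cEval R x y' z w := by
  simp only [cEval, Pi.add_apply, mul_add, add_mul, Finset.sum_add_distrib]

theorem cEval_add₃ (R : Tensor4 ι) (x y z z' w : ι → ℂ) :
    cEval R x y (z + z') w = cEval R x y z w + cEval R x y z' w := by
  simp only [cEval, Pi.add_apply, mul_add, add_mul, Finset.sum_add_distrib]

theorem cEval_add₄ (R : Tensor4 ι) (x y z w w' : ι → ℂ) :
    cEval R x y z (w + w') = cEval R x y z w + cEval R x y z w' := by
  simp only [cEval, Pi.add_apply, mul_add, Finset.sum_add_distrib]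

theorem cEval_smul₁ (R : Tensor4 ι) (c : ℂ) (x y z w : ι → ℂ) :
    cEval R (c • x) y z w = c * cEval R x y z w := by
  simp only [cEval, Pi.smul_apply, smul_eq_mul, Finset.mul_sum]
  exact Finset.sum_congr rfl fun i _ => Finset.sum_congr rfl fun j _ =>
    Finset.sum_congr rfl fun k _ => Finset.sum_congr rfl fun l _ => by ring

theorem cEval_smul₂ (R : Tensor4 ι) (c : ℂ) (x y z w : ι → ℂ) :
    cEval R x (c • y) z w = c * cEval R x y z w := by
  simp only [cEval, Pi.smul_apply, smul_eq_mul, Finset.mul_sum]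
  exact Finset.sum_congr rfl fun i _ => Finset.sum_congr rfl fun j _ =>
    Finset.sum_congr rfl fun k _ => Finset.sum_congr rfl fun l _ => by ring

theorem cEval_smul₃ (R : Tensor4 ι) (c : ℂ) (x y z w : ι → ℂ) :
    cEval R x y (c • z) w = c * cEval R x y z w := by
  simp only [cEval, Pi.smul_apply, smul_eq_mul, Finset.mul_sum]
  exact Finset.sum_congr rfl fun i _ => Finset.sum_congr rfl fun j _ =>
    Finset.sum_congr rfl fun k _ => Finset.sum_congr rfl fun l _ => by ring

theorem cEval_smul₄ (R : Tensor4 ι) (c : ℂ) (x y z w : ι → ℂ) :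
    cEval R x y z (c • w) = c * cEval R x y z w := by
  simp only [cEval, Pi.smul_apply, smul_eq_mul, Finset.mul_sum]
  exact Finset.sum_congr rfl fun i _ => Finset.sum_congr rfl fun j _ =>
    Finset.sum_congr rfl fun k _ => Finset.sum_congr rfl fun l _ => by ring

theorem cEval_antisymm (R : AlgCurv ι) (x y z w : ι → ℂ) :
    cEval R.1 x y z w = -cEval R.1 y x z w := by
  simp only [cEval, ← Finset.sum_neg_distrib]
  rw [Finset.sum_comm]
  refine Finset.sum_congr rfl fun i _ => Finset.sum_congr rfl fun j _ =>
    Finset.sum_congr rfl fun k _ => Finset.sum_congr rfl fun l _ => ?_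
  rw [curv_antisymm R j i k l]; push_cast; ring

theorem cEval_antisymm_right (R : AlgCurv ι) (x y z w : ι → ℂ) :
    cEval R.1 x y z w = -cEval R.1 x y w z := by
  simp only [cEval, ← Finset.sum_neg_distrib]
  refine Finset.sum_congr rfl fun i _ => Finset.sum_congr rfl fun j _ => ?_
  rw [Finset.sum_comm]
  refine Finset.sum_congr rfl fun k _ => Finset.sum_congr rfl fun l _ => ?_
  rw [curv_antisymm_right R i j l k]; push_cast; ring

theorem sum₄_comm (f : ι → ι → ι → ι → ℂ) :
    ∑ i, ∑ j, ∑ k, ∑ l, f i j k l = ∑ k, ∑ l, ∑ i, ∑ j, f i j k l := by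
  have h : ∀ i, ∑ j, ∑ k, ∑ l, f i j k l = ∑ k, ∑ l, ∑ j, f i j k l := fun i => by
    rw [Finset.sum_comm]
    exact Finset.sum_congr rfl fun k _ => Finset.sum_comm
  simp only [h]
  rw [Finset.sum_comm]
  exact Finset.sum_congr rfl fun k _ => Finset.sum_comm

theorem cEval_pair_symm (R : AlgCurv ι) (x y z w : ι → ℂ) :
    cEval R.1 x y z w = cEval R.1 z w x y := by
  simp only [cEval]
  rw [sum₄_comm]
  refine Finset.sum_congr rfl fun i _ => Finset.sum_congr rfl fun j _ =>
    Finset.sum_congr rfl fun k _ => Finset.sum_congr rfl fun l _ => ?_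
  rw [curv_pair_symm R]; ring

theorem cEval_self_left (R : AlgCurv ι) (x z w : ι → ℂ) : cEval R.1 x x z w = 0 := by
  have := cEval_antisymm R x x z w
  linear_combination this / 2

theorem cEval_self_right (R : AlgCurv ι) (x y z : ι → ℂ) : cEval R.1 x y z z = 0 := by
  rw [cEval_pair_symm, cEval_self_left]

theorem csec_smul_left (R : Tensor4 ι) (c : ℂ) (z w : ι → ℂ) :
    csec R (c • z) w = Complex.normSq c * csec R z w := by
  rw [csec, star_smul, cEval_smul₁, cEval_smul₃, ← mul_assoc, Complex.star_def,
    Complex.mul_conj, Complex.re_ofReal_mul, csec]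

theorem csec_smul_right (R : Tensor4 ι) (c : ℂ) (z w : ι → ℂ) :
    csec R z (c • w) = Complex.normSq c * csec R z w := by
  rw [csec, star_smul, cEval_smul₂, cEval_smul₄, ← mul_assoc, Complex.star_def,
    Complex.mul_conj, Complex.re_ofReal_mul, csec]

theorem csec_add_smul_right (R : AlgCurv ι) (c : ℂ) (z w : ι → ℂ) :
    csec R.1 z (w + c • z) = csec R.1 z w := by
  rw [csec, star_add, star_smul, cEval_add₂, cEval_smul₂, cEval_self_left, cEval_add₄,
    cEval_smul₄, cEval_self_right, csec]
  simp

/-- The second variation of the complex sectional curvature at a null pair. -/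
theorem second_variation {R : AlgCurv ι} (hR : NonnegComplex R.1) {z w : ι → ℂ}
    (h0 : csec R.1 z w = 0) (x y : ι → ℂ) :
    0 ≤ (cEval R.1 x w (star x) (star w) + cEval R.1 z y (star z) (star y)
      + cEval R.1 x w (star z) (star y) + cEval R.1 z y (star x) (star w)).re := by
  set F := cEval R.1 x w (star x) (star w) + cEval R.1 z y (star z) (star y)
      + cEval R.1 x w (star z) (star y) + cEval R.1 z y (star x) (star w) with hF
  -- Summing over the phases `1, i, -1, -i` of `t` kills every monomial `t^a t̄^b` with `a ≠ b`,
  -- since `a, b ≤ 2`. The first-order terms and the `t²` terms disappear, and `F` is the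
  -- coefficient of `|t|²`.
  have hexp : ∀ t : ℂ, cEval R.1 (z + t • x) (w + t • y) (star (z + t • x)) (star (w + t • y))
      + cEval R.1 (z + (t * Complex.I) • x) (w + (t * Complex.I) • y)
        (star (z + (t * Complex.I) • x)) (star (w + (t * Complex.I) • y))
      + cEval R.1 (z + (-t) • x) (w + (-t) • y) (star (z + (-t) • x)) (star (w + (-t) • y))
      + cEval R.1 (z + (-(t * Complex.I)) • x) (w + (-(t * Complex.I)) • y)
        (star (z + (-(t * Complex.I)) • x)) (star (w + (-(t * Complex.I)) • y))
      = 4 * (cEval R.1 z w (star z) (star w) + t * conj t * F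
        + (t * conj t) ^ 2 * cEval R.1 x y (star x) (star y)) := by
    intro t
    simp only [star_add, star_smul, cEval_add₁, cEval_add₂, cEval_add₃, cEval_add₄, cEval_smul₁,
      cEval_smul₂, cEval_smul₃, cEval_smul₄, hF, star_neg, star_mul, Complex.star_def,
      Complex.conj_I]
    have hI : Complex.I ^ 2 = -1 := Complex.I_sq
    have hI4 : Complex.I ^ 4 = 1 := Complex.I_pow_four
    ring_nf
    simp only [hI, hI4]
    ring
  have hpos : ∀ ε : ℝ, 0 < ε → 0 ≤ F.re + ε ^ 2 * csec R.1 x y := by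
    intro ε hε
    have h1 := congrArg Complex.re (hexp (ε : ℂ))
    simp only [Complex.add_re] at h1
    have h2 : (4 * (cEval R.1 z w (star z) (star w) + (ε : ℂ) * conj (ε : ℂ) * F
        + ((ε : ℂ) * conj (ε : ℂ)) ^ 2 * cEval R.1 x y (star x) (star y))).re
        = 4 * (ε ^ 2 * (F.re + ε ^ 2 * csec R.1 x y)) := by
      have : (4 * (cEval R.1 z w (star z) (star w) + (ε : ℂ) * conj (ε : ℂ) * F
        + ((ε : ℂ) * conj (ε : ℂ)) ^ 2 * cEval R.1 x y (star x) (star y))) =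
        ((4 : ℝ) : ℂ) * (cEval R.1 z w (star z) (star w) + ((ε ^ 2 : ℝ) : ℂ) * F
        + ((ε ^ 4 : ℝ) : ℂ) * cEval R.1 x y (star x) (star y)) := by
        rw [Complex.conj_ofReal]; push_cast; ring
      rw [this, Complex.re_ofReal_mul, Complex.add_re, Complex.add_re, Complex.re_ofReal_mul,
        Complex.re_ofReal_mul]
      have h0' : (cEval R.1 z w (star z) (star w)).re = 0 := h0
      rw [h0', csec]; ring
    rw [h2] at h1
    have h3 := hR (z + (ε : ℂ) • x) (w + (ε : ℂ) • y)
    have h4 := hR (z + ((ε : ℂ) * Complex.I) • x) (w + ((ε : ℂ) * Complex.I) • y)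
    have h5 := hR (z + (-(ε : ℂ)) • x) (w + (-(ε : ℂ)) • y)
    have h6 := hR (z + (-((ε : ℂ) * Complex.I)) • x) (w + (-((ε : ℂ) * Complex.I)) • y)
    simp only [csec] at h3 h4 h5 h6
    have h7 : 0 ≤ ε ^ 2 * (F.re + ε ^ 2 * csec R.1 x y) := by linarith
    exact nonneg_of_mul_nonneg_right h7 (by positivity)
  by_contra! hneg
  have hc : 0 < |csec R.1 x y| + 1 := by positivity
  have hq : 0 < -F.re / (2 * (|csec R.1 x y| + 1)) := div_pos (by linarith) (by positivity)
  -- This `ε` is so small that the quartic contribution is at most half of `-Re F`.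
  have h1 := hpos (Real.sqrt (-F.re / (2 * (|csec R.1 x y| + 1)))) (Real.sqrt_pos.2 hq)
  rw [Real.sq_sqrt hq.le] at h1
  have h2 : -F.re / (2 * (|csec R.1 x y| + 1)) * csec R.1 x y ≤
      -F.re / (2 * (|csec R.1 x y| + 1)) * (|csec R.1 x y| + 1) :=
    mul_le_mul_of_nonneg_left (by linarith [le_abs_self (csec R.1 x y)]) hq.le
  have h3 : -F.re / (2 * (|csec R.1 x y| + 1)) * (|csec R.1 x y| + 1) = -F.re / 2 := by
    field_simp
  linarith

end ComplexSectional
end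
end PinchingCones

namespace PinchingCones

noncomputable section

open Matrix ComplexConjugate ComplexOrder MatrixOrder

open scoped Matrix.Norms.L2Operator

/-! ### `Q` preserves nonnegativity on null planes of the complex sectional curvature. -/

section NullVector

variable {ι : Type*} [Fintype ι]

theorem sum_mul_sum₁₂ (f g : ι → ι → ℂ) :
    ∑ i, ∑ j, ∑ k, ∑ l, f i j * g k l = (∑ i, ∑ j, f i j) * ∑ k, ∑ l, g k l := by
  simp only [← Finset.mul_sum, ← Finset.sum_mul]

theorem sum_mul_sum₁₃ (f g : ι → ι → ℂ) :
    ∑ i, ∑ j, ∑ k, ∑ l, f i k * g j l = (∑ i, ∑ k, f i k) * ∑ j, ∑ l, g j l := by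
  rw [← sum_mul_sum₁₂]
  exact Finset.sum_congr rfl fun i _ => Finset.sum_comm

theorem sum_mul_sum₁₄ (f g : ι → ι → ℂ) :
    ∑ i, ∑ j, ∑ k, ∑ l, f i l * g j k = (∑ i, ∑ l, f i l) * ∑ j, ∑ k, g j k := by
  rw [← sum_mul_sum₁₃]
  exact Finset.sum_congr rfl fun i _ => Finset.sum_congr rfl fun j _ => Finset.sum_comm

/-- The partial contraction `∑ S_{ipkq} x_i z_k`. -/
def sect (S : Tensor4 ι) (x z : ι → ℂ) : Matrix ι ι ℂ :=
  of fun p q => ∑ i, ∑ k, (S i p k q : ℂ) * x i * z k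

/-- The partial contraction `∑ S_{ijpq} x_i y_j`. -/
def curvOp (S : Tensor4 ι) (x y : ι → ℂ) : Matrix ι ι ℂ :=
  of fun p q => ∑ i, ∑ j, (S i j p q : ℂ) * x i * y j

theorem sum_comm₄₂ (f : ι → ι → ι → ι → ι → ι → ℂ) :
    ∑ i, ∑ j, ∑ k, ∑ l, ∑ p, ∑ q, f i j k l p q = ∑ p, ∑ q, ∑ i, ∑ j, ∑ k, ∑ l, f i j k l p q := by
  have h : ∀ i j, ∑ k, ∑ l, ∑ p, ∑ q, f i j k l p q = ∑ p, ∑ q, ∑ k, ∑ l, f i j k l p q :=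
    fun i j => sum₄_comm _
  simp only [h]
  exact sum₄_comm _

theorem cEval_eq_sect (S : Tensor4 ι) (x y z w : ι → ℂ) :
    cEval S x y z w = ∑ p, ∑ q, sect S x z p q * y p * w q := by
  simp only [cEval, sect, of_apply, Finset.sum_mul]
  rw [Finset.sum_comm]
  refine Finset.sum_congr rfl fun p _ => ?_
  have : ∀ i, ∑ k, ∑ l, (S i p k l : ℂ) * x i * y p * z k * w l =
      ∑ q, ∑ k, (S i p k q : ℂ) * x i * z k * y p * w q := fun i => by
    rw [Finset.sum_comm]
    exact Finset.sum_congr rfl fun q _ => Finset.sum_congr rfl fun k _ => by ring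
  simp only [this]
  rw [Finset.sum_comm]

theorem cEval_Q (S : AlgCurv ι) (x y z w : ι → ℂ) :
    cEval (Q S).1 x y z w = ∑ p, ∑ q, (curvOp S.1 x y p q * curvOp S.1 z w p q
      + 2 * (sect S.1 x z p q * sect S.1 y w p q - sect S.1 x w p q * sect S.1 y z p q)) := by
  have h1 : ∀ i j k l, (((Q S).1 i j k l : ℝ) : ℂ) * x i * y j * z k * w l =
      ∑ p, ∑ q, (((S.1 i j p q : ℂ) * x i * y j) * ((S.1 k l p q : ℂ) * z k * w l)
        + 2 * (((S.1 i p k q : ℂ) * x i * z k) * ((S.1 j p l q : ℂ) * y j * w l)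
          - ((S.1 i p l q : ℂ) * x i * w l) * ((S.1 j p k q : ℂ) * y j * z k))) := by
    intro i j k l
    have : (Q S).1 i j k l = ∑ p, ∑ q, (S.1 i j p q * S.1 k l p q
        + 2 * (S.1 i p k q * S.1 j p l q - S.1 i p l q * S.1 j p k q)) := by
      simp only [Q, curvB]
      rw [Finset.mul_sum, ← Finset.sum_add_distrib]
      refine Finset.sum_congr rfl fun p _ => ?_
      rw [Finset.mul_sum, ← Finset.sum_add_distrib]
      exact Finset.sum_congr rfl fun q _ => by ring
    rw [this]
    push_cast
    simp only [Finset.sum_mul]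
    exact Finset.sum_congr rfl fun p _ => Finset.sum_congr rfl fun q _ => by ring
  simp only [cEval, h1]
  rw [sum_comm₄₂]
  refine Finset.sum_congr rfl fun p _ => Finset.sum_congr rfl fun q _ => ?_
  simp only [curvOp, sect, of_apply]
  rw [← sum_mul_sum₁₂, ← sum_mul_sum₁₃, ← sum_mul_sum₁₄]
  simp only [Finset.mul_sum, Finset.sum_add_distrib, Finset.sum_sub_distrib, mul_sub]

theorem trace_mul_nonneg_of_posSemidef {𝕜 n : Type*} [RCLike 𝕜] [Fintype n]
    {M N : Matrix n n 𝕜}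
    (hM : M.PosSemidef) (hN : N.PosSemidef) : 0 ≤ (M * N).trace := by
  classical
  obtain ⟨B, rfl⟩ := CStarAlgebra.nonneg_iff_eq_star_mul_self.mp hM.nonneg
  rw [star_eq_conjTranspose, Matrix.mul_assoc, trace_mul_comm]
  exact (hN.mul_mul_conjTranspose_same B).trace_nonneg

/-- Conjugating the transpose of the block matrix by the symplectic matrix exchanges the diagonal
blocks and changes the off-diagonal signs. The trace of the product of the two positive matrices is
twice the expression in question. -/
theorem trace_sub_nonneg_of_block_posSemidef [DecidableEq ι] {A B C : Matrix ι ι ℂ}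
    (h : (fromBlocks Aᵀ (-C.map star) (-Cᵀ) Bᵀ).PosSemidef) :
    0 ≤ (Aᵀ * B).trace - (C.map star * C).trace := by
  have hJ := h.transpose.mul_mul_conjTranspose_same
    (fromBlocks 0 1 (-1) 0 : Matrix (ι ⊕ ι) (ι ⊕ ι) ℂ)
  have h2 := trace_mul_nonneg_of_posSemidef h hJ
  have htr : ∀ X Y Z W : Matrix ι ι ℂ, (fromBlocks X Y Z W).trace = X.trace + W.trace :=
    fun X Y Z W => by simp [trace]
  have hC : Cᵀ * (C.map star)ᵀ = (C.map star * C)ᵀ := by rw [transpose_mul]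
  have hB : (Bᵀ * A).trace = (Aᵀ * B).trace := by
    rw [← trace_transpose, transpose_mul, transpose_transpose]
  simp only [fromBlocks_transpose, fromBlocks_conjTranspose, fromBlocks_multiply,
    transpose_transpose, transpose_neg, conjTranspose_zero, conjTranspose_one, conjTranspose_neg,
    zero_mul, one_mul, zero_add, neg_mul, mul_neg, mul_one, mul_zero, add_zero, neg_neg,
    neg_zero, htr, trace_add, trace_neg, hC, trace_transpose, hB] at h2
  have h3 : (Aᵀ * B).trace - (C.map star * C).trace = ((1 / 2 : ℝ) : ℂ) *
    ((Aᵀ * B).trace + -(C.map star * C).trace +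
      (-(C.map star * C).trace + (Aᵀ * B).trace)) := by push_cast; ring
  rw [h3]
  refine mul_nonneg (by rw [Complex.zero_le_real]; norm_num) h2

theorem sect_conj (S : AlgCurv ι) (x z : ι → ℂ) (p q : ι) :
    sect S.1 (star z) (star x) q p = star (sect S.1 x z p q) := by
  simp only [sect, of_apply, star_sum, star_mul']
  rw [Finset.sum_comm]
  refine Finset.sum_congr rfl fun i _ => Finset.sum_congr rfl fun k _ => ?_
  rw [curv_pair_symm S k q i p]
  simp [mul_right_comm]

/-- The second variation at the null pair `(z, w)` is a Hermitian form in the two variations, hence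
a positive block matrix with blocks `A`, `B`, `C`. The value of `Q(S)` on the pair is a sum of
squared moduli plus twice the trace expression of `trace_sub_nonneg_of_block_posSemidef`. -/
theorem csec_Q_nonneg {S : AlgCurv ι} (hS : NonnegComplex S.1) {z w : ι → ℂ}
    (h0 : csec S.1 z w = 0) : 0 ≤ csec (Q S).1 z w := by
  classical
  set A := sect S.1 w (star w) with hA
  set B := sect S.1 z (star z) with hB
  set C := sect S.1 w (star z) with hC
  have hAH : ∀ p q, A q p = star (A p q) := fun p q => by
    rw [hA, ← sect_conj, star_star]
  have hBH : ∀ p q, B q p = star (B p q) := fun p q => by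
    rw [hB, ← sect_conj, star_star]
  have hpsd : (fromBlocks Aᵀ (-C.map star) (-Cᵀ) Bᵀ).PosSemidef := by
    have hherm : (fromBlocks Aᵀ (-C.map star) (-Cᵀ) Bᵀ).IsHermitian := by
      refine IsHermitian.fromBlocks ?_ ?_ ?_
      · ext p q; simp [hAH p q]
      · ext p q; simp
      · ext p q; simp [hBH p q]
    refine PosSemidef.of_dotProduct_mulVec_nonneg hherm fun v => ?_
    · have hval : star v ⬝ᵥ (fromBlocks Aᵀ (-C.map star) (-Cᵀ) Bᵀ *ᵥ v) =
          cEval S.1 (v ∘ Sum.inl) w (star (v ∘ Sum.inl)) (star w)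
          + cEval S.1 z (v ∘ Sum.inr) (star z) (star (v ∘ Sum.inr))
          + cEval S.1 (v ∘ Sum.inl) w (star z) (star (v ∘ Sum.inr))
          + cEval S.1 z (v ∘ Sum.inr) (star (v ∘ Sum.inl)) (star w) := by
        have e1 : cEval S.1 (v ∘ Sum.inl) w (star (v ∘ Sum.inl)) (star w) =
            ∑ p, ∑ q, A p q * v (Sum.inl p) * star (v (Sum.inl q)) := by
          rw [cEval_antisymm, cEval_antisymm_right, neg_neg, cEval_eq_sect]; rfl
        have e2 : cEval S.1 z (v ∘ Sum.inr) (star z) (star (v ∘ Sum.inr)) =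
            ∑ p, ∑ q, B p q * v (Sum.inr p) * star (v (Sum.inr q)) := by
          rw [cEval_eq_sect]; rfl
        have e3 : cEval S.1 (v ∘ Sum.inl) w (star z) (star (v ∘ Sum.inr)) =
            -∑ p, ∑ q, C p q * v (Sum.inl p) * star (v (Sum.inr q)) := by
          rw [cEval_antisymm, cEval_eq_sect]; rfl
        have e4 : cEval S.1 z (v ∘ Sum.inr) (star (v ∘ Sum.inl)) (star w) =
            -∑ q, ∑ p, star (C p q) * v (Sum.inr q) * star (v (Sum.inl p)) := by
          rw [cEval_antisymm_right, cEval_eq_sect]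
          have : ∀ p q, sect S.1 z (star w) q p = star (C p q) := fun p q => by
            rw [hC, ← sect_conj, star_star]
          simp only [this]; rfl
        rw [e1, e2, e3, e4]
        simp only [dotProduct, mulVec, Fintype.sum_sum_type, fromBlocks_apply₁₁,
          fromBlocks_apply₁₂, fromBlocks_apply₂₁, fromBlocks_apply₂₂, mul_add,
          Finset.sum_add_distrib, Finset.mul_sum, transpose_apply, Matrix.neg_apply, map_apply,
          Pi.star_apply, neg_mul, mul_neg, Finset.sum_neg_distrib]
        rw [Finset.sum_comm (f := fun q p => star (v (Sum.inl q)) * (A p q * v (Sum.inl p))),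
          Finset.sum_comm (f := fun q p => star (v (Sum.inr q)) * (B p q * v (Sum.inr p))),
          Finset.sum_comm (f := fun q p => star (v (Sum.inr q)) * (C p q * v (Sum.inl p))),
          Finset.sum_comm (f := fun p q => star (v (Sum.inl p)) * (star (C p q) * v (Sum.inr q)))]
        simp only [mul_comm (star (v _))]
        ring
      rw [Complex.le_def]
      refine ⟨?_, ?_⟩
      · rw [hval]
        exact second_variation hS h0 _ _
      · exact (hherm.im_star_dotProduct_mulVec_self v).symm
  have h1 := trace_sub_nonneg_of_block_posSemidef hpsd
  rw [csec, cEval_Q]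
  have h2 : ∑ p, ∑ q, (curvOp S.1 z w p q * curvOp S.1 (star z) (star w) p q
      + 2 * (sect S.1 z (star z) p q * sect S.1 w (star w) p q
        - sect S.1 z (star w) p q * sect S.1 w (star z) p q)) =
      ((∑ p, ∑ q, Complex.normSq (curvOp S.1 z w p q) : ℝ) : ℂ) +
      2 * ((Aᵀ * B).trace - (C.map star * C).trace) := by
    have e1 : ∀ p q, curvOp S.1 z w p q * curvOp S.1 (star z) (star w) p q =
        (Complex.normSq (curvOp S.1 z w p q) : ℂ) := fun p q => by
      rw [← Complex.mul_conj]
      congr 1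
      simp [curvOp, map_sum]
    have e2 : ∀ p q, sect S.1 z (star w) p q = star (C q p) := fun p q => by
      rw [hC, ← sect_conj, star_star]
    have e3 : (Aᵀ * B).trace = ∑ p, ∑ q, B p q * A p q := by
      simp only [trace, diag_apply, mul_apply, transpose_apply]
      rw [Finset.sum_comm]
      exact Finset.sum_congr rfl fun p _ => Finset.sum_congr rfl fun q _ => mul_comm _ _
    have e4 : (C.map star * C).trace = ∑ p, ∑ q, star (C q p) * C p q := by
      simp only [trace, diag_apply, mul_apply, map_apply]
      rw [Finset.sum_comm]
    simp only [e1, e2, e3, e4, Finset.sum_add_distrib, Finset.sum_sub_distrib, mul_sub,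
      Finset.mul_sum]
    push_cast
    rfl
  rw [h2]
  have h3 := (Complex.le_def.1 h1).1
  have h4 : 0 ≤ ∑ p, ∑ q, Complex.normSq (curvOp S.1 z w p q) :=
    Finset.sum_nonneg fun p _ => Finset.sum_nonneg fun q _ => Complex.normSq_nonneg _
  rw [Complex.add_re, Complex.ofReal_re]
  have h5 : (2 * ((Aᵀ * B).trace - (C.map star * C).trace)).re =
    2 * ((Aᵀ * B).trace - (C.map star * C).trace).re := by simp
  rw [h5]
  simp only [Complex.zero_re] at h3
  linarith

end NullVector
end
end PinchingCones

namespace PinchingCones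

noncomputable section

open Matrix ComplexConjugate

/-! ### PIC2 as nonnegative complex sectional curvature. -/

section PIC2Characterization

variable {ι : Type*}

/-- The complexification of a real vector. -/
def cplx (x : EuclideanSpace ℝ ι) : ι → ℂ := fun i => (x i : ℂ)

theorem star_cplx (x : EuclideanSpace ℝ ι) : star (cplx x) = cplx x := by
  ext i; simp [cplx]

variable [Fintype ι]

/-- A pair of vectors of `ℂ^ι` that is orthonormal for the standard Hermitian product. -/
def UnitaryPair (z w : ι → ℂ) : Prop :=
  star z ⬝ᵥ z = 1 ∧ star w ⬝ᵥ w = 1 ∧ star z ⬝ᵥ w = 0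

theorem star_dotProduct_self_eq (z : ι → ℂ) :
    star z ⬝ᵥ z = ((∑ i, Complex.normSq (z i) : ℝ) : ℂ) := by
  simp only [dotProduct, Pi.star_apply, Complex.star_def, ← Complex.normSq_eq_conj_mul_self,
    Complex.ofReal_sum]

theorem exists_pos_star_dotProduct_self {z : ι → ℂ} (hz : z ≠ 0) :
    ∃ r : ℝ, 0 < r ∧ star z ⬝ᵥ z = ((r ^ 2 : ℝ) : ℂ) := by
  have hpos : 0 < ∑ i, Complex.normSq (z i) := by
    obtain ⟨i, hi⟩ := Function.ne_iff.1 hz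
    exact Finset.sum_pos' (fun i _ => Complex.normSq_nonneg _)
      ⟨i, Finset.mem_univ _, Complex.normSq_pos.2 hi⟩
  exact ⟨Real.sqrt _, Real.sqrt_pos.2 hpos, by rw [Real.sq_sqrt hpos.le, star_dotProduct_self_eq]⟩

theorem csec_zero_left (R : Tensor4 ι) (w : ι → ℂ) : csec R 0 w = 0 := by
  have := csec_smul_left R 0 0 w
  simpa using this

theorem csec_zero_right (R : Tensor4 ι) (z : ι → ℂ) : csec R z 0 = 0 := by
  have := csec_smul_right R 0 z 0
  simpa using this

/-- Gram-Schmidt orthonormalization for complex sectional curvatures. -/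
theorem csec_gramSchmidt (z w : ι → ℂ) :
    (∀ R : AlgCurv ι, csec R.1 z w = 0) ∨ ∃ a b c : ℂ, ∃ t : ℝ, 0 ≤ t ∧
      UnitaryPair (a • z) (b • w + c • z) ∧
      ∀ R : AlgCurv ι, csec R.1 z w = t * csec R.1 (a • z) (b • w + c • z) := by
  by_cases hz : z = 0
  · left; intro R; rw [hz, csec_zero_left]
  obtain ⟨r, hr, hzr⟩ := exists_pos_star_dotProduct_self hz
  have hrc : (r : ℂ) ≠ 0 := by exact_mod_cast hr.ne'
  set d : ℂ := -(star z ⬝ᵥ w) / (r ^ 2 : ℂ) with hd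
  have horth : star z ⬝ᵥ (w + d • z) = 0 := by
    rw [dotProduct_add, dotProduct_smul, hzr, hd, smul_eq_mul]
    push_cast
    field_simp
    ring
  by_cases hw : w + d • z = 0
  · left; intro R; rw [← csec_add_smul_right R d, hw, csec_zero_right]
  obtain ⟨q, hq, hwq⟩ := exists_pos_star_dotProduct_self hw
  have hqc : (q : ℂ) ≠ 0 := by exact_mod_cast hq.ne'
  right
  have he : (q : ℂ)⁻¹ • w + ((q : ℂ)⁻¹ * d) • z = (q : ℂ)⁻¹ • (w + d • z) := by
    rw [smul_add, smul_smul]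
  refine ⟨(r : ℂ)⁻¹, (q : ℂ)⁻¹, (q : ℂ)⁻¹ * d, r ^ 2 * q ^ 2, by positivity, ⟨?_, ?_, ?_⟩, fun R => ?_⟩
  · rw [star_smul, smul_dotProduct, dotProduct_smul, hzr]
    simp only [smul_eq_mul, star_inv₀, Complex.star_def, Complex.conj_ofReal]
    push_cast
    field_simp
  · rw [he, star_smul, smul_dotProduct, dotProduct_smul, hwq]
    simp only [smul_eq_mul, star_inv₀, Complex.star_def, Complex.conj_ofReal]
    push_cast
    field_simp
  · rw [he, star_smul, smul_dotProduct, dotProduct_smul, horth]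
    simp
  · rw [he, csec_smul_left, csec_smul_right, csec_add_smul_right]
    simp only [map_inv₀, Complex.normSq_ofReal]
    field_simp

theorem nonnegComplex_of_unitaryPair {R : AlgCurv ι}
    (h : ∀ z w, UnitaryPair z w → 0 ≤ csec R.1 z w) : NonnegComplex R.1 := by
  intro z w
  rcases csec_gramSchmidt z w with h0 | ⟨a, b, c, t, ht, hu, hR⟩
  · rw [h0 R]
  · rw [hR R]; exact mul_nonneg ht (h _ _ hu)

theorem cEval_bianchi (R : AlgCurv ι) (x y z w : ι → ℂ) :
    cEval R.1 x y z w + cEval R.1 x z w y + cEval R.1 x w y z = 0 := by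
  have h1 : cEval R.1 x z w y = ∑ i, ∑ j, ∑ k, ∑ l, (R.1 i k l j : ℂ) * x i * y j * z k * w l := by
    simp only [cEval]
    refine Finset.sum_congr rfl fun i _ => ?_
    conv_rhs => rw [Finset.sum_comm]
    refine Finset.sum_congr rfl fun k _ => ?_
    conv_rhs => rw [Finset.sum_comm]
    exact Finset.sum_congr rfl fun l _ => Finset.sum_congr rfl fun j _ => by ring
  have h2 : cEval R.1 x w y z = ∑ i, ∑ j, ∑ k, ∑ l, (R.1 i l j k : ℂ) * x i * y j * z k * w l := by
    simp only [cEval]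
    refine Finset.sum_congr rfl fun i _ => ?_
    rw [Finset.sum_comm]
    refine Finset.sum_congr rfl fun j _ => ?_
    rw [Finset.sum_comm]
    exact Finset.sum_congr rfl fun k _ => Finset.sum_congr rfl fun l _ => by ring
  rw [h1, h2, cEval]
  simp only [← Finset.sum_add_distrib]
  refine Finset.sum_eq_zero fun i _ => Finset.sum_eq_zero fun j _ =>
    Finset.sum_eq_zero fun k _ => Finset.sum_eq_zero fun l _ => ?_
  have := curv_bianchi R i j k l
  have h : (R.1 i j k l : ℂ) + R.1 i k l j + R.1 i l j k = 0 := by exact_mod_cast this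
  linear_combination (x i * y j * z k * w l) * h

theorem cEval_cplx (R : AlgCurv ι) (x y z w : EuclideanSpace ℝ ι) :
    cEval R.1 (cplx x) (cplx y) (cplx z) (cplx w) = (evalCurv R x y z w : ℂ) := by
  simp only [cEval, evalCurv, cplx]
  push_cast
  rfl

/-- The imaginary terms cancel by pair symmetry, and the Bianchi identity collapses the real mixed
terms to `-2 R(a,b,c,d)`. This links the isotropic curvature of a real four-frame with a complex
plane. -/
theorem csec_cplx (R : AlgCurv ι) (a b c d : EuclideanSpace ℝ ι) :
    csec R.1 (cplx a + Complex.I • cplx b) (cplx c + Complex.I • cplx d) =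
      evalCurv R a c a c + evalCurv R a d a d + evalCurv R b c b c + evalCurv R b d b d
        - 2 * evalCurv R a b c d := by
  have key : cEval R.1 (cplx a + Complex.I • cplx b) (cplx c + Complex.I • cplx d)
      (star (cplx a + Complex.I • cplx b)) (star (cplx c + Complex.I • cplx d)) =
      ((evalCurv R a c a c + evalCurv R a d a d + evalCurv R b c b c + evalCurv R b d b d
        - 2 * evalCurv R a b c d : ℝ) : ℂ) := by
    simp only [star_add, star_smul, star_cplx, cEval_add₁, cEval_add₂, cEval_add₃, cEval_add₄,
      cEval_smul₁, cEval_smul₂, cEval_smul₃, cEval_smul₄, Complex.star_def, Complex.conj_I]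
    have hI : Complex.I ^ 2 = -1 := Complex.I_sq
    have hI4 : Complex.I ^ 4 = 1 := Complex.I_pow_four
    have hI3 : Complex.I ^ 3 = -Complex.I := Complex.I_pow_three
    have s1 := cEval_bianchi R (cplx a) (cplx b) (cplx c) (cplx d)
    have s2 := cEval_pair_symm R (cplx a) (cplx c) (cplx b) (cplx d)
    have s3 := cEval_pair_symm R (cplx a) (cplx d) (cplx b) (cplx c)
    have s4 := cEval_pair_symm R (cplx a) (cplx c) (cplx a) (cplx d)
    have s5 := cEval_pair_symm R (cplx a) (cplx c) (cplx b) (cplx c)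
    have s6 := cEval_pair_symm R (cplx a) (cplx d) (cplx b) (cplx d)
    have s7 := cEval_pair_symm R (cplx b) (cplx c) (cplx b) (cplx d)
    have s8 := cEval_antisymm_right R (cplx a) (cplx c) (cplx d) (cplx b)
    push_cast
    simp only [← cEval_cplx]
    ring_nf
    simp only [hI, hI3, hI4]
    linear_combination 2 * s1 - 2 * s8 + s2 - s3 - Complex.I * (s4 + s5 + s6 + s7)
  rw [csec, key, Complex.ofReal_re]

theorem cEval_prodFlat (κ : Type*) [Fintype κ] (R : AlgCurv ι) (x y z w : ι ⊕ κ → ℂ) :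
    cEval (prodFlat κ R).1 x y z w =
      cEval R.1 (x ∘ Sum.inl) (y ∘ Sum.inl) (z ∘ Sum.inl) (w ∘ Sum.inl) := by
  simp [cEval, prodFlat, prodFlatTensor, Fintype.sum_sum_type]

theorem csec_prodFlat (κ : Type*) [Fintype κ] (R : AlgCurv ι) (z w : ι ⊕ κ → ℂ) :
    csec (prodFlat κ R).1 z w = csec R.1 (z ∘ Sum.inl) (w ∘ Sum.inl) := by
  rw [csec, cEval_prodFlat]; rfl

theorem mem_PIC2_of_nonnegComplex {R : AlgCurv ι} (hR : NonnegComplex R.1) : R ∈ PIC2 ι := by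
  intro e _
  rw [← csec_cplx, csec_prodFlat]
  exact hR _ _

/-- Every complex symmetric `2 × 2` matrix is a Gram matrix for the bilinear dot product. -/
theorem exists_dotProduct_eq (a b c : ℂ) :
    ∃ α β : Fin 2 → ℂ, α ⬝ᵥ α = a ∧ α ⬝ᵥ β = b ∧ β ⬝ᵥ β = c := by
  have hsq : ∀ x : ℂ, ∃ y, y * y = x := fun x => by
    obtain ⟨y, hy⟩ := IsAlgClosed.exists_pow_nat_eq x (n := 2) (by norm_num)
    exact ⟨y, by rw [← hy]; ring⟩
  by_cases ha : a = 0
  · by_cases hb : b = 0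
    · obtain ⟨y, hy⟩ := hsq c
      exact ⟨0, ![y, 0], by simp [ha], by simp [hb], by simp [hy]⟩
    -- Take the isotropic vector `(1, i)`; the second vector `(x, y)` solves `x + iy = b`, `x - iy =
    -- c/b`, so that `x² + y² = c`.
    · refine ⟨![1, Complex.I], ![(b + c / b) / 2, (b - c / b) / (2 * Complex.I)], ?_, ?_, ?_⟩
      · simp [ha]
      · simp only [dotProduct, Fin.sum_univ_two, cons_val_zero, cons_val_one]
        field_simp [Complex.I_ne_zero]
        ring
      · simp only [dotProduct, Fin.sum_univ_two, cons_val_zero, cons_val_one]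
        field_simp [Complex.I_ne_zero]
        rw [Complex.I_sq]
        ring
  · obtain ⟨y, hy⟩ := hsq a
    have hy0 : y ≠ 0 := by rintro rfl; exact ha (by rw [← hy]; ring)
    obtain ⟨x, hx⟩ := hsq (c - (b / y) * (b / y))
    refine ⟨![y, 0], ![b / y, x], by simp [hy], ?_, ?_⟩
    · simp only [dotProduct, Fin.sum_univ_two, cons_val_zero, cons_val_one]
      field_simp
      ring
    · simp only [dotProduct, Fin.sum_univ_two, cons_val_zero, cons_val_one, hx]
      ring

/-- The real and imaginary parts of an isotropic unitary pair form, up to scaling, an orthonormal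
four-frame. -/
theorem csec_nonneg_of_isotropic {R : AlgCurv ι} (hR : NonnegIsotropic R) {z w : ι → ℂ}
    (hu : UnitaryPair z w) (hzz : z ⬝ᵥ z = 0) (hzw : z ⬝ᵥ w = 0) (hww : w ⬝ᵥ w = 0) :
    0 ≤ csec R.1 z w := by
  set e : Fin 4 → EuclideanSpace ℝ ι := ![WithLp.toLp 2 fun i => √2 * (z i).re,
    WithLp.toLp 2 fun i => √2 * (z i).im, WithLp.toLp 2 fun i => √2 * (w i).re,
    WithLp.toLp 2 fun i => √2 * (w i).im] with he
  -- The real and imaginary parts of an isotropic unit vector each have squared length `1/2`, whence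
  -- the factors `√2` in the frame.
  have hs : √2 * √2 = 2 := Real.mul_self_sqrt (by norm_num)
  have hsum : ∀ f g : ι → ℝ, inner ℝ (WithLp.toLp 2 fun i => √2 * f i : EuclideanSpace ℝ ι)
      (WithLp.toLp 2 fun i => √2 * g i) = 2 * ∑ i, f i * g i := fun f g => by
    simp only [PiLp.inner_apply, Finset.mul_sum]
    refine Finset.sum_congr rfl fun i _ => ?_
    simp only [RCLike.inner_apply, conj_trivial]
    linear_combination (f i * g i) * hs
  have c1 := congrArg Complex.re hu.1
  have c2 := congrArg Complex.re hu.2.1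
  have c3 := congrArg Complex.re hu.2.2
  have c3' := congrArg Complex.im hu.2.2
  have c4 := congrArg Complex.re hzz
  have c4' := congrArg Complex.im hzz
  have c5 := congrArg Complex.re hzw
  have c5' := congrArg Complex.im hzw
  have c6 := congrArg Complex.re hww
  have c6' := congrArg Complex.im hww
  simp only [dotProduct, Complex.re_sum, Complex.im_sum, Pi.star_apply, Complex.star_def,
    Complex.mul_re, Complex.mul_im, Complex.conj_re, Complex.conj_im, Finset.sum_sub_distrib,
    Finset.sum_add_distrib, neg_mul, Finset.sum_neg_distrib, sub_neg_eq_add, Complex.one_re,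
    Complex.zero_re, Complex.zero_im] at c1 c2 c3 c3' c4 c4' c5 c5' c6 c6'
  have hcomm : ∀ f g : ι → ℝ, ∑ i, f i * g i = ∑ i, g i * f i := fun f g =>
    Finset.sum_congr rfl fun i _ => mul_comm _ _
  have horth : Orthonormal ℝ e := by
    rw [orthonormal_iff_ite]
    have d1 := hcomm (fun i => (z i).im) (fun i => (z i).re)
    have d2 := hcomm (fun i => (w i).im) (fun i => (w i).re)
    have d3 := hcomm (fun i => (w i).im) (fun i => (z i).re)
    have d4 := hcomm (fun i => (w i).re) (fun i => (z i).re)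
    have d5 := hcomm (fun i => (w i).im) (fun i => (z i).im)
    have d6 := hcomm (fun i => (w i).re) (fun i => (z i).im)
    intro i j
    fin_cases i <;> fin_cases j <;>
      simp [he, hsum, -inner_self_eq_norm_sq_to_K] <;> linarith
  have h := hR e horth
  rw [← csec_cplx] at h
  have hz : cplx (e 0) + Complex.I • cplx (e 1) = (√2 : ℂ) • z := by
    ext i
    simp only [he, cplx, Pi.add_apply, Pi.smul_apply, smul_eq_mul, cons_val_zero, cons_val_one]
    push_cast
    conv_rhs => rw [← Complex.re_add_im (z i)]
    ring
  have hw : cplx (e 2) + Complex.I • cplx (e 3) = (√2 : ℂ) • w := by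
    ext i
    simp only [he, cplx, Pi.add_apply, Pi.smul_apply, smul_eq_mul, cons_val]
    push_cast
    conv_rhs => rw [← Complex.re_add_im (w i)]
    ring
  rw [hz, hw, csec_smul_left, csec_smul_right, Complex.normSq_ofReal, hs] at h
  linarith

/-- The flat `ℝ²` supplies components whose bilinear Gram matrix cancels that of `(z, w)`. Every
complex plane thus lifts to an isotropic plane without changing the curvature, and Gram-Schmidt
preserves isotropy. -/
theorem nonnegComplex_of_mem_PIC2 {R : AlgCurv ι} (hR : R ∈ PIC2 ι) : NonnegComplex R.1 := by
  intro z w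
  obtain ⟨α, β, h1, h2, h3⟩ := exists_dotProduct_eq (-(z ⬝ᵥ z)) (-(z ⬝ᵥ w)) (-(w ⬝ᵥ w))
  set z' : ι ⊕ Fin 2 → ℂ := Sum.elim z α with hz'
  set w' : ι ⊕ Fin 2 → ℂ := Sum.elim w β with hw'
  have e1 : z' ⬝ᵥ z' = 0 := by rw [hz', sumElim_dotProduct_sumElim, h1, add_neg_cancel]
  have e2 : z' ⬝ᵥ w' = 0 := by rw [hz', hw', sumElim_dotProduct_sumElim, h2, add_neg_cancel]
  have e3 : w' ⬝ᵥ w' = 0 := by rw [hw', sumElim_dotProduct_sumElim, h3, add_neg_cancel]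
  have hcs : csec R.1 z w = csec (prodFlat (Fin 2) R).1 z' w' := by
    rw [csec_prodFlat]; rfl
  rw [hcs]
  rcases csec_gramSchmidt z' w' with h0 | ⟨a, b, c, t, ht, hu, hR'⟩
  · rw [h0]
  · rw [hR']
    refine mul_nonneg ht (csec_nonneg_of_isotropic hR hu ?_ ?_ ?_)
    · simp [smul_dotProduct, dotProduct_smul, e1]
    · simp [smul_dotProduct, dotProduct_smul, e1, e2]
    · simp [smul_dotProduct, dotProduct_smul, add_dotProduct, dotProduct_add, e1, e2, e3,
        dotProduct_comm w' z']

end PIC2Characterization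
end
end PinchingCones

namespace PinchingCones

noncomputable section

open Matrix ComplexConjugate ComplexOrder MatrixOrder

/-! ### Trace inequalities for compressions, and the scalar inequality they feed. -/

section Frobenius

variable {n : Type*} [Fintype n]

theorem re_trace_conjTranspose_mul_self {m : Type*} [Fintype m] (X : Matrix m n ℂ) :
    (Xᴴ * X).trace.re = ∑ i, ∑ j, ‖X i j‖ ^ 2 := by
  rw [Finset.sum_comm]
  simp only [trace, diag_apply, mul_apply, conjTranspose_apply, Complex.re_sum]
  refine Finset.sum_congr rfl fun i _ => Finset.sum_congr rfl fun j _ => ?_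
  rw [Complex.star_def, ← Complex.normSq_eq_conj_mul_self, Complex.ofReal_re,
    Complex.normSq_eq_norm_sq]

theorem re_trace_conjTranspose_mul_le (X Y : Matrix n n ℂ) :
    ((Xᴴ * Y)ᴴ * (Xᴴ * Y)).trace.re ≤ (Xᴴ * X).trace.re * (Yᴴ * Y).trace.re := by
  let _ : NormedAddCommGroup (Matrix n n ℂ) := Matrix.frobeniusNormedAddCommGroup
  have hsq : ∀ Z : Matrix n n ℂ, ‖Z‖ ^ 2 = (Zᴴ * Z).trace.re := fun Z => by
    rw [re_trace_conjTranspose_mul_self, Matrix.frobenius_norm_def, ← Real.sqrt_eq_rpow,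
      Real.sq_sqrt (by positivity)]
    simp
  rw [← hsq, ← hsq, ← hsq, ← mul_pow]
  refine pow_le_pow_left₀ (norm_nonneg _) ?_ 2
  refine (Matrix.frobenius_norm_mul Xᴴ Y).trans_eq ?_
  rw [Matrix.frobenius_norm_conjTranspose]

theorem trace_mul_projections {P E₁ E₂ : Matrix n n ℂ} (hP : P.IsHermitian)
    (h₁ : E₁.IsHermitian) (h₁' : E₁ * E₁ = E₁) (h₂ : E₂.IsHermitian) (h₂' : E₂ * E₂ = E₂) :
    ((E₁ * P * E₂)ᴴ * (E₁ * P * E₂)).trace = (P * E₁ * P * E₂).trace := by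
  rw [conjTranspose_mul, conjTranspose_mul, hP.eq, h₁.eq, h₂.eq]
  calc (E₂ * (P * E₁) * (E₁ * P * E₂)).trace = (E₂ * (P * (E₁ * E₁) * P * E₂)).trace := by
        simp only [Matrix.mul_assoc]
    _ = (P * E₁ * P * (E₂ * E₂)).trace := by
        rw [h₁', trace_mul_comm, Matrix.mul_assoc]
    _ = _ := by rw [h₂']

theorem re_trace_mul_projections_nonneg {P E₁ E₂ : Matrix n n ℂ} (hP : P.IsHermitian)
    (h₁ : E₁.IsHermitian) (h₁' : E₁ * E₁ = E₁) (h₂ : E₂.IsHermitian) (h₂' : E₂ * E₂ = E₂) :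
    0 ≤ (P * E₁ * P * E₂).trace.re := by
  rw [← trace_mul_projections hP h₁ h₁' h₂ h₂', re_trace_conjTranspose_mul_self]
  positivity

/-- With `P = B* B` the left side is the squared Frobenius norm of `(B E₁)* (B E₂)`, which is at
most the product of the squared norms of `B E₁` and `B E₂`. -/
theorem re_trace_mul_projections_le [DecidableEq n] {P E₁ E₂ : Matrix n n ℂ} (hP : P.PosSemidef)
    (h₁ : E₁.IsHermitian) (h₁' : E₁ * E₁ = E₁) (h₂ : E₂.IsHermitian) (h₂' : E₂ * E₂ = E₂) :
    (P * E₁ * P * E₂).trace.re ≤ (P * E₁).trace.re * (P * E₂).trace.re := by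
  obtain ⟨B, hB⟩ : ∃ B : Matrix n n ℂ, P = Bᴴ * B := by
    obtain ⟨B, hB⟩ := (CStarAlgebra.nonneg_iff_eq_star_mul_self (A := Matrix n n ℂ)).mp hP.nonneg
    exact ⟨B, hB⟩
  have hBX : ∀ E : Matrix n n ℂ, E.IsHermitian → E * E = E →
      ((B * E)ᴴ * (B * E)).trace = (P * E).trace := by
    intro E h h'
    rw [conjTranspose_mul, h.eq, Matrix.mul_assoc, trace_mul_comm, hB]
    simp only [Matrix.mul_assoc, h']
  have := re_trace_conjTranspose_mul_le (B * E₁) (B * E₂)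
  rw [hBX E₁ h₁ h₁', hBX E₂ h₂ h₂'] at this
  have e : (B * E₁)ᴴ * (B * E₂) = E₁ * P * E₂ := by
    rw [conjTranspose_mul, h₁.eq, hB]; simp only [Matrix.mul_assoc]
  rwa [e, trace_mul_projections hP.1 h₁ h₁' h₂ h₂'] at this

/-- The squared Frobenius norms of the blocks of `K` with respect to `E` and `1 - E` are
nonnegative. -/
theorem re_trace_compression_nonneg [DecidableEq n] {K E : Matrix n n ℂ} (hK : K.IsHermitian)
    (h : E.IsHermitian) (h' : E * E = E) :
    0 ≤ (K * E * K * E).trace.re ∧ (K * E * K * E).trace.re ≤ (K * K * E).trace.re ∧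
    (K * E * K * E).trace.re ≤ (K * K).trace.re := by
  have g : (1 - E).IsHermitian := isHermitian_one.sub h
  have g' : (1 - E) * (1 - E) = 1 - E := by
    simp only [mul_sub, sub_mul, mul_one, one_mul, h']; abel
  have e : (K * E * K).trace = (K * K * E).trace := by
    rw [trace_mul_comm, Matrix.mul_assoc]
  have a0 := re_trace_mul_projections_nonneg hK h h' h h'
  have b0 := re_trace_mul_projections_nonneg hK h h' g g'
  have c0 := re_trace_mul_projections_nonneg hK g g' g g'
  simp only [mul_sub, sub_mul, mul_one, trace_sub, Complex.sub_re, e] at b0 c0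
  exact ⟨a0, by linarith, by linarith⟩

/-- Inequalities between the traces attached to a compression of a positive matrix. -/
theorem re_trace_compression_bounds [DecidableEq n] {P E : Matrix n n ℂ} (hP : P.PosSemidef)
    (h : E.IsHermitian) (h' : E * E = E) :
    (P * E * P * E).trace.re ≤ (P * E).trace.re ^ 2 ∧
    (P * E * P * E).trace.re ≤ (P * P * E).trace.re ∧
    (P * P * E).trace.re - (P * E * P * E).trace.re ≤
      (P * E).trace.re * (P.trace.re - (P * E).trace.re) ∧
    (P * P).trace.re - 2 * (P * P * E).trace.re + (P * E * P * E).trace.re ≤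
      (P.trace.re - (P * E).trace.re) ^ 2 := by
  have g : (1 - E).IsHermitian := isHermitian_one.sub h
  have g' : (1 - E) * (1 - E) = 1 - E := by
    simp only [mul_sub, sub_mul, mul_one, one_mul, h']; abel
  have e : (P * E * P).trace = (P * P * E).trace := by
    rw [trace_mul_comm, Matrix.mul_assoc]
  have a1 := re_trace_mul_projections_le hP h h' h h'
  have b1 := re_trace_mul_projections_le hP h h' g g'
  have c1 := re_trace_mul_projections_le hP g g' g g'
  simp only [mul_sub, sub_mul, mul_one, trace_sub, Complex.sub_re, e] at b1 c1
  exact ⟨by rw [sq]; exact a1, (re_trace_compression_nonneg hP.1 h h').2.1, by linarith,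
    by rw [sq]; linarith⟩

end Frobenius

/-- The algebraic inequality behind the invariance of the pinching condition. -/
theorem pinching_inequality {n N σ τ a t q : ℝ} (hn : 4 ≤ n) (hσ : 0 ≤ σ) (hσ2 : σ ≤ 2)
    (h1 : a ≤ τ ^ 2) (h2 : a ≤ t) (h3 : t - a ≤ τ * (N - τ)) (h4 : q - 2 * t + a ≤ (N - τ) ^ 2) :
    N ^ 2 * (1 - σ) ^ 2 ≤ N ^ 2 - σ * (2 - σ) * q
        + σ ^ 2 * (-N * τ + (n - 2) * ((τ ^ 2 - a) / 2) + t) ∨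
      N ^ 2 * (1 - σ / 2) ^ 2 ≤ N ^ 2 - σ * (2 - σ) * q
        + σ ^ 2 * (-N * τ + (n - 2) * ((τ ^ 2 - a) / 2) + t) := by
  -- `X` is the slack in the off-diagonal block estimate `h3`. Up to multiples of `τ² - a ≥ 0`, both
  -- the `q`-term and the `σ²`-term depend only on `X`; the coefficient `(n-4)/2` in the second case
  -- needs `n ≥ 4`.
  set X := τ * (N - τ) - (t - a) with hX
  have hX0 : 0 ≤ X := by linarith
  have hX1 : X ≤ N ^ 2 / 4 := by nlinarith [sq_nonneg (N - 2 * τ)]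
  have hss : 0 ≤ σ * (2 - σ) := mul_nonneg hσ (by linarith)
  have hD : σ * (2 - σ) * (2 * X) ≤ σ * (2 - σ) * (N ^ 2 - q) :=
    mul_le_mul_of_nonneg_left (by nlinarith) hss
  have hG : σ ^ 2 * (-X) ≤ σ ^ 2 * (-N * τ + (n - 2) * ((τ ^ 2 - a) / 2) + t) := by
    refine mul_le_mul_of_nonneg_left ?_ (sq_nonneg σ)
    nlinarith [mul_nonneg (sub_nonneg.2 hn) (sub_nonneg.2 h1)]
  have hE : N ^ 2 * (1 - σ) ^ 2 + σ * (4 - 3 * σ) * X ≤ N ^ 2 - σ * (2 - σ) * q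
        + σ ^ 2 * (-N * τ + (n - 2) * ((τ ^ 2 - a) / 2) + t) := by
    linarith
  -- The lower bound is affine in `X` on `[0, N²/4]`, so its minimum is at an endpoint: `X = 0`
  -- gives `N²(1-σ)²`, and `X = N²/4` gives `N²(1-σ/2)²`.
  rcases le_total 0 (4 - 3 * σ) with h | h
  · left
    have : 0 ≤ σ * (4 - 3 * σ) * X := mul_nonneg (mul_nonneg hσ h) hX0
    linarith
  · right
    have : 0 ≤ σ * (3 * σ - 4) * (N ^ 2 / 4 - X) :=
      mul_nonneg (mul_nonneg hσ (by linarith)) (by linarith)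
    linarith

end
end PinchingCones

namespace PinchingCones

noncomputable section

open Matrix ComplexConjugate ComplexOrder MatrixOrder

/-! ### Complex sectional curvatures of Kulkarni-Nomizu products as traces against a plane
projection. -/

section Forms

variable {ι : Type*}

/-- The complexification of a real matrix. -/
abbrev cMat (A : Matrix ι ι ℝ) : Matrix ι ι ℂ := A.map Complex.ofRealHom

/-- The orthogonal projection onto the span of a unitary pair. -/
def planeProj (z w : ι → ℂ) : Matrix ι ι ℂ := vecMulVec z (star z) + vecMulVec w (star w)

theorem planeProj_isHermitian (z w : ι → ℂ) : (planeProj z w).IsHermitian := by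
  ext i j
  simp [planeProj, vecMulVec_apply, mul_comm]

theorem cMat_isHermitian {K : Matrix ι ι ℝ} (hK : K.IsSymm) : (cMat K).IsHermitian := by
  ext i j
  simp [hK.apply]

variable [Fintype ι]

theorem cMat_mul (A B : Matrix ι ι ℝ) : cMat (A * B) = cMat A * cMat B := Matrix.map_mul

theorem re_trace_cMat (A : Matrix ι ι ℝ) : (cMat A).trace.re = A.trace := by
  simp [trace]

/-- The complex bilinear extension of a real bilinear form. -/
def cForm (A : Matrix ι ι ℝ) (x y : ι → ℂ) : ℂ := ∑ i, ∑ j, (A i j : ℂ) * x i * y j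

theorem cForm_comm {A : Matrix ι ι ℝ} (hA : A.IsSymm) (x y : ι → ℂ) :
    cForm A x y = cForm A y x := by
  simp only [cForm]
  rw [Finset.sum_comm]
  refine Finset.sum_congr rfl fun i _ => Finset.sum_congr rfl fun j _ => ?_
  rw [hA.apply]; ring

theorem conj_cForm (A : Matrix ι ι ℝ) (x y : ι → ℂ) :
    conj (cForm A x y) = cForm A (star x) (star y) := by
  simp [cForm, map_sum]

theorem cForm_one [DecidableEq ι] (x y : ι → ℂ) : cForm 1 x y = x ⬝ᵥ y := by
  simp [cForm, dotProduct, one_apply, apply_ite Complex.ofReal, ite_mul]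

theorem cEval_kn (A B : Matrix ι ι ℝ) (x y z w : ι → ℂ) :
    cEval (kn A B) x y z w = cForm A x z * cForm B y w - cForm A x w * cForm B y z
      - cForm A y z * cForm B x w + cForm A y w * cForm B x z := by
  have h1 : ∀ (A B : Matrix ι ι ℝ), cForm A x z * cForm B y w = ∑ i, ∑ j, ∑ k, ∑ l,
      ((A i k : ℂ) * x i * z k) * ((B j l : ℂ) * y j * w l) := fun A B => (sum_mul_sum₁₃ _ _).symm
  have h2 : ∀ (A B : Matrix ι ι ℝ), cForm A x w * cForm B y z = ∑ i, ∑ j, ∑ k, ∑ l,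
      ((A i l : ℂ) * x i * w l) * ((B j k : ℂ) * y j * z k) := fun A B => (sum_mul_sum₁₄ _ _).symm
  rw [mul_comm (cForm A y z), mul_comm (cForm A y w), h1, h2, h1, h2]
  simp only [← Finset.sum_sub_distrib, ← Finset.sum_add_distrib, cEval, kn]
  refine Finset.sum_congr rfl fun i _ => Finset.sum_congr rfl fun j _ =>
    Finset.sum_congr rfl fun k _ => Finset.sum_congr rfl fun l _ => ?_
  push_cast
  ring

theorem UnitaryPair.symm {z w : ι → ℂ} (h : UnitaryPair z w) : UnitaryPair w z := by
  refine ⟨h.2.1, h.1, ?_⟩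
  have := congrArg star h.2.2
  rw [star_dotProduct, star_star, star_zero] at this
  exact this

theorem planeProj_mul_self {z w : ι → ℂ} (h : UnitaryPair z w) :
    planeProj z w * planeProj z w = planeProj z w := by
  simp only [planeProj, mul_add, add_mul, vecMulVec_mul_vecMulVec, h.1, h.2.1, h.2.2,
    h.symm.2.2]
  simp

theorem trace_planeProj {z w : ι → ℂ} (h : UnitaryPair z w) : (planeProj z w).trace = 2 := by
  rw [planeProj, trace_add, trace_vecMulVec, trace_vecMulVec, dotProduct_comm, h.1,
    dotProduct_comm, h.2.1]
  norm_num

theorem trace_cMat_mul_vecMulVec (A : Matrix ι ι ℝ) (x y : ι → ℂ) :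
    (cMat A * vecMulVec x y).trace = cForm A y x := by
  rw [mul_vecMulVec, trace_vecMulVec]
  simp only [dotProduct, mulVec, cForm, map_apply, Finset.sum_mul]
  exact Finset.sum_congr rfl fun i _ => Finset.sum_congr rfl fun j _ => by
    simp only [Complex.ofRealHom_eq_coe]; ring

theorem trace_cMat_mul_vecMulVec₂ (A : Matrix ι ι ℝ) (x y x' y' : ι → ℂ) :
    (cMat A * vecMulVec x y * cMat A * vecMulVec x' y').trace = cForm A y x' * cForm A y' x := by
  have e : cMat A * vecMulVec x y * cMat A = vecMulVec (cMat A *ᵥ x) (y ᵥ* cMat A) := by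
    rw [mul_vecMulVec, vecMulVec_mul]
  rw [e, vecMulVec_mul_vecMulVec, trace_vecMulVec, dotProduct_smul,
    ← trace_cMat_mul_vecMulVec, ← trace_cMat_mul_vecMulVec, mul_vecMulVec, mul_vecMulVec,
    trace_vecMulVec, trace_vecMulVec, smul_eq_mul, dotProduct_comm (cMat A *ᵥ x') y,
    dotProduct_mulVec]

theorem trace_cMat_mul_planeProj (A : Matrix ι ι ℝ) (z w : ι → ℂ) :
    (cMat A * planeProj z w).trace = cForm A (star z) z + cForm A (star w) w := by
  rw [planeProj, mul_add, trace_add, trace_cMat_mul_vecMulVec, trace_cMat_mul_vecMulVec]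

theorem trace_cMat_mul_planeProj₂ (A : Matrix ι ι ℝ) (z w : ι → ℂ) :
    (cMat A * planeProj z w * cMat A * planeProj z w).trace =
      cForm A (star z) z ^ 2 + 2 * (cForm A (star z) w * cForm A (star w) z)
        + cForm A (star w) w ^ 2 := by
  simp only [planeProj, mul_add, add_mul, trace_add, trace_cMat_mul_vecMulVec₂]
  ring

theorem im_trace_cMat_mul_planeProj {A : Matrix ι ι ℝ} (hA : A.IsSymm) (z w : ι → ℂ) :
    (cMat A * planeProj z w).trace.im = 0 := by
  rw [← Complex.conj_eq_iff_im, trace_cMat_mul_planeProj, map_add, conj_cForm, conj_cForm,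
    star_star, star_star, cForm_comm hA z, cForm_comm hA w]

theorem csec_kn_self {A : Matrix ι ι ℝ} (hA : A.IsSymm) (z w : ι → ℂ) :
    csec (kn A A) z w = (cMat A * planeProj z w).trace.re ^ 2
      - (cMat A * planeProj z w * cMat A * planeProj z w).trace.re := by
  have h : cEval (kn A A) z w (star z) (star w) = (cMat A * planeProj z w).trace ^ 2
      - (cMat A * planeProj z w * cMat A * planeProj z w).trace := by
    rw [cEval_kn, trace_cMat_mul_planeProj₂, trace_cMat_mul_planeProj, cForm_comm hA (star z) z,
      cForm_comm hA (star w) w, cForm_comm hA (star w) z, cForm_comm hA (star z) w]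
    ring
  rw [csec, h, Complex.sub_re, sq, Complex.mul_re, im_trace_cMat_mul_planeProj hA]
  ring

variable [DecidableEq ι]

theorem csec_kn_one {A : Matrix ι ι ℝ} (hA : A.IsSymm) {z w : ι → ℂ} (h : UnitaryPair z w) :
    csec (kn A 1) z w = (cMat A * planeProj z w).trace.re := by
  have h1 : w ⬝ᵥ star z = 0 := by rw [dotProduct_comm, h.2.2]
  have h2 : z ⬝ᵥ star w = 0 := by rw [dotProduct_comm, h.symm.2.2]
  have h3 : z ⬝ᵥ star z = 1 := by rw [dotProduct_comm, h.1]
  have h4 : w ⬝ᵥ star w = 1 := by rw [dotProduct_comm, h.2.1]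
  rw [csec, cEval_kn, trace_cMat_mul_planeProj]
  simp only [cForm_one, h1, h2, h3, h4, cForm_comm hA (star z) z, cForm_comm hA (star w) w]
  simp

theorem csec_one {z w : ι → ℂ} (h : UnitaryPair z w) : csec (kn (1 : Matrix ι ι ℝ) 1) z w = 2 := by
  rw [csec_kn_one isSymm_one h]
  simp [trace_planeProj h]

theorem csec_warp {K : Matrix ι ι ℝ} (hK : K.IsSymm) {z w : ι → ℂ} (h : UnitaryPair z w) :
    csec (warp K) z w = ((Fintype.card ι : ℝ) - 2) * ((cMat K * planeProj z w).trace.re ^ 2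
      - (cMat K * planeProj z w * cMat K * planeProj z w).trace.re)
      + 2 * (cMat K * cMat K * planeProj z w).trace.re := by
  have hKK : (K * K).IsSymm := by rw [Matrix.IsSymm, Matrix.transpose_mul, hK.eq]
  rw [warp, csec_add, csec_smul, csec_smul, csec_kn_self hK, csec_kn_one hKK h, cMat_mul]

theorem cMat_posSemidef {P : Matrix ι ι ℝ} (hP : P.PosSemidef) : (cMat P).PosSemidef := by
  obtain ⟨B, hB⟩ := (CStarAlgebra.nonneg_iff_eq_star_mul_self (A := Matrix ι ι ℝ)).mp hP.nonneg
  have : cMat P = (cMat B)ᴴ * cMat B := by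
    rw [hB, cMat_mul]
    congr 1
    ext i j
    simp
  rw [this]
  exact posSemidef_conjTranspose_mul_self _

/-- Only the compression term of `csec_warp` can be negative, and it is controlled by `tr(K²)`. This
crude bound is enough on the scalar face. -/
theorem csec_warp_ge {K : Matrix ι ι ℝ} (hK : K.IsSymm) (hn : 2 ≤ Fintype.card ι) {z w : ι → ℂ}
    (h : UnitaryPair z w) :
    -(((Fintype.card ι : ℝ) - 2) * (K * K).trace) ≤ csec (warp K) z w := by
  obtain ⟨h1, h2, h3⟩ := re_trace_compression_nonneg (cMat_isHermitian hK)
    (planeProj_isHermitian z w) (planeProj_mul_self h)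
  rw [← cMat_mul, re_trace_cMat] at h3
  rw [csec_warp hK h]
  have hn' : (0 : ℝ) ≤ (Fintype.card ι : ℝ) - 2 := by
    have : (2 : ℝ) ≤ Fintype.card ι := by exact_mod_cast hn
    linarith
  nlinarith [mul_nonneg hn' (sq_nonneg (cMat K * planeProj z w).trace.re),
    mul_nonneg hn' (sub_nonneg.2 h3)]

/-- A positive matrix `P` satisfies `tr(P²) ≤ tr(P)²`; apply this to `P = k id - K`, whose trace is
`nk` because `K` is trace-free. -/
theorem trace_sq_le {K : Matrix ι ι ℝ} (hK0 : K.trace = 0) {k : ℝ}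
    (hP : (k • (1 : Matrix ι ι ℝ) - K).PosSemidef) :
    (K * K).trace ≤ (Fintype.card ι * k) ^ 2 := by
  have h := (re_trace_compression_bounds (cMat_posSemidef hP) isHermitian_one (mul_one 1)).1
  simp only [mul_one] at h
  rw [← cMat_mul, re_trace_cMat, re_trace_cMat] at h
  simp only [mul_sub, sub_mul, Matrix.mul_smul, Matrix.smul_mul, mul_one, one_mul, trace_sub,
    trace_smul, hK0, trace_one, smul_eq_mul] at h
  have : 0 ≤ (Fintype.card ι : ℝ) * k ^ 2 := by positivity
  nlinarith

/-- Rewritten in terms of `P = k id - K` and the plane projection `E`, this becomes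
`pinching_inequality` with `N = nk`, `τ = tr(PE)`, `a = tr(PEPE)`, `t = tr(P²E)` and `q = tr(P²)`.
-/
theorem warp_pinching {K : Matrix ι ι ℝ} (hK : K.IsSymm) (hK0 : K.trace = 0) {k σ : ℝ}
    (hP : (k • (1 : Matrix ι ι ℝ) - K).PosSemidef) (hn : 4 ≤ Fintype.card ι) (hσ : 0 ≤ σ)
    (hσ2 : σ ≤ 2) {z w : ι → ℂ} (h : UnitaryPair z w) :
    (Fintype.card ι * k) ^ 2 * (1 - σ) ^ 2 ≤ Fintype.card ι * (Fintype.card ι - 2 * σ) * k ^ 2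
        - σ * (2 - σ) * (K * K).trace + σ ^ 2 / 2 * csec (warp K) z w ∨
      (Fintype.card ι * k) ^ 2 * (1 - σ / 2) ^ 2 ≤
        Fintype.card ι * (Fintype.card ι - 2 * σ) * k ^ 2
        - σ * (2 - σ) * (K * K).trace + σ ^ 2 / 2 * csec (warp K) z w := by
  have hn' : (4 : ℝ) ≤ Fintype.card ι := by exact_mod_cast hn
  set P := k • (1 : Matrix ι ι ℝ) - K with hPdef
  have hKP : cMat K = (k : ℂ) • (1 : Matrix ι ι ℂ) - cMat P := by
    ext i j
    by_cases hij : i = j <;> simp [hPdef, hij, one_apply]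
  obtain ⟨h1, h2, h3, h4⟩ := re_trace_compression_bounds (cMat_posSemidef hP)
    (planeProj_isHermitian z w) (planeProj_mul_self h)
  have key := pinching_inequality hn' hσ hσ2 h1 h2 h3 h4
  rw [← cMat_mul, re_trace_cMat, re_trace_cMat] at key
  have e1 : P.trace = Fintype.card ι * k := by
    rw [hPdef, trace_sub, trace_smul, trace_one, hK0, smul_eq_mul]; ring
  have e2 : (P * P).trace = Fintype.card ι * k ^ 2 + (K * K).trace := by
    simp only [hPdef, mul_sub, sub_mul, Matrix.mul_smul, Matrix.smul_mul, mul_one, one_mul,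
      trace_sub, trace_smul, hK0, trace_one, smul_eq_mul]
    ring
  have e3 : csec (warp K) z w = 2 * (Fintype.card ι * k ^ 2
      - Fintype.card ι * k * (cMat P * planeProj z w).trace.re
      + ((Fintype.card ι : ℝ) - 2) * (((cMat P * planeProj z w).trace.re ^ 2
        - (cMat P * planeProj z w * cMat P * planeProj z w).trace.re) / 2)
      + (cMat P * cMat P * planeProj z w).trace.re) := by
    have f1 : (cMat K * planeProj z w).trace.re = 2 * k - (cMat P * planeProj z w).trace.re := by
      rw [hKP]
      simp only [sub_mul, Matrix.smul_mul, one_mul, trace_sub, trace_smul, trace_planeProj h,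
        smul_eq_mul, Complex.sub_re, Complex.re_ofReal_mul]
      simp; ring
    have f2 : (cMat K * planeProj z w * cMat K * planeProj z w).trace.re = 2 * k ^ 2
        - 2 * k * (cMat P * planeProj z w).trace.re
        + (cMat P * planeProj z w * cMat P * planeProj z w).trace.re := by
      have g : (planeProj z w * (cMat P * planeProj z w)).trace = (cMat P * planeProj z w).trace := by
        rw [trace_mul_comm, Matrix.mul_assoc, planeProj_mul_self h]
      rw [hKP]
      simp only [sub_mul, mul_sub, Matrix.smul_mul, Matrix.mul_smul, one_mul, mul_one, trace_sub,
        trace_smul, planeProj_mul_self h, trace_planeProj h, Matrix.mul_assoc, g,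
        smul_eq_mul, Complex.sub_re, Complex.re_ofReal_mul]
      simp; ring
    have f3 : (cMat K * cMat K * planeProj z w).trace.re = 2 * k ^ 2
        - 2 * k * (cMat P * planeProj z w).trace.re
        + (cMat P * cMat P * planeProj z w).trace.re := by
      rw [hKP]
      simp only [sub_mul, mul_sub, Matrix.smul_mul, Matrix.mul_smul, one_mul, mul_one, trace_sub,
        trace_smul, trace_planeProj h, Matrix.mul_assoc,
        smul_eq_mul, Complex.sub_re, Complex.re_ofReal_mul]
      simp; ring
    rw [csec_warp hK h, f1, f2, f3]
    ring
  rw [e1, e2] at key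
  rw [e3, ← cMat_mul]
  refine key.imp (fun hh => hh.trans_eq ?_) (fun hh => hh.trans_eq ?_) <;> ring

end Forms
end
end PinchingCones

namespace PinchingCones

noncomputable section

open Matrix ComplexConjugate ComplexOrder MatrixOrder

/-! ### Rigidity at zero scalar curvature and extremal eigenvectors. -/

section Flat

variable {ι : Type*} [Fintype ι] [DecidableEq ι]

theorem cEval_single (R : Tensor4 ι) (i j k l : ι) :
    cEval R (Pi.single i 1) (Pi.single j 1) (Pi.single k 1) (Pi.single l 1) = R i j k l := by
  simp [cEval, Pi.single_apply]

/-- The coordinate sectional curvatures are nonnegative with nonpositive sum, so they vanish.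
Polarizing twice makes `R` skew under exchange of the second and fourth index, and the Bianchi
identity then leaves `3R = 0`. -/
theorem eq_zero_of_scal_nonpos {R : AlgCurv ι} (hR : NonnegComplex R.1) (hs : scal R ≤ 0) :
    R = 0 := by
  have hstar : ∀ i, star (Pi.single i 1 : ι → ℂ) = Pi.single i 1 := fun i => by
    rw [← Pi.single_star, star_one]
  have h1 : ∀ i j, 0 ≤ R.1 i j i j := fun i j => by
    simpa [csec, hstar, cEval_single] using hR (Pi.single i 1) (Pi.single j 1)
  have hsum : ∑ i, ∑ j, R.1 i j i j ≤ 0 := hs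
  have h2 : ∀ i j, R.1 i j i j = 0 := fun i j => by
    have a := (Finset.sum_eq_zero_iff_of_nonneg (s := Finset.univ)
      (fun i _ => Finset.sum_nonneg fun j _ => h1 i j)).1
      (le_antisymm hsum (Finset.sum_nonneg fun i _ => Finset.sum_nonneg fun j _ => h1 i j)) i
      (Finset.mem_univ _)
    exact (Finset.sum_eq_zero_iff_of_nonneg (fun j _ => h1 i j)).1 a j (Finset.mem_univ _)
  have h3 : ∀ i j k, R.1 i j k j = 0 := fun i j k => by
    have a := hR (Pi.single i 1 + (1 : ℂ) • Pi.single k 1) (Pi.single j 1)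
    have b := hR (Pi.single i 1 + (-1 : ℂ) • Pi.single k 1) (Pi.single j 1)
    simp only [csec, star_add, star_smul, hstar, cEval_add₁, cEval_add₃, cEval_smul₁, cEval_smul₃,
      cEval_single, h2, star_neg, star_one, curv_pair_symm R k j i j] at a b
    norm_num at a b
    linarith
  have h4 : ∀ i j k, R.1 j i j k = 0 := fun i j k => by
    rw [curv_antisymm, curv_antisymm_right, h3]; simp
  have h5 : ∀ i j k l, R.1 i j k l + R.1 i l k j = 0 := fun i j k l => by
    have a := hR (Pi.single i 1 + (1 : ℂ) • Pi.single k 1) (Pi.single j 1 + Pi.single l 1)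
    have b := hR (Pi.single i 1 + (-1 : ℂ) • Pi.single k 1) (Pi.single j 1 + Pi.single l 1)
    simp only [csec, star_add, star_smul, hstar, cEval_add₁, cEval_add₂, cEval_add₃, cEval_add₄,
      cEval_smul₁, cEval_smul₃, cEval_single, h2, h3, h4, star_neg, star_one,
      curv_pair_symm R k j i l, curv_pair_symm R k l i j] at a b
    norm_num at a b
    linarith
  refine Subtype.ext ?_
  ext i j k l
  have a := h5 i j k l
  have b := h5 i l j k
  have c := curv_bianchi R i j k l
  have d := curv_antisymm_right R i l k j
  have e := curv_antisymm_right R i k j l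
  have : R.1 i j k l = 0 := by linarith
  simpa using this

theorem posSemidef_smul_one_sub_iff {M : Matrix ι ι ℝ} (hM : M.IsSymm) (k : ℝ) :
    (k • (1 : Matrix ι ι ℝ) - M).PosSemidef ↔ ∀ u : ι → ℝ, u ⬝ᵥ u = 1 → u ⬝ᵥ M *ᵥ u ≤ k := by
  have hval : ∀ u : ι → ℝ, u ⬝ᵥ (k • (1 : Matrix ι ι ℝ) - M) *ᵥ u = k * (u ⬝ᵥ u) - u ⬝ᵥ M *ᵥ u :=
    fun u => by
      rw [sub_mulVec, smul_mulVec, one_mulVec, dotProduct_sub, dotProduct_smul, smul_eq_mul]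
  constructor
  · intro h u hu
    have := h.dotProduct_mulVec_nonneg u
    rw [star_trivial, hval, hu] at this
    linarith
  · intro h
    refine PosSemidef.of_dotProduct_mulVec_nonneg ?_ fun x => ?_
    · exact ((isSymm_one.smul k).sub hM)
    · rw [star_trivial, hval]
      by_cases hx : x = 0
      · simp [hx]
      have hpos : 0 < x ⬝ᵥ x := by
        have := dotProduct_star_self_pos_iff.2 hx
        simpa using this
      have hs : Real.sqrt (x ⬝ᵥ x) ^ 2 = x ⬝ᵥ x := Real.sq_sqrt hpos.le
      have hr : Real.sqrt (x ⬝ᵥ x) ≠ 0 := (Real.sqrt_pos.2 hpos).ne'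
      have := h ((Real.sqrt (x ⬝ᵥ x))⁻¹ • x) (by
        rw [smul_dotProduct, dotProduct_smul, smul_eq_mul, smul_eq_mul]
        nth_rewrite 3 [← hs]
        field_simp)
      rw [mulVec_smul, smul_dotProduct, dotProduct_smul, smul_eq_mul, smul_eq_mul, ← mul_assoc,
        ← mul_inv, ← sq, hs, inv_mul_le_iff₀ hpos] at this
      linarith

/-- The form `x ↦ S(u, x, u, x)` of a tensor with nonnegative complex sectional curvature. -/
theorem dotProduct_contr_le {S : AlgCurv ι} (hS : NonnegComplex S.1) {s : ℝ}
    (hric : ric S = s • (1 : Matrix ι ι ℝ)) {K : Matrix ι ι ℝ} {k : ℝ}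
    (hP : (k • (1 : Matrix ι ι ℝ) - K).PosSemidef) {u : ι → ℝ} (hu : u ⬝ᵥ u = 1) :
    u ⬝ᵥ contr S.1 K *ᵥ u ≤ s * k := by
  -- The Jacobi form `A = S(u, ·, u, ·)` is positive semidefinite with trace `Ric(u,u) = s`, and the
  -- claim is `tr(A(k id - K)) ≥ 0`.
  set A : Matrix ι ι ℝ := of fun p q => ∑ i, ∑ j, u i * S.1 i p j q * u j with hA
  have hcontr : ∀ M : Matrix ι ι ℝ, M.IsSymm → u ⬝ᵥ contr S.1 M *ᵥ u = (A * M).trace := by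
    intro M hM
    simp only [dotProduct, mulVec, contr, of_apply, trace, diag_apply, mul_apply, hA,
      Finset.sum_mul, Finset.mul_sum]
    have h : ∀ f : ι → ι → ι → ι → ℝ,
        ∑ i, ∑ j, ∑ k, ∑ l, f i j k l = ∑ k, ∑ l, ∑ i, ∑ j, f i j k l := by
      intro f
      have h : ∀ i, ∑ j, ∑ k, ∑ l, f i j k l = ∑ k, ∑ l, ∑ j, f i j k l := fun i => by
        rw [Finset.sum_comm]
        exact Finset.sum_congr rfl fun k _ => Finset.sum_comm
      simp only [h]
      rw [Finset.sum_comm]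
      exact Finset.sum_congr rfl fun k _ => Finset.sum_comm
    rw [h]
    refine Finset.sum_congr rfl fun p _ => Finset.sum_congr rfl fun q _ =>
      Finset.sum_congr rfl fun i _ => Finset.sum_congr rfl fun j _ => ?_
    rw [hM.apply p q]; ring
  have hApsd : A.PosSemidef := by
    refine PosSemidef.of_dotProduct_mulVec_nonneg ?_ fun x => ?_
    · ext p q
      simp only [hA, conjTranspose_apply, of_apply, star_trivial]
      rw [Finset.sum_comm]
      refine Finset.sum_congr rfl fun i _ => Finset.sum_congr rfl fun j _ => ?_
      rw [curv_pair_symm S]; ring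
    · have h := hS (cplx (WithLp.toLp 2 u)) (cplx (WithLp.toLp 2 x))
      rw [csec, star_cplx, star_cplx, cEval_cplx, Complex.ofReal_re] at h
      refine h.trans_eq ?_
      simp only [evalCurv, star_trivial, dotProduct, mulVec, hA, of_apply, Finset.sum_mul,
        Finset.mul_sum]
      rw [Finset.sum_comm]
      refine Finset.sum_congr rfl fun p _ => ?_
      have : ∀ i, ∑ k, ∑ l, S.1 i p k l * u i * x p * u k * x l =
          ∑ l, ∑ k, S.1 i p k l * u i * x p * u k * x l := fun i => Finset.sum_comm
      simp only [this]
      rw [Finset.sum_comm]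
      exact Finset.sum_congr rfl fun q _ => Finset.sum_congr rfl fun i _ =>
        Finset.sum_congr rfl fun j _ => by ring
  have hsymm : (k • (1 : Matrix ι ι ℝ) - K).IsSymm := by
    have := hP.1
    rwa [IsHermitian, conjTranspose_eq_transpose_of_trivial] at this
  have hKs : K.IsSymm := by
    have := (isSymm_one.smul k).sub hsymm
    simpa using this
  have htr := trace_mul_nonneg_of_posSemidef (𝕜 := ℝ) hApsd hP
  rw [mul_sub, trace_sub, ← hcontr K hKs, Matrix.mul_smul, trace_smul, ← hcontr 1 isSymm_one,
    contr_one, hric, smul_mulVec, one_mulVec, dotProduct_smul, hu, smul_eq_mul, smul_eq_mul] at htr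
  linarith

/-- A null vector of the positive form `k id - K` lies in its kernel, so `u` is an eigenvector of
`K`. -/
theorem dotProduct_sq_of_max {K : Matrix ι ι ℝ} {u : ι → ℝ} (hu : u ⬝ᵥ u = 1)
    (hP : ((u ⬝ᵥ K *ᵥ u) • (1 : Matrix ι ι ℝ) - K).PosSemidef) :
    u ⬝ᵥ (K * K) *ᵥ u = (u ⬝ᵥ K *ᵥ u) ^ 2 := by
  set k := u ⬝ᵥ K *ᵥ u with hk
  have h0 : star u ⬝ᵥ (k • (1 : Matrix ι ι ℝ) - K) *ᵥ u = 0 := by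
    rw [star_trivial, sub_mulVec, smul_mulVec, one_mulVec, dotProduct_sub, dotProduct_smul, hu,
      smul_eq_mul, mul_one, ← hk, sub_self]
  have h1 := (hP.dotProduct_mulVec_zero_iff u).1 h0
  rw [sub_mulVec, smul_mulVec, one_mulVec, sub_eq_zero] at h1
  rw [← mulVec_mulVec, ← h1, mulVec_smul, ← h1, dotProduct_smul, dotProduct_smul, hu]
  simp [sq]

end Flat
end
end PinchingCones

namespace PinchingCones

noncomputable section

open Matrix ComplexConjugate ComplexOrder MatrixOrder

/-! ### The cone in terms of the single parameter `h`, and the evolution on its two kinds of faces.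
-/

section Splitting

variable {n : ℕ}

/-- The rescaled trace-free Ricci tensor, that is the trace-free part of `H` in a decomposition
`R = S + H ∧ id` with `Ric₀(S) = 0`. -/
def kMat (R : AlgCurv (Fin n)) : Matrix (Fin n) (Fin n) ℝ := ((n : ℝ) - 2)⁻¹ • ric0 R

theorem scal_add (R T : AlgCurv (Fin n)) : scal (R + T) = scal R + scal T := by
  rw [scal, ric_add, trace_add, scal, scal]

theorem scal_smul (c : ℝ) (R : AlgCurv (Fin n)) : scal (c • R) = c * scal R := by
  rw [scal, ric_smul, trace_smul, scal, smul_eq_mul]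

theorem kMat_add (R T : AlgCurv (Fin n)) : kMat (R + T) = kMat R + kMat T := by
  simp only [kMat, ric0, ric_add, scal_add, add_div]
  module

theorem kMat_smul (c : ℝ) (R : AlgCurv (Fin n)) : kMat (c • R) = c • kMat R := by
  simp only [kMat, ric0, ric_smul, scal_smul, mul_div_assoc]
  module

theorem ric0_isSymm (R : AlgCurv (Fin n)) : (ric0 R).IsSymm :=
  (ric_isSymm R).sub (isSymm_one.smul _)

theorem kMat_isSymm (R : AlgCurv (Fin n)) : (kMat R).IsSymm := (ric0_isSymm R).smul _

theorem trace_kMat (hn : 5 ≤ n) (R : AlgCurv (Fin n)) : (kMat R).trace = 0 := by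
  have hn0 : (n : ℝ) ≠ 0 := by positivity
  have : (ric0 R).trace = 0 := by
    rw [ric0, trace_sub, trace_smul, trace_one, Fintype.card_fin, smul_eq_mul,
      div_mul_cancel₀ _ hn0, scal, sub_self]
  rw [kMat, trace_smul, this, smul_zero]

theorem add_smul_one_isSymm {K : Matrix (Fin n) (Fin n) ℝ} (hK : K.IsSymm) (h : ℝ) :
    (K + h • (1 : Matrix (Fin n) (Fin n) ℝ)).IsSymm := hK.add (isSymm_one.smul h)

/-- The curvature tensor `S = R - (K + h id) ∧ id` with `Ric₀(S) = 0`. -/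
def sPart (R : AlgCurv (Fin n)) (h : ℝ) : AlgCurv (Fin n) :=
  R - knAlg (kMat R + h • (1 : Matrix (Fin n) (Fin n) ℝ)) 1
    (add_smul_one_isSymm (kMat_isSymm R) h) isSymm_one

/-- The Einstein constant of `sPart R h`. -/
def sConst (R : AlgCurv (Fin n)) (h : ℝ) : ℝ := scal R / n - 2 * ((n : ℝ) - 1) * h

theorem eq_sPart_add (R : AlgCurv (Fin n)) (h : ℝ) :
    R.1 = (sPart R h).1 + kn (kMat R + h • (1 : Matrix (Fin n) (Fin n) ℝ)) 1 := by
  simp [sPart, knAlg]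

theorem ric_sPart (hn : 5 ≤ n) (R : AlgCurv (Fin n)) (h : ℝ) :
    ric (sPart R h) = sConst R h • (1 : Matrix (Fin n) (Fin n) ℝ) := by
  have hn2 : (n : ℝ) - 2 ≠ 0 := by
    have : (5 : ℝ) ≤ n := by exact_mod_cast hn
    linarith
  have h1 : sPart R h = R + (-1 : ℝ) • knAlg (kMat R + h • (1 : Matrix (Fin n) (Fin n) ℝ)) 1
    (add_smul_one_isSymm (kMat_isSymm R) h) isSymm_one := by
    rw [sPart, sub_eq_add_neg]
    exact congrArg _ (neg_one_smul ℝ _).symm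
  have h2 : ric R = ((n : ℝ) - 2) • kMat R + (scal R / n) • (1 : Matrix (Fin n) (Fin n) ℝ) := by
    rw [kMat, smul_smul, mul_inv_cancel₀ hn2, one_smul, ric0, Fintype.card_fin, sub_add_cancel]
  rw [h1, ric_add, ric_smul, ric_kn_one, trace_add, trace_kMat hn, trace_smul, trace_one,
    Fintype.card_fin, h2, sConst]
  module

theorem csec_sPart (R : AlgCurv (Fin n)) (h : ℝ) {z w : Fin n → ℂ} (hu : UnitaryPair z w) :
    csec (sPart R h).1 z w = csec R.1 z w - csec (kn (kMat R) 1) z w - 2 * h := by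
  have := congrArg (fun T => csec T z w) (eq_sPart_add R h)
  simp only [csec_add, kn_add_left, kn_smul_left, csec_smul, csec_one hu] at this
  linarith

/-- Comparing trace-free Ricci tensors identifies the trace-free part of `H` with `kMat R`; the
remaining unknown is `h = tr(H)/n`. -/
theorem mem_pinchingCone_iff (hn : 5 ≤ n) (σ θ : ℝ) (R : AlgCurv (Fin n)) :
    R ∈ pinchingCone n σ θ ↔ ∃ h : ℝ, NonnegComplex (sPart R h).1 ∧
      ((2 * σ * h) • (1 : Matrix (Fin n) (Fin n) ℝ) - ((n : ℝ) - 2 * σ) • kMat R).PosSemidef ∧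
      θ * sConst R h ≤ h := by
  have hn0 : (0 : ℝ) < n := by positivity
  have hn2 : (n : ℝ) - 2 ≠ 0 := by
    have : (5 : ℝ) ≤ n := by exact_mod_cast hn
    linarith
  have htr : ∀ h : ℝ, (kMat R + h • (1 : Matrix (Fin n) (Fin n) ℝ)).trace = n * h := fun h => by
    rw [trace_add, trace_kMat hn, trace_smul, trace_one, Fintype.card_fin, smul_eq_mul]; ring
  have hscal : ∀ h : ℝ, scal (sPart R h) = n * sConst R h := fun h => by
    rw [scal, ric_sPart hn, trace_smul, trace_one, Fintype.card_fin, smul_eq_mul]; ring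
  constructor
  · rintro ⟨S, H, hH, hR, hS, hS0, hpsd, hθ⟩
    have hRS : R = S + knAlg H 1 hH isSymm_one := Subtype.ext hR
    have hK : kMat R = H - (H.trace / n) • (1 : Matrix (Fin n) (Fin n) ℝ) := by
      have h1 : kMat (knAlg H 1 hH isSymm_one) =
          H - (H.trace / n) • (1 : Matrix (Fin n) (Fin n) ℝ) := by
        rw [kMat, ric0, scal, ric_kn_one, trace_add, trace_smul, trace_smul, trace_one,
          Fintype.card_fin, smul_eq_mul, smul_eq_mul, inv_smul_eq_iff₀ hn2]
        ext i j
        simp only [Matrix.smul_apply, Matrix.add_apply, Matrix.sub_apply, smul_eq_mul]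
        field_simp
        ring
      have h2 : kMat S = 0 := by rw [kMat, hS0, smul_zero]
      rw [hRS, kMat_add, h1, h2, zero_add]
    have hHK : kMat R + (H.trace / n) • (1 : Matrix (Fin n) (Fin n) ℝ) = H := by
      rw [hK, sub_add_cancel]
    have hSs : sPart R (H.trace / n) = S := by
      refine Subtype.ext ?_
      have h1 := eq_sPart_add R (H.trace / n)
      rw [hHK, hR] at h1
      exact (add_right_cancel h1).symm
    refine ⟨H.trace / n, ?_, ?_, ?_⟩
    · rw [hSs]; exact nonnegComplex_of_mem_PIC2 hS
    · convert hpsd using 1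
      rw [hK, smul_sub, smul_smul, ← sub_add, sub_add_eq_add_sub, ← add_smul]
      congr 2
      field_simp
      ring
    · have := hscal (H.trace / n)
      rw [hSs] at this
      rw [this] at hθ
      rw [le_div_iff₀ hn0]
      linarith
  · rintro ⟨h, h1, h2, h3⟩
    refine ⟨sPart R h, kMat R + h • (1 : Matrix (Fin n) (Fin n) ℝ),
      add_smul_one_isSymm (kMat_isSymm R) h, eq_sPart_add R h, mem_PIC2_of_nonnegComplex h1, ?_,
      ?_, ?_⟩
    · rw [ric0, hscal, ric_sPart hn, Fintype.card_fin, mul_div_cancel_left₀ _ hn0.ne', sub_self]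
    · convert h2 using 1
      rw [htr]
      module
    · rw [htr, hscal]
      have := mul_le_mul_of_nonneg_left h3 hn0.le
      linarith

theorem kMat_Q (hn : 5 ≤ n) (R : AlgCurv (Fin n)) (h : ℝ) :
    kMat (Q R) = hVel (sPart R h) (kMat R) (sConst R h) h -
      ((hVel (sPart R h) (kMat R) (sConst R h) h).trace / n) •
        (1 : Matrix (Fin n) (Fin n) ℝ) := by
  have hn0 : (n : ℝ) ≠ 0 := by positivity
  have hn2 : (n : ℝ) - 2 ≠ 0 := by
    have : (5 : ℝ) ≤ n := by exact_mod_cast hn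
    linarith
  rw [kMat, ric0, scal, ric_Q_decomposition (kMat_isSymm R) (trace_kMat hn R) (ric_sPart hn R h)
    (eq_sPart_add R h), trace_add, trace_smul, trace_smul, trace_one, Fintype.card_fin,
    inv_smul_eq_iff₀ hn2]
  ext i j
  simp only [Matrix.smul_apply, Matrix.add_apply, Matrix.sub_apply, smul_eq_mul]
  field_simp
  ring

theorem scal_Q (hn : 5 ≤ n) (R : AlgCurv (Fin n)) (h : ℝ) :
    scal (Q R) = 2 * ((n : ℝ) - 1) * (hVel (sPart R h) (kMat R) (sConst R h) h).trace
      + n * (2 * sConst R h ^ 2 + 2 * (kMat R * kMat R).trace) := by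
  rw [scal, ric_Q_decomposition (kMat_isSymm R) (trace_kMat hn R) (ric_sPart hn R h)
    (eq_sPart_add R h), trace_add, trace_smul, trace_smul, trace_one, Fintype.card_fin]
  simp only [smul_eq_mul]
  ring

theorem csec_Q_sub (hn : 5 ≤ n) (R : AlgCurv (Fin n)) (h : ℝ) {z w : Fin n → ℂ}
    (hu : UnitaryPair z w) :
    csec (Q R).1 z w - csec (kn (kMat (Q R)) 1) z w = csec (Q (sPart R h)).1 z w
      + csec (warp (kMat R)) z w
      + 2 * ((hVel (sPart R h) (kMat R) (sConst R h) h).trace / n) := by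
  rw [Q_decomposition (kMat_isSymm R) (trace_kMat hn R) (ric_sPart hn R h) (eq_sPart_add R h),
    kMat_Q hn R h, sub_eq_add_neg (hVel _ _ _ _), ← neg_smul, kn_add_left, kn_smul_left, csec_add,
    csec_add, csec_add, csec_smul, csec_one hu]
  ring

/-- The pinching quantity at a face on which the largest eigenvalue of `H` is critical. -/
theorem eigenvalue_face {R : AlgCurv (Fin n)} (hn : 5 ≤ n) {σ h : ℝ} (hσ : 0 < σ) (hσ2 : σ ≤ 2)
    (hS : NonnegComplex (sPart R h).1) {u : Fin n → ℝ} (hu : u ⬝ᵥ u = 1)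
    (hmax : ∀ u', u' ⬝ᵥ u' = 1 → u' ⬝ᵥ kMat R *ᵥ u' ≤ u ⬝ᵥ kMat R *ᵥ u)
    (hh : 2 * σ * h = ((n : ℝ) - 2 * σ) * (u ⬝ᵥ kMat R *ᵥ u)) {z w : Fin n → ℂ}
    (hzw : UnitaryPair z w) (h0 : csec (sPart R h).1 z w = 0) :
    let ℓ := csec (Q R).1 z w - csec (kn (kMat (Q R)) 1) z w
      - 2 * (((n : ℝ) - 2 * σ) / (2 * σ) * (u ⬝ᵥ kMat (Q R) *ᵥ u))
    (n * (u ⬝ᵥ kMat R *ᵥ u)) ^ 2 * (1 - σ) ^ 2 ≤ σ ^ 2 / 2 * ℓ ∨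
      (n * (u ⬝ᵥ kMat R *ᵥ u)) ^ 2 * (1 - σ / 2) ^ 2 ≤ σ ^ 2 / 2 * ℓ := by
  intro ℓ
  have hn5 : (5 : ℝ) ≤ n := by exact_mod_cast hn
  have hn0 : (0 : ℝ) < n := by positivity
  set K := kMat R with hK
  set k := u ⬝ᵥ K *ᵥ u with hk
  set s := sConst R h with hs
  set V := hVel (sPart R h) K s h with hV
  have hP : (k • (1 : Matrix (Fin n) (Fin n) ℝ) - K).PosSemidef :=
    (posSemidef_smul_one_sub_iff (kMat_isSymm R) k).2 hmax
  have hcontr := dotProduct_contr_le hS (ric_sPart hn R h) hP hu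
  have hsq := dotProduct_sq_of_max hu hP
  have hQ := csec_Q_nonneg hS h0
  have htr := trace_hVel (sPart R h) (trace_kMat hn R) (ric_sPart hn R h) h
  have hVu : u ⬝ᵥ V *ᵥ u = (2 * s + 4 * ((n : ℝ) - 2) * h) * k
      + 2 * (u ⬝ᵥ contr (sPart R h).1 K *ᵥ u) - 4 * k ^ 2
      + (4 * s * h + 4 * ((n : ℝ) - 1) * h ^ 2 + (K * K).trace) := by
    simp only [hV, hVel, add_mulVec, sub_mulVec, smul_mulVec, one_mulVec, dotProduct_add,
      dotProduct_sub, dotProduct_smul, smul_eq_mul, hu, hsq, Fintype.card_fin, ← hk]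
    ring
  rw [Fintype.card_fin] at htr
  have hKQ : u ⬝ᵥ kMat (Q R) *ᵥ u = u ⬝ᵥ V *ᵥ u - V.trace / n := by
    rw [kMat_Q hn R h, sub_mulVec, smul_mulVec, one_mulVec, dotProduct_sub, dotProduct_smul, hu,
      smul_eq_mul, mul_one]
  have hℓ : σ ^ 2 / 2 * ℓ = σ ^ 2 / 2 * csec (Q (sPart R h)).1 z w
      + σ ^ 2 / 2 * csec (warp K) z w
      + σ / 2 * (V.trace - ((n : ℝ) - 2 * σ) * (u ⬝ᵥ V *ᵥ u)) := by
    simp only [ℓ]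
    rw [csec_Q_sub hn R h hzw, hKQ]
    field_simp
    ring
  -- Discard the nonnegative contributions of `Q(S)` and of `sk - (S*K)(u,u)`. The face equation
  -- `hh` then eliminates `h` from the velocity, leaving exactly the quantity estimated by
  -- `warp_pinching`.
  have hge : n * ((n : ℝ) - 2 * σ) * k ^ 2 - σ * (2 - σ) * (K * K).trace
      + σ ^ 2 / 2 * csec (warp K) z w ≤ σ ^ 2 / 2 * ℓ := by
    have h1 : 0 ≤ σ ^ 2 / 2 * csec (Q (sPart R h)).1 z w := mul_nonneg (by positivity) hQ
    have hnσ : 0 < (n : ℝ) - 2 * σ := by linarith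
    have h2 : 0 ≤ σ * ((n : ℝ) - 2 * σ) * (s * k - u ⬝ᵥ contr (sPart R h).1 K *ᵥ u) :=
      mul_nonneg (mul_pos hσ hnσ).le (by linarith)
    have h3 : σ / 2 * (V.trace - ((n : ℝ) - 2 * σ) * (u ⬝ᵥ V *ᵥ u)) =
        n * ((n : ℝ) - 2 * σ) * k ^ 2 - σ * (2 - σ) * (K * K).trace
        + σ * ((n : ℝ) - 2 * σ) * (s * k - u ⬝ᵥ contr (sPart R h).1 K *ᵥ u) := by
      rw [htr, hVu]
      linear_combination (2 * σ * s + ((n : ℝ) - 1) * (2 * σ * h) + ((n : ℝ) - 2 * σ) * k) * hh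
    linarith
  have hw := warp_pinching (kMat_isSymm R) (trace_kMat hn R) hP
    (by rw [Fintype.card_fin]; omega) hσ.le hσ2 hzw
  rw [Fintype.card_fin] at hw
  exact hw.imp (fun a => a.trans hge) (fun a => a.trans hge)

/-- The pinching quantity at a face on which `tr(H) = θ scal(S)`. -/
theorem scalar_face {R : AlgCurv (Fin n)} (hn : 5 ≤ n) {σ θ h : ℝ} (hσ : 0 < σ) (hσ2 : σ ≤ 2)
    (hθ : 0 ≤ θ) (hθ2 : 32 * (n : ℝ) ^ 3 * θ ≤ 1)
    (hS : NonnegComplex (sPart R h).1) {k : ℝ}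
    (hP : (k • (1 : Matrix (Fin n) (Fin n) ℝ) - kMat R).PosSemidef)
    (hk : ((n : ℝ) - 2 * σ) * k ≤ 2 * σ * h) (hh : θ * sConst R h = h) {z w : Fin n → ℂ}
    (hzw : UnitaryPair z w) (h0 : csec (sPart R h).1 z w = 0) :
    let ℓ := csec (Q R).1 z w - csec (kn (kMat (Q R)) 1) z w
      - 2 * (θ / (1 + 2 * ((n : ℝ) - 1) * θ) * (scal (Q R) / n))
    0 ≤ ℓ ∧ h ^ 2 ≤ θ * (1 + 2 * ((n : ℝ) - 1) * θ) / 2 * ℓ := by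
  intro ℓ
  have hn5 : (5 : ℝ) ≤ n := by exact_mod_cast hn
  have hn0 : (0 : ℝ) < n := by positivity
  set K := kMat R with hK
  set s := sConst R h with hs
  set q := (K * K).trace with hq
  set c := 1 + 2 * ((n : ℝ) - 1) * θ with hc
  have hc1 : 1 ≤ c := by
    have : 0 ≤ 2 * ((n : ℝ) - 1) * θ := mul_nonneg (by linarith) hθ
    linarith
  have hQ := csec_Q_nonneg hS h0
  have htr := trace_hVel (sPart R h) (trace_kMat hn R) (ric_sPart hn R h) h
  have hw := csec_warp_ge (kMat_isSymm R) (by rw [Fintype.card_fin]; omega) hzw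
  have hqle := trace_sq_le (trace_kMat hn R) hP
  rw [Fintype.card_fin] at htr hw hqle
  rw [← hK, ← hq, ← hs] at htr
  rw [← hK, ← hq] at hw hqle
  have hq0 : 0 ≤ q := by
    have := (posSemidef_conjTranspose_mul_self K).trace_nonneg
    rwa [conjTranspose_eq_transpose_of_trivial, (kMat_isSymm R).eq] at this
  have hk0 : 0 ≤ k := by
    have := hP.trace_nonneg
    rw [trace_sub, trace_kMat hn, trace_smul, trace_one, Fintype.card_fin, smul_eq_mul,
      sub_zero] at this
    exact nonneg_of_mul_nonneg_left this hn0
  -- Here `n ≥ 5` and `σ ≤ 2` enter through `n - 2σ ≥ 1`.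
  have hk4 : k ≤ 4 * h := by
    have h1 : k ≤ ((n : ℝ) - 2 * σ) * k := le_mul_of_one_le_left hk0 (by linarith)
    have h2 : 0 ≤ h := by
      have : 0 ≤ 2 * σ * h := hk0.trans (h1.trans hk)
      exact nonneg_of_mul_nonneg_right this (by positivity)
    have h3 : 2 * σ * h ≤ 4 * h := mul_le_mul_of_nonneg_right (by linarith) h2
    linarith
  have hq16 : q ≤ 16 * (n : ℝ) ^ 2 * h ^ 2 := by
    have h1 : (n * k) ^ 2 ≤ (n * (4 * h)) ^ 2 :=
      pow_le_pow_left₀ (by positivity) (mul_le_mul_of_nonneg_left hk4 hn0.le) 2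
    calc q ≤ _ := hqle
      _ ≤ _ := h1
      _ = _ := by ring
  have hℓ : c / 2 * ℓ = c / 2 * csec (Q (sPart R h)).1 z w + c / 2 * csec (warp K) z w
      + (2 * s * h + 4 * ((n : ℝ) - 1) * h ^ 2 + ((n : ℝ) - 4) / n * q - 2 * θ * q) := by
    have hc0 : c ≠ 0 := by linarith
    have h1 : c / 2 * ℓ = c / 2 * csec (Q (sPart R h)).1 z w + c / 2 * csec (warp K) z w
        + c * ((hVel (sPart R h) K s h).trace / n) - θ * (scal (Q R) / n) := by
      simp only [ℓ]
      rw [csec_Q_sub hn R h hzw, ← hc]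
      field_simp
      ring
    rw [h1, scal_Q hn R h, ← hK, ← hs, ← hq, htr, hc]
    field_simp
    linear_combination (-4 * n * s) * hh
  -- The warp term costs at most `(n-2) q`, because `c/2 ≤ 1`, and the term `-2θq` at most `2q`.
  have hT : 2 * s * h - (n : ℝ) * q ≤ c / 2 * ℓ := by
    have hn3 : (n : ℝ) ≤ (n : ℝ) ^ 3 := by nlinarith [mul_pos hn0 hn0]
    have hnθ : 32 * ((n : ℝ) * θ) ≤ 1 := by nlinarith [mul_le_mul_of_nonneg_right hn3 hθ]
    have hθ1 : θ ≤ 1 := by nlinarith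
    have hc2 : c ≤ 2 := by rw [hc]; linarith
    have h1 : 0 ≤ c / 2 * csec (Q (sPart R h)).1 z w := mul_nonneg (by linarith) hQ
    have h2 : c / 2 * (-(((n : ℝ) - 2) * q)) ≤ c / 2 * csec (warp K) z w :=
      mul_le_mul_of_nonneg_left hw (by linarith)
    have h3 : c / 2 * (((n : ℝ) - 2) * q) ≤ 1 * (((n : ℝ) - 2) * q) :=
      mul_le_mul_of_nonneg_right (by linarith) (mul_nonneg (by linarith) hq0)
    have h4 : 0 ≤ 4 * ((n : ℝ) - 1) * h ^ 2 := mul_nonneg (by linarith) (sq_nonneg h)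
    have h5 : 0 ≤ ((n : ℝ) - 4) / n * q :=
      mul_nonneg (div_nonneg (by linarith) hn0.le) hq0
    have h6 : θ * q ≤ 1 * q := mul_le_mul_of_nonneg_right hθ1 hq0
    linarith
  -- Multiplying by `θ` turns `2sh` into `2h²`, and `θ n q ≤ 16 n³ θ h² ≤ h²/2`; this last estimate
  -- fixes the bound on `θ`.
  have hT' : h ^ 2 ≤ θ * (c / 2 * ℓ) := by
    have h1 := mul_le_mul_of_nonneg_left hT hθ
    have h2 : θ * (n * q) ≤ θ * (n * (16 * (n : ℝ) ^ 2 * h ^ 2)) := by gcongr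
    have h3 : 32 * (n : ℝ) ^ 3 * θ * h ^ 2 ≤ 1 * h ^ 2 :=
      mul_le_mul_of_nonneg_right hθ2 (sq_nonneg h)
    have h4 : θ * (2 * s * h) = 2 * h ^ 2 := by linear_combination 2 * h * hh
    nlinarith [sq_nonneg h]
  have hc2 : 0 < c / 2 := by linarith
  refine ⟨?_, hT'.trans_eq (by ring)⟩
  -- For `θ = 0` one cannot divide by `θ`, but then `h = 0`, hence `q = 0`, and `hT` gives the sign
  -- directly.
  rcases hθ.eq_or_lt with h1 | h1
  · have hh0 : h = 0 := by rw [← hh, ← h1, zero_mul]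
    have hq00 : q = 0 := le_antisymm (by simpa [hh0] using hq16) hq0
    rw [hh0, hq00] at hT
    exact nonneg_of_mul_nonneg_right (by linarith) hc2
  · have h2 : 0 ≤ θ * (c / 2 * ℓ) := (sq_nonneg h).trans hT'
    exact nonneg_of_mul_nonneg_right (nonneg_of_mul_nonneg_right h2 h1) hc2

end Splitting
end
end PinchingCones

namespace PinchingCones

noncomputable section

open Matrix ComplexConjugate ComplexOrder MatrixOrder

/-! ### The linear inequalities defining the cone and the null vector condition. -/

section Faces

variable {n : ℕ}

/-- The lower bounds for `tr(H) / n` in the definition of the cone: `b = 1` gives the bound by the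
eigenvalues of `H`, and `b = 0` the bound by the scalar curvature. -/
def hBound (σ θ b : ℝ) (u : Fin n → ℝ) (R : AlgCurv (Fin n)) : ℝ :=
  b * (((n : ℝ) - 2 * σ) / (2 * σ) * (u ⬝ᵥ kMat R *ᵥ u)) +
    (1 - b) * (θ / (1 + 2 * ((n : ℝ) - 1) * θ) * (scal R / n))

/-- The parameter space of the linear inequalities that define the cone. -/
abbrev FaceParam (n : ℕ) := ℝ × (Fin n → ℝ) × (Fin n → ℂ) × (Fin n → ℂ)

/-- The linear functionals that define the cone. -/
def faceFun (σ θ : ℝ) (v : FaceParam n) : AlgCurv (Fin n) →ₗ[ℝ] ℝ where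
  toFun R := csec R.1 v.2.2.1 v.2.2.2 - csec (kn (kMat R) 1) v.2.2.1 v.2.2.2
    - 2 * hBound σ θ v.1 v.2.1 R
  map_add' R T := by
    simp only [hBound, kMat_add, scal_add, kn_add_left, csec_add, add_mulVec, dotProduct_add,
      Submodule.coe_add]
    ring
  map_smul' c R := by
    simp only [hBound, kMat_smul, scal_smul, kn_smul_left, csec_smul, smul_mulVec,
      dotProduct_smul, Submodule.coe_smul, smul_eq_mul, RingHom.id_apply]
    ring

/-- The compact set of parameters. -/
def faceSet (n : ℕ) : Set (FaceParam n) :=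
  {v | (v.1 = 0 ∨ v.1 = 1) ∧ v.2.1 ⬝ᵥ v.2.1 = 1 ∧ UnitaryPair v.2.2.1 v.2.2.2}

/-- The left side does not involve `h`: it measures the gap between the upper bound for `h` set by
the plane and the chosen lower bound. Setting `h` equal to that lower bound leaves the curvature of
`S` alone. -/
theorem faceFun_eq_csec {σ θ : ℝ} {v : FaceParam n} (hv : v ∈ faceSet n) (R : AlgCurv (Fin n))
    (h : ℝ) : faceFun σ θ v R = csec (sPart R h).1 v.2.2.1 v.2.2.2
      + 2 * (h - hBound σ θ v.1 v.2.1 R) := by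
  rw [csec_sPart R h hv.2.2]
  simp only [faceFun, LinearMap.coe_mk, AddHom.coe_mk]
  ring

theorem norm_le_one_of_star_dotProduct {z : Fin n → ℂ} (hz : star z ⬝ᵥ z = 1) : ‖z‖ ≤ 1 := by
  rw [star_dotProduct_self_eq] at hz
  have hz' : ∑ i, Complex.normSq (z i) = 1 := by exact_mod_cast hz
  refine (pi_norm_le_iff_of_nonneg zero_le_one).2 fun i => ?_
  have h1 : Complex.normSq (z i) ≤ 1 := by
    rw [← hz']
    exact Finset.single_le_sum (fun j _ => Complex.normSq_nonneg (z j)) (Finset.mem_univ i)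
  rw [Complex.normSq_eq_norm_sq] at h1
  exact (sq_le_one_iff₀ (norm_nonneg _)).1 h1

theorem norm_le_one_of_dotProduct {u : Fin n → ℝ} (hu : u ⬝ᵥ u = 1) : ‖u‖ ≤ 1 := by
  refine (pi_norm_le_iff_of_nonneg zero_le_one).2 fun i => ?_
  have h1 : u i * u i ≤ 1 := by
    rw [← hu]
    exact Finset.single_le_sum (f := fun j => u j * u j) (fun j _ => mul_self_nonneg _)
      (Finset.mem_univ i)
  rw [Real.norm_eq_abs]
  exact abs_le_one_iff_mul_self_le_one.2 h1

theorem isCompact_unitSphere : IsCompact {u : Fin n → ℝ | u ⬝ᵥ u = 1} := by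
  refine Metric.isCompact_of_isClosed_isBounded ?_ ?_
  · refine isClosed_eq ?_ continuous_const
    simp only [dotProduct]
    fun_prop
  · refine (Metric.isBounded_closedBall (x := 0) (r := 1)).subset fun u hu => ?_
    rw [mem_closedBall_zero_iff]
    exact norm_le_one_of_dotProduct hu

theorem isCompact_faceSet : IsCompact (faceSet n) := by
  refine Metric.isCompact_of_isClosed_isBounded ?_ ?_
  · have h1 : IsClosed {v : FaceParam n | v.1 = 0 ∨ v.1 = 1} :=
      (isClosed_eq continuous_fst continuous_const).union
        (isClosed_eq continuous_fst continuous_const)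
    have h2 : IsClosed {v : FaceParam n | v.2.1 ⬝ᵥ v.2.1 = 1} := by
      refine isClosed_eq ?_ continuous_const
      simp only [dotProduct]
      fun_prop
    have h3 : IsClosed {v : FaceParam n | star v.2.2.1 ⬝ᵥ v.2.2.1 = 1} := by
      refine isClosed_eq ?_ continuous_const
      simp only [dotProduct, Pi.star_apply]
      fun_prop
    have h4 : IsClosed {v : FaceParam n | star v.2.2.2 ⬝ᵥ v.2.2.2 = 1} := by
      refine isClosed_eq ?_ continuous_const
      simp only [dotProduct, Pi.star_apply]
      fun_prop
    have h5 : IsClosed {v : FaceParam n | star v.2.2.1 ⬝ᵥ v.2.2.2 = 0} := by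
      refine isClosed_eq ?_ continuous_const
      simp only [dotProduct, Pi.star_apply]
      fun_prop
    exact h1.inter (h2.inter (h3.inter (h4.inter h5)))
  · refine (Metric.isBounded_closedBall (x := 0) (r := 1)).subset fun v hv => ?_
    rw [mem_closedBall_zero_iff]
    obtain ⟨hb, hu, hz, hw, -⟩ := hv
    refine max_le ?_ (max_le (norm_le_one_of_dotProduct hu)
      (max_le (norm_le_one_of_star_dotProduct hz) (norm_le_one_of_star_dotProduct hw)))
    rcases hb with h | h <;> simp [h]

theorem continuous_coord (i j k l : Fin n) : Continuous fun R : AlgCurv (Fin n) => R.1 i j k l :=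
  (continuous_apply l).comp ((continuous_apply k).comp ((continuous_apply j).comp
    ((continuous_apply i).comp continuous_subtype_val)))

theorem continuous_ric (i k : Fin n) : Continuous fun R : AlgCurv (Fin n) => ric R i k := by
  simp only [ric, of_apply]
  exact continuous_finsetSum _ fun j _ => continuous_coord i j k j

theorem continuous_scal : Continuous fun R : AlgCurv (Fin n) => scal R := by
  simp only [scal, trace, diag_apply]
  exact continuous_finsetSum _ fun i _ => continuous_ric i i

theorem continuous_kMat (i k : Fin n) : Continuous fun R : AlgCurv (Fin n) => kMat R i k := by
  have h1 := continuous_ric i k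
  have h2 := continuous_scal (n := n)
  simp only [kMat, ric0, Matrix.smul_apply, Matrix.sub_apply, smul_eq_mul]
  fun_prop

theorem continuous_csec {X : Type*} [TopologicalSpace X] {T : X → Tensor4 (Fin n)}
    {z w : X → Fin n → ℂ} (hT : ∀ i j k l, Continuous fun x => T x i j k l) (hz : Continuous z)
    (hw : Continuous w) : Continuous fun x => csec (T x) (z x) (w x) := by
  simp only [csec, cEval, Pi.star_apply]
  refine Complex.continuous_re.comp ?_
  refine continuous_finsetSum _ fun i _ => continuous_finsetSum _ fun j _ =>
    continuous_finsetSum _ fun k _ => continuous_finsetSum _ fun l _ => ?_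
  have h1 := hT i j k l
  fun_prop

theorem continuous_faceFun (σ θ : ℝ) :
    Continuous fun p : AlgCurv (Fin n) × FaceParam n => faceFun σ θ p.2 p.1 := by
  have hK : ∀ i k, Continuous fun p : AlgCurv (Fin n) × FaceParam n => kMat p.1 i k :=
    fun i k => (continuous_kMat i k).comp continuous_fst
  have hs : Continuous fun p : AlgCurv (Fin n) × FaceParam n => scal p.1 :=
    continuous_scal.comp continuous_fst
  have h1 : Continuous fun p : AlgCurv (Fin n) × FaceParam n =>
      csec p.1.1 p.2.2.2.1 p.2.2.2.2 :=
    continuous_csec (fun i j k l => (continuous_coord i j k l).comp continuous_fst)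
      (by fun_prop) (by fun_prop)
  have h2 : Continuous fun p : AlgCurv (Fin n) × FaceParam n =>
      csec (kn (kMat p.1) 1) p.2.2.2.1 p.2.2.2.2 :=
    continuous_csec (fun i j k l => by simp only [kn]; fun_prop) (by fun_prop) (by fun_prop)
  have h3 : Continuous fun p : AlgCurv (Fin n) × FaceParam n => hBound σ θ p.2.1 p.2.2.1 p.1 := by
    simp only [hBound, dotProduct, mulVec]
    fun_prop
  exact (h1.sub h2).sub (continuous_const.mul h3)

theorem exists_max_eigenvalue (hn : 5 ≤ n) (K : Matrix (Fin n) (Fin n) ℝ) :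
    ∃ u : Fin n → ℝ, u ⬝ᵥ u = 1 ∧ ∀ u', u' ⬝ᵥ u' = 1 → u' ⬝ᵥ K *ᵥ u' ≤ u ⬝ᵥ K *ᵥ u := by
  have hne : {u : Fin n → ℝ | u ⬝ᵥ u = 1}.Nonempty :=
    ⟨Pi.single ⟨0, by omega⟩ 1, by simp⟩
  have hc : Continuous fun u : Fin n → ℝ => u ⬝ᵥ K *ᵥ u := by
    simp only [dotProduct, mulVec]
    fun_prop
  obtain ⟨u, hu, hmax⟩ := isCompact_unitSphere.exists_isMaxOn hne hc.continuousOn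
  exact ⟨u, hu, fun u' hu' => hmax hu'⟩

theorem posSemidef_eigenvalue_iff {σ h : ℝ} (hσ : 0 < σ) {K : Matrix (Fin n) (Fin n) ℝ}
    (hK : K.IsSymm) :
    ((2 * σ * h) • (1 : Matrix (Fin n) (Fin n) ℝ) - ((n : ℝ) - 2 * σ) • K).PosSemidef ↔
      ∀ u : Fin n → ℝ, u ⬝ᵥ u = 1 → ((n : ℝ) - 2 * σ) / (2 * σ) * (u ⬝ᵥ K *ᵥ u) ≤ h := by
  rw [posSemidef_smul_one_sub_iff (hK.smul _)]
  refine forall₂_congr fun u _ => ?_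
  rw [smul_mulVec, dotProduct_smul, smul_eq_mul, div_mul_eq_mul_div, div_le_iff₀ (by positivity),
    mul_comm h]

theorem scalar_bound_iff (hn : 5 ≤ n) {θ : ℝ} (hθ : 0 ≤ θ) (R : AlgCurv (Fin n)) (h : ℝ) :
    θ * sConst R h ≤ h ↔ θ / (1 + 2 * ((n : ℝ) - 1) * θ) * (scal R / n) ≤ h := by
  have hn5 : (5 : ℝ) ≤ n := by exact_mod_cast hn
  have hc : 0 < 1 + 2 * ((n : ℝ) - 1) * θ := by
    have : 0 ≤ 2 * ((n : ℝ) - 1) * θ := mul_nonneg (by linarith) hθ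
    linarith
  rw [div_mul_eq_mul_div, div_le_iff₀ hc, sConst]
  constructor <;> intro h' <;> linarith

theorem hBound_one (σ θ : ℝ) (u : Fin n → ℝ) (R : AlgCurv (Fin n)) :
    hBound σ θ 1 u R = ((n : ℝ) - 2 * σ) / (2 * σ) * (u ⬝ᵥ kMat R *ᵥ u) := by
  rw [hBound]; ring

theorem hBound_zero (σ θ : ℝ) (u : Fin n → ℝ) (R : AlgCurv (Fin n)) :
    hBound σ θ 0 u R = θ / (1 + 2 * ((n : ℝ) - 1) * θ) * (scal R / n) := by
  rw [hBound]; ring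

/-- An admissible `h` exists exactly when every lower bound is at most every upper bound. In the
converse direction `h` is the larger of the scalar bound and the eigenvalue bound at a maximizing
unit vector. -/
theorem pinchingCone_eq_familyCone (hn : 5 ≤ n) {σ θ : ℝ} (hσ : 0 < σ) (hσ2 : σ ≤ 2)
    (hθ : 0 ≤ θ) : pinchingCone n σ θ = familyCone (faceSet n) (faceFun σ θ) := by
  have hn5 : (5 : ℝ) ≤ n := by exact_mod_cast hn
  have hcoef : 0 ≤ ((n : ℝ) - 2 * σ) / (2 * σ) := div_nonneg (by linarith) (by positivity)
  ext R
  rw [mem_pinchingCone_iff hn]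
  constructor
  · rintro ⟨h, h1, h2, h3⟩ v hv
    rw [posSemidef_eigenvalue_iff hσ (kMat_isSymm R)] at h2
    rw [scalar_bound_iff hn hθ] at h3
    rw [faceFun_eq_csec hv R h]
    have hb : hBound σ θ v.1 v.2.1 R ≤ h := by
      rcases hv.1 with hb | hb
      · rw [hb, hBound_zero]; exact h3
      · rw [hb, hBound_one]; exact h2 _ hv.2.1
    have := h1 v.2.2.1 v.2.2.2
    linarith
  · intro hR
    obtain ⟨u, hu, hmax⟩ := exists_max_eigenvalue hn (kMat R)
    have hS : ∀ b, (b = 0 ∨ b = 1) → NonnegComplex (sPart R (hBound σ θ b u R)).1 := by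
      intro b hb
      refine nonnegComplex_of_unitaryPair fun z w hzw => ?_
      have hv : ((b, u, z, w) : FaceParam n) ∈ faceSet n := ⟨hb, hu, hzw⟩
      have := hR _ hv
      rw [faceFun_eq_csec hv R (hBound σ θ b u R)] at this
      simpa using this
    have h1 : ∀ u' : Fin n → ℝ, u' ⬝ᵥ u' = 1 →
        ((n : ℝ) - 2 * σ) / (2 * σ) * (u' ⬝ᵥ kMat R *ᵥ u') ≤ hBound σ θ 1 u R := fun u' hu' => by
      rw [hBound_one]
      exact mul_le_mul_of_nonneg_left (hmax u' hu') hcoef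
    rcases le_total (hBound σ θ 0 u R) (hBound σ θ 1 u R) with hle | hle
    · refine ⟨_, hS 1 (Or.inr rfl), ?_, ?_⟩
      · rw [posSemidef_eigenvalue_iff hσ (kMat_isSymm R)]; exact h1
      · rw [scalar_bound_iff hn hθ]; rwa [hBound_zero] at hle
    · refine ⟨_, hS 0 (Or.inl rfl), ?_, ?_⟩
      · rw [posSemidef_eigenvalue_iff hσ (kMat_isSymm R)]
        exact fun u' hu' => (h1 u' hu').trans hle
      · rw [scalar_bound_iff hn hθ, hBound_zero]

/-- The null vector condition, with strict inequality in the transversal range. -/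
theorem null_vector_condition (hn : 5 ≤ n) {σ θ : ℝ} (hσ : 0 < σ) (hσ2 : σ ≤ 2)
    (hθ : 0 ≤ θ) (hθ2 : 32 * (n : ℝ) ^ 3 * θ ≤ 1) {R : AlgCurv (Fin n)}
    (hR : R ∈ familyCone (faceSet n) (faceFun σ θ)) {v : FaceParam n} (hv : v ∈ faceSet n)
    (h0 : faceFun σ θ v R = 0) :
    0 ≤ faceFun σ θ v (Q R) ∧
      (σ ≠ 1 → σ ≠ 2 → 0 < θ → R ≠ 0 → 0 < faceFun σ θ v (Q R)) := by
  have hn5 : (5 : ℝ) ≤ n := by exact_mod_cast hn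
  have hn0 : (0 : ℝ) < n := by linarith
  have hnσ : 0 < (n : ℝ) - 2 * σ := by linarith
  set h := hBound σ θ v.1 v.2.1 R with hh
  have hcs : csec (sPart R h).1 v.2.2.1 v.2.2.2 = 0 := by
    rw [faceFun_eq_csec hv R h, ← hh, sub_self, mul_zero, add_zero] at h0
    exact h0
  have hS : NonnegComplex (sPart R h).1 := by
    refine nonnegComplex_of_unitaryPair fun z w hzw => ?_
    have hv' : ((v.1, v.2.1, z, w) : FaceParam n) ∈ faceSet n := ⟨hv.1, hv.2.1, hzw⟩
    have := hR _ hv'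
    rw [faceFun_eq_csec hv' R h] at this
    simpa [← hh] using this
  -- Since the active plane is null for `S`, keeping it and varying the lower bound shows that the
  -- active bound is the largest one.
  have hbound : ∀ b u, (b = 0 ∨ b = 1) → u ⬝ᵥ u = 1 → hBound σ θ b u R ≤ h := by
    intro b u hb hu
    have hv' : ((b, u, v.2.2.1, v.2.2.2) : FaceParam n) ∈ faceSet n := ⟨hb, hu, hv.2.2⟩
    have := hR _ hv'
    rw [faceFun_eq_csec hv' R h] at this
    simp only [hcs] at this
    linarith
  obtain ⟨u₀, hu₀, hmax₀⟩ := exists_max_eigenvalue hn (kMat R)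
  have hP : ((u₀ ⬝ᵥ kMat R *ᵥ u₀) • (1 : Matrix (Fin n) (Fin n) ℝ) - kMat R).PosSemidef :=
    (posSemidef_smul_one_sub_iff (kMat_isSymm R) _).2 hmax₀
  have hk : ((n : ℝ) - 2 * σ) * (u₀ ⬝ᵥ kMat R *ᵥ u₀) ≤ 2 * σ * h := by
    have := hbound 1 u₀ (Or.inr rfl) hu₀
    rw [hBound_one, div_mul_eq_mul_div, div_le_iff₀ (by positivity)] at this
    linarith
  have hk0 : 0 ≤ u₀ ⬝ᵥ kMat R *ᵥ u₀ := by
    have := hP.trace_nonneg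
    rw [trace_sub, trace_kMat hn, trace_smul, trace_one, Fintype.card_fin, smul_eq_mul,
      sub_zero] at this
    exact nonneg_of_mul_nonneg_left this hn0
  have hhnonneg : 0 ≤ h := by
    have : 0 ≤ 2 * σ * h := (mul_nonneg hnσ.le hk0).trans hk
    exact nonneg_of_mul_nonneg_right this (by positivity)
  -- If `h = 0`, the eigenvalue bound kills `K`, so `R = S`, and the scalar bound with `θ > 0` gives
  -- `scal(R) ≤ 0`; rigidity then forces `R = 0`.
  have hhpos : 0 < θ → R ≠ 0 → 0 < h := by
    intro hθpos hR0
    refine hhnonneg.lt_of_ne fun hz => hR0 ?_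
    rw [← hz, mul_zero] at hk
    have hk00 : u₀ ⬝ᵥ kMat R *ᵥ u₀ = 0 :=
      le_antisymm (nonpos_of_mul_nonpos_right hk hnσ) hk0
    have hq := trace_sq_le (trace_kMat hn R) hP
    rw [hk00, mul_zero, zero_pow two_ne_zero] at hq
    have hK0 : kMat R = 0 := by
      rw [← trace_conjTranspose_mul_self_eq_zero_iff, conjTranspose_eq_transpose_of_trivial,
        (kMat_isSymm R).eq]
      refine le_antisymm hq ?_
      have := (posSemidef_conjTranspose_mul_self (kMat R)).trace_nonneg
      rwa [conjTranspose_eq_transpose_of_trivial, (kMat_isSymm R).eq] at this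
    have hRS : R = sPart R h := by
      refine Subtype.ext ?_
      have := eq_sPart_add R h
      rw [hK0, ← hz, zero_smul, zero_add] at this
      rw [← hz]
      refine this.trans ?_
      ext i j k l
      simp [kn]
    have hscal : scal R ≤ 0 := by
      have := hbound 0 u₀ (Or.inl rfl) hu₀
      rw [← hz, hBound_zero] at this
      have hc : 0 < 1 + 2 * ((n : ℝ) - 1) * θ := by
        have : 0 ≤ 2 * ((n : ℝ) - 1) * θ := mul_nonneg (by linarith) hθ
        linarith
      have h1 : scal R / n ≤ 0 := nonpos_of_mul_nonpos_right this (div_pos hθpos hc)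
      by_contra! hpos
      exact absurd h1 (not_le.2 (div_pos hpos hn0))
    rw [← hRS] at hS
    exact eq_zero_of_scal_nonpos hS hscal
  rcases hv.1 with hb | hb
  · have hθs : θ * sConst R h = h := by
      have hc : 0 < 1 + 2 * ((n : ℝ) - 1) * θ := by
        have : 0 ≤ 2 * ((n : ℝ) - 1) * θ := mul_nonneg (by linarith) hθ
        linarith
      have hh' : h * (1 + 2 * ((n : ℝ) - 1) * θ) = θ * (scal R / n) := by
        rw [hh, hb, hBound_zero, div_mul_eq_mul_div, div_mul_cancel₀ _ hc.ne']
      rw [sConst]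
      linarith
    have key := scalar_face hn hσ hσ2 hθ hθ2 hS hP hk hθs hv.2.2 hcs
    have hℓ : faceFun σ θ v (Q R) = csec (Q R).1 v.2.2.1 v.2.2.2
        - csec (kn (kMat (Q R)) 1) v.2.2.1 v.2.2.2
        - 2 * (θ / (1 + 2 * ((n : ℝ) - 1) * θ) * (scal (Q R) / n)) := by
      simp only [faceFun, LinearMap.coe_mk, AddHom.coe_mk, hb, hBound_zero]
    rw [hℓ]
    refine ⟨key.1, fun _ _ hθpos hR0 => key.1.lt_of_ne fun hz => ?_⟩
    have h2 := key.2
    rw [← hz, mul_zero] at h2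
    have := pow_pos (hhpos hθpos hR0) 2
    linarith
  · have hh' : 2 * σ * h = ((n : ℝ) - 2 * σ) * (v.2.1 ⬝ᵥ kMat R *ᵥ v.2.1) := by
      rw [hh, hb, hBound_one]
      field_simp
    have hmax : ∀ u', u' ⬝ᵥ u' = 1 → u' ⬝ᵥ kMat R *ᵥ u' ≤ v.2.1 ⬝ᵥ kMat R *ᵥ v.2.1 := by
      intro u' hu'
      have := hbound 1 u' (Or.inr rfl) hu'
      rw [hBound_one, div_mul_eq_mul_div, div_le_iff₀ (by positivity), mul_comm h, hh'] at this
      exact le_of_mul_le_mul_left this hnσ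
    have key := eigenvalue_face hn hσ hσ2 hS hv.2.1 hmax hh' hv.2.2 hcs
    have hℓ : faceFun σ θ v (Q R) = csec (Q R).1 v.2.2.1 v.2.2.2
        - csec (kn (kMat (Q R)) 1) v.2.2.1 v.2.2.2
        - 2 * (((n : ℝ) - 2 * σ) / (2 * σ) * (v.2.1 ⬝ᵥ kMat (Q R) *ᵥ v.2.1)) := by
      simp only [faceFun, LinearMap.coe_mk, AddHom.coe_mk, hb, hBound_one]
    simp only [← hℓ] at key
    have hσ22 : 0 < σ ^ 2 / 2 := by positivity
    refine ⟨?_, fun hσ1 hσ2' hθpos hR0 => ?_⟩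
    · refine (mul_nonneg_iff_of_pos_left hσ22).1 ?_
      rcases key with h1 | h1
      · exact le_trans (by positivity) h1
      · exact le_trans (by positivity) h1
    · have hkpos : 0 < v.2.1 ⬝ᵥ kMat R *ᵥ v.2.1 := by
        have h1 : 0 < 2 * σ * h := mul_pos (by positivity) (hhpos hθpos hR0)
        rw [hh'] at h1
        exact (mul_pos_iff_of_pos_left hnσ).1 h1
      -- Either lower bound is positive: `k > 0` because `h > 0`, and the factors `1 - σ` and `1 -
      -- σ/2` vanish only at the excluded values of `σ`.
      refine (mul_pos_iff_of_pos_left hσ22).1 ?_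
      rcases key with h1 | h1
      · refine lt_of_lt_of_le ?_ h1
        have : 1 - σ ≠ 0 := sub_ne_zero.2 (Ne.symm hσ1)
        positivity
      · refine lt_of_lt_of_le ?_ h1
        have : 1 - σ / 2 ≠ 0 := by
          intro h2; apply hσ2'; linarith
        positivity

/-- Provides the direction `e = id ∧ id` into the interior of the cone that the maximum principle
uses for its barrier. -/
theorem faceFun_knAlg_one_pos (hn : 5 ≤ n) {σ θ : ℝ} (hθ : 0 ≤ θ) {v : FaceParam n}
    (hv : v ∈ faceSet n) : 0 < faceFun σ θ v (knAlg 1 1 isSymm_one isSymm_one) := by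
  have hn5 : (5 : ℝ) ≤ n := by exact_mod_cast hn
  have hn0 : (n : ℝ) ≠ 0 := by positivity
  have hc : 0 < 1 + 2 * ((n : ℝ) - 1) * θ := by
    have : 0 ≤ 2 * ((n : ℝ) - 1) * θ := mul_nonneg (by linarith) hθ
    linarith
  have hscal : scal (knAlg (1 : Matrix (Fin n) (Fin n) ℝ) 1 isSymm_one isSymm_one) / n =
      2 * ((n : ℝ) - 1) := by
    rw [scal, ric_kn_one, trace_add, trace_smul, trace_smul, trace_one, Fintype.card_fin]
    simp only [smul_eq_mul]
    field_simp
    ring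
  have hK : kMat (knAlg (1 : Matrix (Fin n) (Fin n) ℝ) 1 isSymm_one isSymm_one) = 0 := by
    rw [kMat, ric0, Fintype.card_fin, hscal, ric_kn_one, trace_one, Fintype.card_fin, ← add_smul,
      ← sub_smul]
    have : (n : ℝ) - 2 + n - 2 * (n - 1) = 0 := by ring
    rw [this, zero_smul, smul_zero]
  have hkn : kn (0 : Matrix (Fin n) (Fin n) ℝ) 1 = 0 := by
    ext i j k l; simp [kn]
  have hcz : csec (0 : Tensor4 (Fin n)) v.2.2.1 v.2.2.2 = 0 := by
    simp [csec, cEval]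
  have hone : csec (knAlg (1 : Matrix (Fin n) (Fin n) ℝ) 1 isSymm_one isSymm_one).1 v.2.2.1
      v.2.2.2 = 2 := csec_one hv.2.2
  simp only [faceFun, LinearMap.coe_mk, AddHom.coe_mk, hK, hkn, hcz, hone]
  rcases hv.1 with hb | hb
  · rw [hb, hBound_zero, hscal]
    have : 2 - 0 - 2 * (θ / (1 + 2 * ((n : ℝ) - 1) * θ) * (2 * ((n : ℝ) - 1))) =
        2 / (1 + 2 * ((n : ℝ) - 1) * θ) := by
      rw [eq_div_iff hc.ne', div_mul_eq_mul_div, sub_mul, mul_assoc 2 (_ / _),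
        div_mul_cancel₀ _ hc.ne']
      ring
    rw [this]
    positivity
  · rw [hb, hBound_one, hK]
    simp

theorem curvB_smul_self (c : ℝ) (T : Tensor4 (Fin n)) :
    curvB (c • T) (c • T) = c ^ 2 • curvB T T := by
  ext i j k l
  simp only [curvB, Pi.smul_apply, smul_eq_mul, mul_add, Finset.mul_sum]
  congr 1
  · exact Finset.sum_congr rfl fun p _ => Finset.sum_congr rfl fun q _ => by ring
  · exact Finset.sum_congr rfl fun p _ => Finset.sum_congr rfl fun q _ => by ring

/-- The difference quotient of `Q` in the direction of `id ∧ id`. -/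
def qQuotient (R : AlgCurv (Fin n)) (δ : ℝ) : AlgCurv (Fin n) :=
  (4 : ℝ) • knAlg (ric R) 1 (ric_isSymm R) isSymm_one +
    δ • Q (knAlg 1 1 isSymm_one isSymm_one)

/-- Since `Q` is quadratic, its increment along `id ∧ id` is exactly divisible by `δ`. Continuity of
the quotient takes the place of a Lipschitz estimate in the maximum principle. -/
theorem Q_add_smul_one (R : AlgCurv (Fin n)) (δ : ℝ) :
    Q (R + δ • knAlg 1 1 isSymm_one isSymm_one) = Q R + δ • qQuotient R δ := by
  refine Subtype.ext ?_
  have h1 : curvB R.1 (δ • kn 1 1) = (2 * δ) • kn (ric R) 1 := by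
    rw [← kn_smul_left, curvB_kn_one R (isSymm_one.smul δ), contr_smul_right, contr_one,
      kn_smul_left, kn_smul_right]
    module
  change curvB (R.1 + δ • kn 1 1) (R.1 + δ • kn 1 1) = curvB R.1 R.1 +
    δ • ((4 : ℝ) • kn (ric R) 1 + δ • curvB (kn 1 1) (kn 1 1))
  rw [curvB_add_self, curvB_smul_self, h1]
  module

theorem continuous_qQuotient :
    Continuous fun p : AlgCurv (Fin n) × ℝ => qQuotient p.1 p.2 := by
  have hk : Continuous fun p : AlgCurv (Fin n) × ℝ =>
      knAlg (ric p.1) 1 (ric_isSymm p.1) isSymm_one := by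
    refine Continuous.subtype_mk ?_ _
    have hr : ∀ i k, Continuous fun p : AlgCurv (Fin n) × ℝ => ric p.1 i k :=
      fun i k => (continuous_ric i k).comp continuous_fst
    refine continuous_pi fun i => continuous_pi fun j => continuous_pi fun k =>
      continuous_pi fun l => ?_
    simp only [kn]
    fun_prop
  exact (hk.const_smul (4 : ℝ)).add (continuous_snd.smul continuous_const)

end Faces
end
end PinchingCones

theorem mainTheorem3 (n : ℕ) (hn : 5 ≤ n) :
    ∃ θbar : ℝ, 0 < θbar ∧
      (∀ σ ∈ Set.Ioc (0 : ℝ) 2, ∀ θ ∈ Set.Icc 0 θbar,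
        PinchingCones.HamiltonInvariant (PinchingCones.pinchingCone n σ θ)) ∧
      (∀ σ ∈ Set.Ioo (0 : ℝ) 1 ∪ Set.Ioo (1 : ℝ) 2, ∀ θ ∈ Set.Ioo 0 θbar,
        PinchingCones.TransversallyInvariantAwayFromZero
          (PinchingCones.pinchingCone n σ θ)) := by
  have hn0 : (0 : ℝ) < 32 * (n : ℝ) ^ 3 := by positivity
  have hbar : ∀ θ : ℝ, θ ≤ 1 / (32 * (n : ℝ) ^ 3) → 32 * (n : ℝ) ^ 3 * θ ≤ 1 := fun θ h => by
    rwa [le_div_iff₀ hn0, mul_comm] at h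
  -- The constant is the one required by the scalar face; the eigenvalue face imposes no restriction
  -- on `θ`.
  refine ⟨1 / (32 * (n : ℝ) ^ 3), by positivity, ?_, ?_⟩
  · intro σ hσ θ hθ T R hsol hR0 t ht
    rw [PinchingCones.pinchingCone_eq_familyCone hn hσ.1 hσ.2 hθ.1] at hR0 ⊢
    exact PinchingCones.mem_familyCone_of_null_vector_condition
      (E := PinchingCones.AlgCurv (Fin n)) (PinchingCones.isCompact_faceSet (n := n))
      (PinchingCones.continuous_faceFun σ θ)
      (fun v hv => PinchingCones.faceFun_knAlg_one_pos hn hθ.1 hv)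
      PinchingCones.continuous_qQuotient PinchingCones.Q_add_smul_one
      (fun x hx v hv h0 => (PinchingCones.null_vector_condition hn hσ.1 hσ.2 hθ.1
        (hbar θ hθ.2) hx hv h0).1) hsol hR0 ht
  · intro σ hσ θ hθ R hR hR0
    have hσ' : 0 < σ ∧ σ < 2 ∧ σ ≠ 1 := by
      rcases hσ with h | h
      · exact ⟨h.1, by linarith [h.2], h.2.ne⟩
      · exact ⟨by linarith [h.1], h.2, h.1.ne'⟩
    rw [PinchingCones.pinchingCone_eq_familyCone hn hσ'.1 hσ'.2.1.le hθ.1.le] at hR ⊢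
    exact PinchingCones.mem_interior_posTangentConeAt_familyCone
      (E := PinchingCones.AlgCurv (Fin n)) (PinchingCones.isCompact_faceSet (n := n))
      (PinchingCones.continuous_faceFun σ θ) hR
      (fun v hv h0 => (PinchingCones.null_vector_condition hn hσ'.1 hσ'.2.1.le hθ.1.le
        (hbar θ hθ.2.le) hR hv h0).2 hσ'.2.2 hσ'.2.1.ne hθ.1 hR0)
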